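/- **Definitions.** A *tangle* is a connected (non-empty) topological space $\mathcal T$ that can be built by taking finitely many disjoint copies of $[0,1]$ and identifying some of their endpoints. A point has *degree* $k$ if it has an open neighbourhood homeomorphic to $k$ copies of $[0,1)$ with all the $0$s identified, the point corresponding to the common $0$; points of degree $1$ or of degree at least $3$ are *singular*. The *edges* of $\mathcal T$ are the connected components left when all singular points are removed. The multigraph $G_{\mathcal T}$ (loops and parallel edges allowed) has the singular points as vertices and the edges of $\mathcal T$ as edges; for the circle, the only tangle without singular points, $G_{\mathcal T}$ is one vertex (an arbitrary point of $\mathcal T$) with one loop. $G^\dagger_{\mathcal T}$ is obtained from $G_{\mathcal T}$ by inserting one vertex of degree $2$ along each edge. *Orderings.* A *bipolar numbering* of a multigraph is an enumeration $v_1,\dots,v_k$ of its vertices such that every $v_j$ with $j>1$ is adjacent to some $v_i$ with $i<j$, and every $v_m$ with $m<k$ is adjacent to some $v_n$ with $n>m$. A *bipolar ordering* of $\mathcal T$ is a linear order on its points such that, for every $a\in\mathcal T$, the sets $\{x<a\}$, $\{x\le a\}$, $\{x>a\}$, $\{x\ge a\}$ are connected (the empty set counts as connected). *Allocations.* Identify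 each of the $m$ edges $e_1,\dots,e_m$ (with its ends) with a copy of $[0,1]$. A point $z=(x_1,y_1,\dots,x_m,y_m)\in\mathbb R^{2m}$ then determines a closed set $X(z)\subseteq\mathcal T$, the union over $i$ of the parts of $e_i$ that correspond to $[x_i,y_i]\cap[0,1]$. A *monotone continuous valuation* assigns a real number $\nu(X)\ge 0$ to every connected $X\subseteq\mathcal T$ such that $\nu(\emptyset)=0$, $\nu(X)\le\nu(Y)$ whenever $X\subseteq Y$, and, for every such identification, $z\mapsto\nu(X(z))$ is continuous on the set of those $z$ for which $X(z)$ is connected. $\mathcal T$ *guarantees connected EF allocations for two agents* if for all monotone continuous valuations $\nu_1,\nu_2$ there is a partition of $\mathcal T$ into two connected sets $A_1,A_2$ (a share may be empty) with $\nu_1(A_1)\ge\nu_1(A_2)$ and $\nu_2(A_2)\ge\nu_2(A_1)$. *Cutsets.* A *subtangle* is a set consisting of one or more singular points, possibly together with some edges all of whose ends are among these points. A *generalized gap $\ge2$ cutset of cardinality $t$* is a family of pairwise disjoint connected subtangles $X_1,\dots,X_t$ for which there are $t+2$ distinct connected components $C_1,\dots,C_{t+2}$ of $\mathcal T\setminus\bigcup_i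 X_i$ such that (a) every $X_i\cap\overline{C_j}$ is empty or a single point, the *contact point* of $X_i$ and $C_j$; and (b) every $X_i$ either is a single point, or has more than one point, has a contact point with exactly three of the $C_j$, and these contact points are distinct. *Blocks and tridents.* A *separating vertex* of a connected multigraph $G$ is a vertex $v$ such that $G$ decomposes into two connected subgraphs, each with at least one edge and with no edge in common, whose only common vertex is $v$. A *block* of $G$ is a maximal subgraph that is connected and has no separating vertex. The *block graph* $B(G)$ is the bipartite graph on the blocks and the separating vertices of $G$ in which a block is adjacent to the separating vertices that it contains. A *trident* of $G$ consists of connected subgraphs $C,P_1,P_2,P_3$ such that each $P_i$ has at least two vertices and has exactly one vertex $s_i$ in common with $C$; for $i\ne j$ every path from a vertex of $P_i$ to a vertex of $P_j$ passes through both $s_i$ and $s_j$; and either $C$ has a single vertex or $s_1,s_2,s_3$ are distinct. **Theorem.** For every tangle $\mathcal T$ the following are equivalent: 1. $G^\dagger_{\mathcal T}$ admits a bipolar numbering. 2. $\mathcal T$ admits a bipolar ordering. 3. $\mathcal T$ guarantees connected EF allocations for two agents with monotone continuous valuations. 4. $\mathcal T$ has no generalized gap $\ge2$ cutset of cardinality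 $1$. 5. The block graph $B(G_{\mathcal T})$ is a path (a single vertex counts as a path). 6. The block graph $B(G^\dagger_{\mathcal T})$ is a path; equivalently, $G^\dagger_{\mathcal T}$ has no trident. In particular, (2), (3) and (4), which concern the tangle alone, are equivalent for every tangle. -/

import Mathlib

open Set

namespace TangleDivision

/-! ## Tangles -/

section Tangles

variable (T : Type*) [TopologicalSpace T]

/-- A tangle: a connected (in particular non-empty) space that is the quotient of finitely many
disjoint copies of `[0, 1]` by an equivalence relation that identifies only endpoints. -/
def IsTangle : Prop :=
  ConnectedSpace T ∧
    ∃ (n : ℕ) (q : Fin n × unitInterval → T), Topology.IsQuotientMap q ∧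
      ∀ a b, q a = q b → a = b ∨ ((a.2 = 0 ∨ a.2 = 1) ∧ (b.2 = 0 ∨ b.2 = 1))

/-- The star with `k` rays: `k` copies of `[0, 1)` with all the zeros identified, realised as
the union of the half-open unit segments on the `k` coordinate axes of `ℝᵏ`. -/
def Star (k : ℕ) : Set (Fin k → ℝ) :=
  {v | (∀ i, v i ∈ Ico (0 : ℝ) 1) ∧ ∀ i j, v i ≠ 0 → v j ≠ 0 → i = j}

variable {T}

/-- `x` has degree `k`: an open neighbourhood of `x` is homeomorphic to the star with `k` rays,
`x` corresponding to its centre. -/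
def HasDegree (x : T) (k : ℕ) : Prop :=
  ∃ (U : Set T) (hx : x ∈ U) (h : U ≃ₜ Star k), IsOpen U ∧ (h ⟨x, hx⟩ : Fin k → ℝ) = 0

/-- Singular points: the points of degree `1` or of degree at least `3`. -/
def IsSingular (x : T) : Prop := ∃ k, (k = 1 ∨ 3 ≤ k) ∧ HasDegree x k

/-- The connected components of the subspace `S`, as subsets of `T`. -/
def componentsOf (S : Set T) : Set (Set T) := {e | ∃ x ∈ S, e = connectedComponentIn S x}

variable (T)

/-- The edges of a tangle: the components left when all singular points are removed. -/
def edges : Set (Set T) := componentsOf {x : T | ¬ IsSingular x}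

/-- `T` admits a bipolar ordering (the empty set counts as connected here). -/
def HasBipolarOrdering : Prop :=
  ∃ _ : LinearOrder T, ∀ a : T,
    IsPreconnected {x : T | x < a} ∧ IsPreconnected {x : T | x ≤ a} ∧
    IsPreconnected {x : T | a < x} ∧ IsPreconnected {x : T | a ≤ x}

end Tangles

/-! ## Valuations and envy-free allocations -/

section Valuations

variable {T : Type*} [TopologicalSpace T]

/-- `φ` identifies every edge `e` of `T`, with its ends, with a copy of `[0, 1]`: `φ e` runs
continuously through the closure of `e`, and runs injectively inside `e` on `(0, 1)`. -/
structure IsEdgeIdentification (φ : edges T → unitInterval → T) : Prop where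
  continuous : ∀ e, Continuous (φ e)
  injOn : ∀ e, InjOn (φ e) (Ioo 0 1)
  mapsTo : ∀ e, MapsTo (φ e) (Ioo 0 1) e.1
  range_eq : ∀ e, range (φ e) = closure e.1

/-- The closed set that meets the edge `e` in the interval `[x, y] ∩ [0, 1]`, `(x, y) = z e`,
(empty when `y < x`), for every edge `e`. -/
def closedPiece (φ : edges T → unitInterval → T) (z : edges T → ℝ × ℝ) : Set T :=
  ⋃ e, φ e '' {t : unitInterval | (z e).1 ≤ (t : ℝ) ∧ (t : ℝ) ≤ (z e).2}

/-- `ν` is a monotone continuous valuation of the connected subsets (including `∅`) of `T`.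
The values of `ν` at disconnected sets play no role. -/
structure IsMonotoneContinuous (ν : Set T → ℝ) : Prop where
  nonneg : ∀ X, IsPreconnected X → 0 ≤ ν X
  empty : ν ∅ = 0
  mono : ∀ X Y, IsPreconnected X → IsPreconnected Y → X ⊆ Y → ν X ≤ ν Y
  continuousOn : ∀ φ : edges T → unitInterval → T, IsEdgeIdentification φ →
    ContinuousOn (fun z => ν (closedPiece φ z)) {z | IsPreconnected (closedPiece φ z)}

variable (T)

/-- `T` guarantees connected envy-free allocations for `n` agents with monotone continuous
valuations. -/
def GuaranteesConnectedEF (n : ℕ) : Prop :=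
  ∀ ν : Fin n → Set T → ℝ, (∀ i, IsMonotoneContinuous (ν i)) →
    ∃ A : Fin n → Set T, (∀ i, IsPreconnected (A i)) ∧
      (∀ i j, i ≠ j → Disjoint (A i) (A j)) ∧ (⋃ i, A i) = univ ∧
      ∀ i j, ν i (A j) ≤ ν i (A i)

end Valuations

/-! ## Generalized cutsets -/

section Cutsets

variable {T : Type*} [TopologicalSpace T]

/-- A subtangle: one or more singular points, possibly together with some of the edges
joining these points. -/
def IsSubtangle (X : Set T) : Prop :=
  ∃ (A : Set T) (F : Set (Set T)), A.Nonempty ∧ (∀ x ∈ A, IsSingular x) ∧ F ⊆ edges T ∧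
    (∀ e ∈ F, closure e \ e ⊆ A) ∧ X = A ∪ ⋃₀ F

/-- `X` (consisting of `t` sets) is a generalized gap `≥ 2` cutset, with `t + 2` of the
components of the complement chosen as `C`. -/
structure IsGenGapCutset {t : ℕ} (X : Fin t → Set T) (C : Fin (t + 2) → Set T) : Prop where
  subtangle : ∀ i, IsSubtangle (X i)
  connected : ∀ i, IsConnected (X i)
  disjoint : ∀ i i', i ≠ i' → Disjoint (X i) (X i')
  component : ∀ j, C j ∈ componentsOf (⋃ i, X i)ᶜ
  injective : Function.Injective C
  /-- at most one contact point for each `X i` and `C j` -/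
  contact : ∀ i j, (X i ∩ closure (C j)).Subsingleton
  /-- type I: a single point; type II: more than one point, exactly three of the `C j` have a
  contact point with `X i`, and these contact points are distinct -/
  type : ∀ i, (∃ p, X i = {p}) ∨
    ((X i).Nontrivial ∧ {j | (X i ∩ closure (C j)).Nonempty}.ncard = 3 ∧
      ∀ j j', j ≠ j' → Disjoint (X i ∩ closure (C j)) (X i ∩ closure (C j')))

variable (T)

/-- `T` has a generalized gap `≥ 2` cutset of cardinality `t`. -/
def HasGenGapCutset (t : ℕ) : Prop :=
  ∃ (X : Fin t → Set T) (C : Fin (t + 2) → Set T), IsGenGapCutset X C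

end Cutsets

/-! ## Multigraphs -/

section Multigraphs

open scoped Graph

variable {α β : Type*}

/-- A multigraph is connected: it has a vertex, and any two vertices are joined by a walk. -/
def GraphConnected (G : Graph α β) : Prop :=
  V(G).Nonempty ∧ ∀ x ∈ V(G), ∀ y ∈ V(G), Relation.ReflTransGen G.Adj x y

/-- `v` is a separating vertex of `G`: `G` decomposes into two connected subgraphs, each with at
least one edge, that have only the vertex `v` in common. (So a vertex that carries a loop and
lies on another edge is separating.) -/
def IsSeparatingVertex (G : Graph α β) (v : α) : Prop :=
  ∃ H₁ H₂ : Graph α β, H₁ ≤ G ∧ H₂ ≤ G ∧ GraphConnected H₁ ∧ GraphConnected H₂ ∧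
    E(H₁).Nonempty ∧ E(H₂).Nonempty ∧ Disjoint E(H₁) E(H₂) ∧
    E(H₁) ∪ E(H₂) = E(G) ∧ V(H₁) ∪ V(H₂) = V(G) ∧ V(H₁) ∩ V(H₂) = {v}

/-- A non-separable multigraph: connected, without separating vertices. -/
def IsNonseparable (G : Graph α β) : Prop :=
  GraphConnected G ∧ ∀ v, ¬ IsSeparatingVertex G v

/-- A block of `G`: a maximal non-separable subgraph. -/
def IsBlock (G B : Graph α β) : Prop := Maximal (fun H => H ≤ G ∧ IsNonseparable H) B

/-- The block graph `B(G)`: its vertices are the blocks and the separating vertices of `G`, and a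
block is adjacent to the separating vertices that belong to it. -/
def blockGraph (G : Graph α β) :
    SimpleGraph ({B : Graph α β // IsBlock G B} ⊕ {v : α // IsSeparatingVertex G v}) :=
  SimpleGraph.fromRel fun a b =>
    match a, b with
    | Sum.inl B, Sum.inr v => v.1 ∈ V(B.1)
    | _, _ => False

/-- A simple graph is a path (with at least one vertex; a single vertex is a path). -/
def IsPathGraph {W : Type*} (H : SimpleGraph W) : Prop :=
  ∃ n : ℕ, 1 ≤ n ∧ Nonempty (H ≃g SimpleGraph.pathGraph n)

/-- `G` admits a bipolar numbering: an enumeration of its vertices in which every vertex but the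
first is adjacent to an earlier one, and every vertex but the last to a later one. -/
def HasBipolarNumbering (G : Graph α β) : Prop :=
  ∃ (k : ℕ) (v : Fin k → α), Function.Injective v ∧ range v = V(G) ∧
    (∀ j : Fin k, 0 < (j : ℕ) → ∃ i < j, G.Adj (v i) (v j)) ∧
    (∀ m : Fin k, (m : ℕ) + 1 < k → ∃ n > m, G.Adj (v m) (v n))

/-- `G` has a trident: connected subgraphs `C`, `P 0`, `P 1`, `P 2` such that each `P i` has
exactly one vertex `s i` in common with `C` and has at least two vertices, every path from `P i`
to `P j` (`i ≠ j`) passes through both `s i` and `s j`, and either `C` is a single vertex or the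
three contact vertices `s i` are distinct. -/
def HasTrident (G : Graph α β) : Prop :=
  ∃ (C : Graph α β) (P : Fin 3 → Graph α β) (s : Fin 3 → α),
    C ≤ G ∧ GraphConnected C ∧ (∀ i, P i ≤ G ∧ GraphConnected (P i)) ∧
    (∀ i, V(P i) ∩ V(C) = {s i}) ∧ (∀ i, V(P i).Nontrivial) ∧
    (∀ i j, i ≠ j → ∀ w : List α, w.IsChain G.Adj → w.Nodup →
      (∃ x ∈ V(P i), w.head? = some x) → (∃ y ∈ V(P j), w.getLast? = some y) →
      s i ∈ w ∧ s j ∈ w) ∧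
    ((∃ v, V(C) = {v}) ∨ Function.Injective s)

/-- The half-edges of `G`, as triples: `(e, x, false)` for an end `x` of the edge `e`, and a second
one `(e, x, true)` when `e` is a loop at `x`. So each edge has exactly two half-edges. -/
def IsHalfEdge (G : Graph α β) (h : β × α × Bool) : Prop :=
  (h.2.2 = false ∧ G.Inc h.1 h.2.1) ∨ (h.2.2 = true ∧ G.IsLoopAt h.1 h.2.1)

/-- `G` with one new vertex of degree `2` inserted along each edge: the new vertices are the edges
of `G`, and each half-edge of `G` becomes an edge from its end to the new vertex. -/
def subdivideOnce (G : Graph α β) : Graph (α ⊕ β) (β × α × Bool) where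
  vertexSet := Sum.inl '' V(G) ∪ Sum.inr '' E(G)
  IsLink h a b := IsHalfEdge G h ∧
    ((a = Sum.inl h.2.1 ∧ b = Sum.inr h.1) ∨ (a = Sum.inr h.1 ∧ b = Sum.inl h.2.1))
  isLink_symm _ _ := ⟨fun _ _ hab => ⟨hab.1, hab.2.symm.imp And.symm And.symm⟩⟩
  eq_or_eq_of_isLink_of_isLink := by
    rintro h a b c d ⟨-, ⟨rfl, rfl⟩ | ⟨rfl, rfl⟩⟩ ⟨-, ⟨rfl, rfl⟩ | ⟨rfl, rfl⟩⟩ <;> simp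
  left_mem_of_isLink := by
    rintro ⟨e, x, b⟩ a c ⟨hh, hac⟩
    have hinc : G.Inc e x := hh.elim And.right fun hl => Graph.IsLoopAt.inc hl.2
    rcases hac with ⟨rfl, -⟩ | ⟨rfl, -⟩
    · exact Or.inl ⟨x, hinc.vertex_mem, rfl⟩
    · exact Or.inr ⟨e, hinc.edge_mem, rfl⟩

end Multigraphs

/-! ## The multigraph of a tangle -/

section TangleGraph

variable {T : Type*} [TopologicalSpace T]

/-- The multigraph drawn by the vertex set `V` in `T`: its edges are the components of `T \ V`,
and the ends of an edge are the points that its closure adds to it. -/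
def drawnGraph (V : Set T) : Graph T (Set T) where
  vertexSet := V
  IsLink e x y := e ∈ componentsOf Vᶜ ∧ x ∈ V ∧ y ∈ V ∧ closure e \ e = {x, y}
  isLink_symm _ _ := ⟨fun x y h => ⟨h.1, h.2.2.1, h.2.1, h.2.2.2.trans (pair_comm x y)⟩⟩
  eq_or_eq_of_isLink_of_isLink := by
    rintro e x y v w ⟨-, -, -, h⟩ ⟨-, -, -, h'⟩
    have hx : x ∈ closure e \ e := h ▸ mem_insert x {y}
    rw [h'] at hx
    simpa using hx
  left_mem_of_isLink _ _ _ h := h.2.1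

/-- The multigraph `G_T` of a tangle: its vertices are the singular points. The circle, the only
tangle without singular points, gets the single vertex `p` (and one loop at it); for every other
tangle `p` plays no role. -/
def tangleGraph (p : T) : Graph T (Set T) :=
  drawnGraph {x : T | IsSingular x ∨ ((∀ y : T, ¬ IsSingular y) ∧ x = p)}

end TangleGraph

end TangleDivision

/-! Everything rests on a dichotomy for the finite connected multigraph G†: either it has a bipolar
numbering, or it has a `Fork`, that is, three pairwise disjoint connected sets of vertices, each
attached to the rest at one original vertex. A numbering produces every positive statement. A fork
refutes statements (4) to (7) directly, and (2) and (3) each imply (4).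

The dichotomy. The side of v containing w consists of the points reachable from w without passing v.
Take a smallest proper side, then a smallest one among those disjoint from it, and let s and t be
their base points. A further side avoiding s and t is disjoint from both by minimality, which gives
three disjoint sides (`exists_pair_or_sideTriple`). If instead every side contains s or t, a path
from s to t can be enlarged by ears until it lists all points, with every interior member keeping an
earlier and a later neighbour (`exists_bipolarList`). Three disjoint sides are then normalised:
their vertices may be assumed equal or distinct (`SideTriple.exists_normal`), and original rather
than inserted by the subdivision (`SideTriple.exists_inl`).

From a numbering. Read it as a height function. The subdivision vertex of a loop has a single
neighbour, so it is a local extremum, hence the lowest or the highest vertex. Thus G has a `Sweep`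
in which at most one loop hangs below the lowest vertex and at most one stands on the highest
(`Numbered.sweep_subdivideOnce`). In a sweep the separating vertices are the heights that no edge
crosses, and the blocks are the layers between consecutive ones, so the block graph is a path
(`Sweep.isPathGraph`). Extended affinely along the edges (`Sweep.sweeping`), the height has
connected lower and upper sets in the tangle (`Sweeping.isPreconnected_of_lower`). Breaking ties
arbitrarily gives a bipolar ordering. The value of a lower set depends continuously on its height,
so some height is a fair cut for one agent and the other agent chooses
(`Sweeping.guaranteesConnectedEF`).

From a fork. Its parts, with their attaching vertices, are the arms of a trident
(`Fork.hasTrident`). They also give three disjoint splits of the edges. Along a path of blocks each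
split is an initial or a final stretch, and two of the same kind are nested, so three disjoint ones
cannot exist (`not_isPathGraph_of_isSplit`). In the tangle the parts are three components of the
complement of a cutset (`Fork.hasGenGapCutset`). Conversely, a cutset gives three disjoint open sets
with at most one boundary point each. Of two disjoint connected sets one meets at most one of the
three (`ThreeEnds.meets_one`), which excludes a bipolar ordering, and also envy-freeness for two
equal agents who value each of the three ends at 1.

The passage between space and multigraph uses a `Drawing`: finitely many vertices and arcs. Degrees
are topological invariants (`HasDegree.le`), so nonsingular vertices can be recognised and
suppressed until the vertices are those of the multigraph of the tangle (`IsTangle.exists_drawing`).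
-/

open Set

namespace TangleDivision

/-! ## Sides of a vertex in a connected relation -/

section Sides

variable {W : Type*} {r : W → W → Prop}

/-- The points that can be reached from `x` by an `r`-walk avoiding `v`. -/
def Side (r : W → W → Prop) (v x : W) : Set W :=
  {y | Relation.ReflTransGen (fun a b => r a b ∧ a ≠ v ∧ b ≠ v) x y}

theorem self_mem_side (v x : W) : x ∈ Side r v x := Relation.ReflTransGen.refl

theorem ne_of_mem_side {v x y : W} (hx : x ≠ v) (hy : y ∈ Side r v x) : y ≠ v := by
  rcases Relation.ReflTransGen.cases_tail hy with h | ⟨z, -, h⟩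
  · exact h ▸ hx
  · exact h.2.2

theorem side_trans {v x y z : W} (hy : y ∈ Side r v x) (hz : z ∈ Side r v y) : z ∈ Side r v x :=
  Relation.ReflTransGen.trans hy hz

theorem side_symm (hr : ∀ ⦃a b⦄, r a b → r b a) {v x y : W} (hy : y ∈ Side r v x) : x ∈ Side r v y := by
  induction hy with
  | refl => exact self_mem_side _ _
  | tail _ h ih => exact Relation.ReflTransGen.head ⟨hr h.1, h.2.2, h.2.1⟩ ih

theorem mem_side_of_rel {v x y z : W} (hx : x ≠ v) (hy : y ∈ Side r v x) (h : r y z)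
    (hz : z ≠ v) : z ∈ Side r v x :=
  Relation.ReflTransGen.tail hy ⟨h, ne_of_mem_side hx hy, hz⟩

theorem side_subset_of_closed {v x : W} {S : Set W} (hx : x ∈ S)
    (hS : ∀ y ∈ S, ∀ z, r y z → z ≠ v → z ∈ S) : Side r v x ⊆ S := by
  intro y hy
  induction hy with
  | refl => exact hx
  | tail _ h ih => exact hS _ ih _ h.1 h.2.2

/-- A walk from `y` to `v` cannot enter the side of `x` before it has reached `v`, since a side can
only be entered through its vertex. Up to that moment it therefore avoids `v'`. -/
theorem mem_side_of_notMem (hr : ∀ ⦃a b⦄, r a b → r b a) (hc : ∀ x y, Relation.ReflTransGen r x y)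
    {v x v' y : W} (hx : x ≠ v) (hv' : v' ∈ Side r v x) (hy : y ∉ Side r v x) :
    v ∈ Side r v' y := by
  have key : ∀ y, Relation.ReflTransGen r y v → y ∉ Side r v x → v ∈ Side r v' y := by
    intro y h
    induction h using Relation.ReflTransGen.head_induction_on with
    | refl => exact fun _ => self_mem_side _ _
    | @head a b hab _ ih =>
      intro ha
      by_cases hav : a = v
      · subst hav; exact self_mem_side _ _
      have hb : b ∉ Side r v x := fun hb => ha (mem_side_of_rel hx hb (hr hab) hav)
      exact Relation.ReflTransGen.head
        ⟨hab, fun h => ha (h ▸ hv'), fun h => hb (h ▸ hv')⟩ (ih hb)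
  exact key y (hc y v) hy

/-- Three pairwise disjoint sides. -/
structure SideTriple (r : W → W → Prop) (v x : Fin 3 → W) : Prop where
  ne : ∀ i, x i ≠ v i
  disjoint : ∀ i j, i ≠ j → Disjoint (Side r (v i) (x i)) (Side r (v j) (x j))

theorem fin_three_exists_other (i j : Fin 3) : ∃ k, k ≠ i ∧ k ≠ j := by
  revert i j; decide

/-- If `v i` were inside the `j`-th side, the points `x i` and `x k` outside that side would both
reach `v j` without passing `v i`. Then `x k` would lie in the `i`-th side as well as in its own. -/
theorem SideTriple.notMem (hr : ∀ ⦃a b⦄, r a b → r b a) (hc : ∀ x y, Relation.ReflTransGen r x y)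
    {v x : Fin 3 → W} (h : SideTriple r v x) {i j : Fin 3} (hij : i ≠ j) :
    v i ∉ Side r (v j) (x j) := by
  intro hv
  obtain ⟨k, hki, hkj⟩ := fin_three_exists_other i j
  have hi : x i ∉ Side r (v j) (x j) :=
    fun hx => (h.disjoint i j hij).le_bot ⟨self_mem_side _ _, hx⟩
  have hk : x k ∉ Side r (v j) (x j) :=
    fun hx => (h.disjoint k j hkj).le_bot ⟨self_mem_side _ _, hx⟩
  have h1 := mem_side_of_notMem hr hc (h.ne j) hv hi
  have h2 := mem_side_of_notMem hr hc (h.ne j) hv hk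
  exact (h.disjoint k i hki).le_bot ⟨self_mem_side _ _, side_trans h1 (side_symm hr h2)⟩

/-- The vertices of three disjoint sides may be assumed to be equal or pairwise distinct. -/
theorem SideTriple.exists_normal (hr : ∀ ⦃a b⦄, r a b → r b a) (hc : ∀ x y, Relation.ReflTransGen r x y)
    {v x : Fin 3 → W} (h : SideTriple r v x) :
    ∃ v' x' : Fin 3 → W, SideTriple r v' x' ∧ ((∀ i, v' i = v' 0) ∨ Function.Injective v') ∧
      ∀ i, ∃ j, v' i = v j := by
  by_cases hinj : Function.Injective v
  · exact ⟨v, x, h, Or.inr hinj, fun i => ⟨i, rfl⟩⟩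
  simp only [Function.Injective, not_forall] at hinj
  obtain ⟨i, j, hv, hij⟩ := hinj
  obtain ⟨k, hki, hkj⟩ := fin_three_exists_other i j
  have hcases : ∀ m : Fin 3, m = i ∨ m = j ∨ m = k := fun m => by omega
  by_cases hk : v k = v i
  · refine ⟨v, x, h, Or.inl fun m => ?_, fun i => ⟨i, rfl⟩⟩
    have : ∀ m, v m = v i := fun m => by
      rcases hcases m with rfl | rfl | rfl
      exacts [rfl, hv.symm, hk]
    rw [this m, this 0]
  -- Two vertices agree and the third differs. The third side is traded for the side of the common
  -- vertex that contains `v k`; it is disjoint from the other two because `v k` lies in neither of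
  -- them.
  refine ⟨fun _ => v i, Function.update x k (v k), ⟨?_, ?_⟩, Or.inl fun _ => rfl, fun _ => ⟨i, rfl⟩⟩
  · intro m
    by_cases hm : m = k
    · subst hm; simpa using hk
    · have : v m = v i := by
        rcases hcases m with rfl | rfl | rfl
        exacts [rfl, hv.symm, absurd rfl hm]
      simp only [Function.update_of_ne hm]
      exact this ▸ h.ne m
  · have hvm : ∀ m, m ≠ k → v m = v i := fun m hm => by
      rcases hcases m with rfl | rfl | rfl
      exacts [rfl, hv.symm, absurd rfl hm]
    have main : ∀ m, m ≠ k → Disjoint (Side r (v i) (v k)) (Side r (v i) (x m)) := by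
      intro m hm
      rw [Set.disjoint_left]
      intro y hy hy'
      have := h.notMem hr hc (i := k) (j := m) (Ne.symm hm)
      rw [hvm m hm] at this
      exact this (side_trans hy' (side_symm hr hy))
    intro a b hab
    by_cases ha : a = k
    · subst ha
      simpa [Function.update_of_ne hab.symm] using main b hab.symm
    by_cases hb : b = k
    · subst hb
      simpa [Function.update_of_ne hab] using (main a hab).symm
    · have := h.disjoint a b hab
      rw [hvm a ha, hvm b hb] at this
      simpa [Function.update_of_ne ha, Function.update_of_ne hb] using this

/-- Either two points meet all sides, or there are three disjoint sides. -/
theorem exists_pair_or_sideTriple [Finite W] [Nontrivial W] (hr : ∀ ⦃a b⦄, r a b → r b a)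
    (hc : ∀ x y, Relation.ReflTransGen r x y) :
    (∃ s t : W, s ≠ t ∧ ∀ v w, w ≠ v → s ∈ Side r v w ∨ t ∈ Side r v w) ∨
      ∃ v x, SideTriple r v x := by
  by_cases hP : ∃ v x y : W, x ≠ v ∧ y ≠ v ∧ y ∉ Side r v x
  swap
  · push Not at hP
    obtain ⟨s, t, hst⟩ := exists_pair_ne W
    refine Or.inl ⟨s, t, hst, fun v w hw => ?_⟩
    by_cases hs : s = v
    · exact Or.inr (hP v w t hw (hs ▸ hst.symm))
    · exact Or.inl (hP v w s hw hs)
  -- The proper sides: those that miss some point besides their vertex.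
  let A : Set (W × W) := {p | p.2 ≠ p.1 ∧ ∃ y, y ≠ p.1 ∧ y ∉ Side r p.1 p.2}
  have hA : A.Nonempty := by
    obtain ⟨v, x, y, h1, h2, h3⟩ := hP
    exact ⟨(v, x), h1, y, h2, h3⟩
  obtain ⟨⟨v₁, x₁⟩, ⟨hx₁, y₁, hy₁, hy₁'⟩, hmin₁⟩ :=
    Set.exists_min_image A (fun p => (Side r p.1 p.2).ncard) (Set.toFinite _) hA
  simp only at hx₁ hy₁ hy₁' hmin₁
  -- The second side is minimal only among the proper sides disjoint from the first one, so the
  -- third side has to be shown disjoint from the first before minimality of the second applies.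
  let B : Set (W × W) := {p | p ∈ A ∧ Disjoint (Side r p.1 p.2) (Side r v₁ x₁)}
  have hdisj : ∀ {v x y : W}, y ∉ Side r v x → Disjoint (Side r v y) (Side r v x) := by
    intro v x y h
    rw [Set.disjoint_left]
    intro z hz hz'
    exact h (side_trans hz' (side_symm hr hz))
  have hB : B.Nonempty := by
    refine ⟨(v₁, y₁), ⟨hy₁, x₁, hx₁, fun h => hy₁' (side_symm hr h)⟩, hdisj hy₁'⟩
  obtain ⟨⟨v₂, x₂⟩, ⟨⟨hx₂, y₂, hy₂, hy₂'⟩, hd₂⟩, hmin₂⟩ :=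
    Set.exists_min_image B (fun p => (Side r p.1 p.2).ncard) (Set.toFinite _) hB
  simp only at hx₂ hy₂ hy₂' hmin₂ hd₂
  have hst : x₁ ≠ x₂ := by
    rintro rfl
    exact hd₂.le_bot ⟨self_mem_side _ _, self_mem_side _ _⟩
  by_cases hO : ∀ v w, w ≠ v → x₁ ∈ Side r v w ∨ x₂ ∈ Side r v w
  · exact Or.inl ⟨x₁, x₂, hst, hO⟩
  push Not at hO
  obtain ⟨v, w, hw, hs, ht⟩ := hO
  right
  have hprop : ∃ y, y ≠ v ∧ y ∉ Side r v w := by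
    by_cases h : x₁ = v
    · exact ⟨x₂, h ▸ hst.symm, ht⟩
    · exact ⟨x₁, h, hs⟩
  -- a side missing a point of another side, and a point outside it, is inside or disjoint
  have key : ∀ {v' x' p : W}, x' ≠ v' → p ∉ Side r v' x' → p ∉ Side r v w →
      x' ∉ Side r v w → ¬ Disjoint (Side r v w) (Side r v' x') →
      Side r v w ⊂ Side r v' x' := by
    intro v' x' p hx' hp hpw hxw hnd
    rw [Set.not_disjoint_iff] at hnd
    obtain ⟨z, hz, hz'⟩ := hnd
    -- With `v` inside the second side, all points outside that side lie on one and the same side of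
    -- `v`, namely the one of `p`, so none of them is in `Side r v w`. With `v` outside, the second
    -- side is joined up without `v` and would lie in `Side r v w` together with `x'`.
    by_cases hv : v ∈ Side r v' x'
    · refine ⟨fun u hu => ?_, fun hsub => ne_of_mem_side hw (hsub hv) rfl⟩
      by_contra hu'
      have h1 := mem_side_of_notMem hr hc hx' hv hu'
      have h2 := mem_side_of_notMem hr hc hx' hv hp
      exact hpw (side_trans hu (side_trans h1 (side_symm hr h2)))
    · exfalso
      apply hxw
      have : Side r v' x' ⊆ Side r v w := by
        have hzx : Side r v' x' ⊆ Side r v' x' ∩ Side r v z := by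
          have : Side r v' z ⊆ Side r v' x' ∩ Side r v z := by
            refine side_subset_of_closed ⟨hz', self_mem_side _ _⟩ ?_
            rintro y ⟨h1, h2⟩ u hyu hu
            have hu1 := mem_side_of_rel hx' h1 hyu hu
            exact ⟨hu1, mem_side_of_rel (fun h => hv (h ▸ hz')) h2 hyu (fun h => hv (h ▸ hu1))⟩
          intro u hu
          exact this (side_trans (side_symm hr hz') hu)
        intro u hu
        exact side_trans hz (hzx hu).2
      exact this (self_mem_side _ _)
  have hx₂1 : x₂ ∉ Side r v₁ x₁ := fun h => hd₂.le_bot ⟨self_mem_side _ _, h⟩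
  have hx₁2 : x₁ ∉ Side r v₂ x₂ := fun h => hd₂.le_bot ⟨h, self_mem_side _ _⟩
  have hd1 : Disjoint (Side r v w) (Side r v₁ x₁) := by
    by_contra hnd
    have hss := key hx₁ hx₂1 ht hs hnd
    have := hmin₁ (v, w) ⟨hw, hprop⟩
    exact absurd (Set.ncard_lt_ncard hss (Set.toFinite _)) (not_lt.2 this)
  have hd2 : Disjoint (Side r v w) (Side r v₂ x₂) := by
    by_contra hnd
    have hss := key hx₂ hx₁2 hs ht hnd
    have := hmin₂ (v, w) ⟨⟨hw, hprop⟩, hd1⟩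
    exact absurd (Set.ncard_lt_ncard hss (Set.toFinite _)) (not_lt.2 this)
  refine ⟨![v₁, v₂, v], ![x₁, x₂, w], ⟨?_, ?_⟩⟩
  · intro i; fin_cases i
    exacts [hx₁, hx₂, hw]
  · intro i j hij
    fin_cases i <;> fin_cases j
    exacts [absurd rfl hij, hd₂.symm, hd1.symm, hd₂, absurd rfl hij, hd2.symm, hd1, hd2,
      absurd rfl hij]

end Sides

/-! ## Bipolar lists -/

section BipolarLists

variable {W : Type*} {r : W → W → Prop}

/-- Every member of the list is related to a member of `S` or to an earlier member. -/
def LowFrom (r : W → W → Prop) : Set W → List W → Prop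
  | _, [] => True
  | S, x :: l => (∃ y ∈ S, r x y) ∧ LowFrom r (insert x S) l

/-- Every member of the list but the first is related to an earlier one. -/
def LowList (r : W → W → Prop) : List W → Prop
  | [] => True
  | x :: l => LowFrom r {x} l

theorem LowFrom.mono {S S' : Set W} {l : List W} (hS : S ⊆ S') (h : LowFrom r S l) :
    LowFrom r S' l := by
  induction l generalizing S S' with
  | nil => trivial
  | cons x l ih =>
    obtain ⟨⟨y, hy, hxy⟩, h⟩ := h
    exact ⟨⟨y, hS hy, hxy⟩, ih (insert_subset_insert hS) h⟩

theorem lowFrom_append {S : Set W} {l₁ l₂ : List W} :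
    LowFrom r S (l₁ ++ l₂) ↔ LowFrom r S l₁ ∧ LowFrom r (S ∪ {x | x ∈ l₁}) l₂ := by
  induction l₁ generalizing S with
  | nil => simp [LowFrom]
  | cons x l ih =>
    have : insert x S ∪ {y | y ∈ l} = S ∪ {y | y ∈ x :: l} := by
      ext y; simp only [mem_union, mem_insert_iff, mem_ofPred_eq, List.mem_cons]; tauto
    simp only [List.cons_append, LowFrom, ih, this, and_assoc]

theorem lowFrom_of_isChain (hr : ∀ ⦃a b⦄, r a b → r b a) {S : Set W} {l : List W} (hl : l.IsChain r)
    (h : ∀ x, l.head? = some x → ∃ y ∈ S, r x y) : LowFrom r S l := by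
  induction l generalizing S with
  | nil => trivial
  | cons x l ih =>
    refine ⟨h x rfl, ih hl.tail fun y hy => ⟨x, mem_insert _ _, hr ?_⟩⟩
    cases l with
    | nil => simp at hy
    | cons z l =>
      simp only [List.head?_cons, Option.some.injEq] at hy
      subst hy
      exact (List.isChain_cons_cons.1 hl).1

/-- A new stretch only enlarges the supply of earlier members for what follows it. `A` must be
non-empty because the first member of a list is exempt from the condition. -/
theorem LowList.insert {A l B : List W} (h : LowList r (A ++ B)) (hA : A ≠ [])
    (hl : LowFrom r {x | x ∈ A} l) : LowList r (A ++ (l ++ B)) := by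
  cases A with
  | nil => exact absurd rfl hA
  | cons s A =>
    have hs : ({s} ∪ {x | x ∈ A} : Set W) = {x | x ∈ s :: A} := by ext; simp
    have h' : LowFrom r {s} (A ++ B) := h
    change LowFrom r {s} (A ++ (l ++ B))
    rw [lowFrom_append, hs] at h' ⊢
    rw [lowFrom_append]
    exact ⟨h'.1, hl, h'.2.mono subset_union_left⟩

theorem LowFrom.exists_lt {S : Set W} {l : List W} (h : LowFrom r S l) (j : ℕ)
    (hj : j < l.length) : (∃ y ∈ S, r l[j] y) ∨ ∃ i, ∃ hi : i < j, r l[j] l[i] := by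
  induction l generalizing S j with
  | nil => simp at hj
  | cons x l ih =>
    cases j with
    | zero => exact Or.inl h.1
    | succ j =>
      rcases ih h.2 j (by simpa using hj) with ⟨y, hy | hy, hxy⟩ | ⟨i, hi, hij⟩
      · exact Or.inr ⟨0, by omega, by simpa [hy] using hxy⟩
      · exact Or.inl ⟨y, hy, by simpa using hxy⟩
      · exact Or.inr ⟨i + 1, by omega, by simpa using hij⟩

theorem LowList.exists_lt {l : List W} (h : LowList r l) (j : ℕ)
    (hj : j < l.length) (h0 : 0 < j) : ∃ i, ∃ hi : i < j, r l[j] l[i] := by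
  cases l with
  | nil => simp at hj
  | cons x l =>
    obtain ⟨j, rfl⟩ := Nat.exists_eq_succ_of_ne_zero h0.ne'
    rcases LowFrom.exists_lt h j (by simpa using hj) with ⟨y, hy, hxy⟩ | ⟨i, hi, hij⟩
    · exact ⟨0, by omega, by simpa [show y = x from hy] using hxy⟩
    · exact ⟨i + 1, by omega, by simpa using hij⟩

/-- A simple walk from `w` that ends next to the first member of `P` that it meets. -/
theorem exists_simple_walk {q : W → W → Prop} {P : Set W} {w z : W}
    (h : Relation.ReflTransGen q w z) (hz : z ∈ P) (hw : w ∉ P) :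
    ∃ l : List W, l.Nodup ∧ l.IsChain q ∧ l.head? = some w ∧ (∀ x ∈ l, x ∉ P) ∧
      ∃ a, l.getLast? = some a ∧ ∃ u ∈ P, q a u := by
  induction h using Relation.ReflTransGen.head_induction_on with
  | refl => exact absurd hz hw
  | @head a b hab _ ih =>
    by_cases hb : b ∈ P
    · exact ⟨[a], by simp, by simp, rfl, by simpa using hw, a, rfl, b, hb, hab⟩
    obtain ⟨l, hn, hch, hhd, hP, c, hc, u, hu, hcu⟩ := ih hb
    by_cases ha : a ∈ l
    · obtain ⟨X, Y, rfl⟩ := List.append_of_mem ha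
      refine ⟨a :: Y, (List.nodup_append.1 hn).2.1, hch.right_of_append, rfl,
        fun x hx => hP x (by simp [List.mem_cons.1 hx]), c, ?_, u, hu, hcu⟩
      simpa using hc
    · refine ⟨a :: l, List.nodup_cons.2 ⟨ha, hn⟩, ?_, rfl, ?_, c, ?_, u, hu, hcu⟩
      · rw [List.isChain_cons]
        refine ⟨fun y hy => ?_, hch⟩
        rw [hhd] at hy
        simp only [Option.mem_def, Option.some.injEq] at hy
        exact hy ▸ hab
      · intro x hx
        rcases List.mem_cons.1 hx with rfl | hx
        exacts [hw, hP x hx]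
      · cases l with
        | nil => simp at hc
        | cons d l => simpa using hc

theorem exists_append_of_ne {L : List W} {u u' : W} (hu : u ∈ L) (hu' : u' ∈ L) (hne : u ≠ u') :
    ∃ A B, L = A ++ B ∧ (u ∈ A ∧ u' ∈ B ∨ u' ∈ A ∧ u ∈ B) := by
  obtain ⟨X, Y, rfl⟩ := List.append_of_mem hu
  rcases List.mem_append.1 hu' with h | h
  · exact ⟨X, u :: Y, rfl, Or.inr ⟨h, by simp⟩⟩
  · refine ⟨X ++ [u], Y, by simp, Or.inl ⟨by simp, ?_⟩⟩
    rcases List.mem_cons.1 h with h | h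
    exacts [absurd h hne.symm, h]

/-- A linear arrangement of some points in which every one but the first is related to an earlier
one, and every one but the last to a later one. -/
structure BipolarList (r : W → W → Prop) (L : List W) : Prop where
  nodup : L.Nodup
  low : LowList r L
  high : LowList r L.reverse

/-- The new stretch is an ear: a path whose two ends touch the old list at `u` and `u'`. Read
forwards it hangs on `u`, which comes earlier; read backwards it hangs on `u'`. -/
theorem BipolarList.insert_ear (hr : ∀ ⦃a b⦄, r a b → r b a) {A l B : List W} {u u' : W}
    (h : BipolarList r (A ++ B)) (hu : u ∈ A) (hu' : u' ∈ B) (hn : l.Nodup)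
    (hl : ∀ x ∈ l, x ∉ A ++ B) (hch : l.IsChain r) (hhead : ∀ x, l.head? = some x → r x u)
    (hlast : ∀ x, l.getLast? = some x → r x u') : BipolarList r (A ++ (l ++ B)) := by
  refine ⟨?_, h.low.insert (List.ne_nil_of_mem hu)
    (lowFrom_of_isChain hr hch fun x hx => ⟨u, hu, hhead x hx⟩), ?_⟩
  · have := h.nodup
    rw [List.nodup_append] at this ⊢
    rw [List.nodup_append]
    refine ⟨this.1, ⟨hn, this.2.1, ?_⟩, ?_⟩
    · rintro a ha b hb rfl
      exact hl a ha (by simp [hb])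
    · rintro a ha b hb rfl
      rcases List.mem_append.1 hb with hb | hb
      · exact hl a hb (by simp [ha])
      · exact this.2.2 a ha a hb rfl
  · have hh : LowList r (B.reverse ++ A.reverse) := by simpa using h.high
    have := hh.insert (l := l.reverse) (by simpa using List.ne_nil_of_mem hu')
      (lowFrom_of_isChain hr ?_ fun x hx => ⟨u', by simpa using hu', hlast x (by simpa using hx)⟩)
    · simpa using this
    · rw [List.isChain_reverse]
      exact hch.imp fun _ _ h => hr h

/-- If `s` and `t` meet all sides, then all points can be arranged in a bipolar list. -/
theorem exists_bipolarList [Finite W] (hr : ∀ ⦃a b⦄, r a b → r b a)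
    (hc : ∀ x y, Relation.ReflTransGen r x y) {s t : W} (hst : s ≠ t)
    (h : ∀ v w, w ≠ v → s ∈ Side r v w ∨ t ∈ Side r v w) :
    ∃ L : List W, BipolarList r L ∧ ∀ x, x ∈ L := by
  by_contra hcon
  push Not at hcon
  -- As long as some point is missing, an ear can be added; lists of unbounded length contradict
  -- finiteness.
  have grow : ∀ n : ℕ, ∃ L : List W, BipolarList r L ∧ s ∈ L ∧ t ∈ L ∧ n ≤ L.length := by
    intro n
    induction n with
    | zero =>
      obtain ⟨l, hn, hch, hhd, hP, a, ha, u, rfl, hau⟩ :=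
        exists_simple_walk (P := {t}) (hc s t) rfl hst
      have hs : s ∈ l := List.mem_of_mem_head? hhd
      cases l with
      | nil => simp at hs
      | cons b l =>
        refine ⟨(b :: l) ++ [u], ⟨?_, ?_, ?_⟩,
          List.mem_append_left _ hs, by simp, by simp⟩
        · rw [List.nodup_append]
          refine ⟨hn, by simp, ?_⟩
          rintro x hx y hy rfl
          exact hP x hx (by simpa using hy)
        · change LowFrom r {b} (l ++ [u])
          apply lowFrom_of_isChain hr
          · have : (b :: (l ++ [u])).IsChain r := by
              rw [← List.cons_append, List.isChain_append]
              refine ⟨hch, by simp, ?_⟩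
              intro x hx y hy
              rw [ha] at hx
              simp only [Option.mem_def, Option.some.injEq, List.head?_cons] at hx hy
              subst hx hy; exact hau
            exact this.tail
          · intro x hx
            refine ⟨b, rfl, hr ?_⟩
            have : (b :: (l ++ [u])).IsChain r := by
              rw [← List.cons_append, List.isChain_append]
              refine ⟨hch, by simp, ?_⟩
              intro x hx y hy
              rw [ha] at hx
              simp only [Option.mem_def, Option.some.injEq, List.head?_cons] at hx hy
              subst hx hy; exact hau
            rw [List.isChain_cons] at this
            exact this.1 x hx
        · rw [List.reverse_append]
          change LowFrom r {u} ((b :: l).reverse)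
          apply lowFrom_of_isChain hr
          · rw [List.isChain_reverse]
            exact hch.imp fun _ _ h => hr h
          · intro x hx
            rw [List.head?_reverse, ha] at hx
            simp only [Option.some.injEq] at hx
            exact ⟨u, rfl, hx ▸ hau⟩
    | succ n ih =>
      obtain ⟨L, hL, hs, ht, hlen⟩ := ih
      obtain ⟨w₀, hw₀⟩ := hcon L hL
      -- a point outside the list next to a point of the list
      obtain ⟨l₀, -, -, -, hl₀, w, hw, u, hu, hwu⟩ :=
        exists_simple_walk (P := {x | x ∈ L}) (hc w₀ s) hs hw₀
      have hwL : w ∉ L := hl₀ w (List.mem_of_getLast? hw)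
      have hwu' : w ≠ u := fun h => hwL (h ▸ hu)
      -- The side of `u` containing `w` contains `s` or `t`, both already listed. So a walk from `w`
      -- returns to the list without using `u`, at a second attaching point `u' ≠ u`.
      obtain ⟨z, hzL, hz⟩ : ∃ z ∈ L, z ∈ Side r u w := by
        rcases h u w hwu' with h | h
        exacts [⟨s, hs, h⟩, ⟨t, ht, h⟩]
      obtain ⟨l, hn, hch, hhd, hP, a, ha, u', hu', hau'⟩ :=
        exists_simple_walk (P := {x | x ∈ L}) hz hzL hwL
      have hch' : l.IsChain r := hch.imp fun _ _ h => h.1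
      have hlpos : 0 < l.length := List.length_pos_of_mem (List.mem_of_mem_head? hhd)
      have hhd' : ∀ x, l.head? = some x → r x u := by
        intro x hx; rw [hhd] at hx; simp only [Option.some.injEq] at hx; exact hx ▸ hwu
      have hlast : ∀ x, l.getLast? = some x → r x u' := by
        intro x hx; rw [ha] at hx; simp only [Option.some.injEq] at hx; exact hx ▸ hau'.1
      obtain ⟨A, B, rfl, ⟨huA, huB⟩ | ⟨huA, huB⟩⟩ := exists_append_of_ne hu hu' hau'.2.2.symm
      · refine ⟨A ++ (l ++ B), hL.insert_ear hr huA huB hn hP hch' hhd' hlast, ?_, ?_, ?_⟩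
        · simp only [List.mem_append] at hs ⊢; tauto
        · simp only [List.mem_append] at ht ⊢; tauto
        · simp only [List.length_append] at hlen ⊢; omega
      -- Here `u'` precedes `u`, so the ear is inserted backwards.
      · refine ⟨A ++ (l.reverse ++ B), hL.insert_ear hr huA huB (by simpa using hn)
          (fun x hx => hP x (by simpa using hx)) ?_ (by simpa using hlast) (by simpa using hhd'),
          ?_, ?_, ?_⟩
        · rw [List.isChain_reverse]
          exact hch'.imp fun _ _ h => hr h
        · simp only [List.mem_append] at hs ⊢; tauto
        · simp only [List.mem_append] at ht ⊢; tauto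
        · simp only [List.length_append, List.length_reverse] at hlen ⊢; omega
  have := Fintype.ofFinite W
  obtain ⟨L, hL, -, -, hlen⟩ := grow (Fintype.card W + 1)
  have := hL.nodup.length_le_card
  omega

theorem BipolarList.exists_enumeration (hr : ∀ ⦃a b⦄, r a b → r b a) {L : List W} (h : BipolarList r L)
    (hall : ∀ x, x ∈ L) :
    ∃ (k : ℕ) (v : Fin k → W), Function.Bijective v ∧
      (∀ j : Fin k, 0 < (j : ℕ) → ∃ i < j, r (v i) (v j)) ∧
      (∀ m : Fin k, (m : ℕ) + 1 < k → ∃ n > m, r (v m) (v n)) := by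
  refine ⟨L.length, fun i => L[i], ⟨?_, ?_⟩, ?_, ?_⟩
  · intro i j hij
    exact Fin.ext ((List.Nodup.getElem_inj_iff h.nodup).1 hij)
  · intro x
    obtain ⟨i, hi, rfl⟩ := List.mem_iff_getElem.1 (hall x)
    exact ⟨⟨i, hi⟩, rfl⟩
  · intro j hj
    obtain ⟨i, hi, hij⟩ := h.low.exists_lt j j.2 hj
    exact ⟨⟨i, hi.trans j.2⟩, hi, hr hij⟩
  · intro m hm
    -- The member with index `m` has index `L.length - 1 - m` in the reversed list, and earlier
    -- there means later here.
    obtain ⟨i, hi, hij⟩ := h.high.exists_lt (L.length - 1 - m) (by simp; omega) (by omega)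
    simp only [List.getElem_reverse] at hij
    have e1 : L.length - 1 - (L.length - 1 - (m : ℕ)) = m := by omega
    simp only [e1] at hij
    refine ⟨⟨L.length - 1 - i, by omega⟩, ?_, hij⟩
    rw [gt_iff_lt, Fin.lt_def]
    simp only
    omega

end BipolarLists

/-! ## Splits of a multigraph -/

section Splits

open scoped Graph

variable {α β : Type*} {H K : Graph α β}

/-- The subgraph formed by a set of edges and their ends. -/
def edgeSpan (H : Graph α β) (D : Set β) : Graph α β where
  vertexSet := {x | ∃ e ∈ D, H.Inc e x}
  IsLink e x y := e ∈ D ∧ H.IsLink e x y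
  isLink_symm _ _ := ⟨fun _ _ h => ⟨h.1, h.2.symm⟩⟩
  eq_or_eq_of_isLink_of_isLink _ _ _ _ _ h h' := h.2.left_eq_or_eq h'.2
  left_mem_of_isLink e _ _ h := ⟨e, h.1, h.2.inc_left⟩

theorem edgeSet_edgeSpan {D : Set β} (hD : D ⊆ E(H)) : E(edgeSpan H D) = D := by
  ext e
  rw [Graph.edge_mem_iff_exists_isLink]
  constructor
  · rintro ⟨x, y, h⟩; exact h.1
  · intro h
    obtain ⟨x, y, hxy⟩ := H.exists_isLink_of_mem_edgeSet (hD h)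
    exact ⟨x, y, h, hxy⟩

theorem edgeSpan_le (D : Set β) : edgeSpan H D ≤ H :=
  ⟨fun _ ⟨_, _, h⟩ => h.vertex_mem, fun _ _ _ h => h.2⟩

theorem le_edgeSpan (hK : K ≤ H) {D : Set β} (hV : ∀ x ∈ V(K), ∃ e, K.Inc e x) (hE : E(K) ⊆ D) :
    K ≤ edgeSpan H D := by
  refine ⟨fun x hx => ?_, fun e x y h => ⟨hE h.edge_mem, h.mono hK⟩⟩
  obtain ⟨e, he⟩ := hV x hx
  exact ⟨e, hE he.edge_mem, he.mono hK⟩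

theorem GraphConnected.exists_inc (h : GraphConnected H) (hE : E(H).Nonempty) {x : α}
    (hx : x ∈ V(H)) : ∃ e, H.Inc e x := by
  obtain ⟨e, he⟩ := hE
  obtain ⟨y, z, hyz⟩ := H.exists_isLink_of_mem_edgeSet he
  rcases Relation.ReflTransGen.cases_head (h.2 x hx y hyz.left_mem) with rfl | ⟨w, ⟨e', h'⟩, -⟩
  · exact ⟨e, hyz.inc_left⟩
  · exact ⟨e', h'.inc_left⟩

/-- A set `D` of edges, neither empty nor everything, that meets the other edges only in `v`. -/
structure IsSplit (H : Graph α β) (v : α) (D : Set β) : Prop where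
  subset : D ⊆ E(H)
  nonempty : D.Nonempty
  compl_nonempty : (E(H) \ D).Nonempty
  eq_of_inc : ∀ e ∈ D, ∀ e' ∈ E(H) \ D, ∀ x, H.Inc e x → H.Inc e' x → x = v

theorem IsSplit.compl {v : α} {D : Set β} (h : IsSplit H v D) : IsSplit H v (E(H) \ D) where
  subset := sdiff_subset
  nonempty := h.compl_nonempty
  compl_nonempty := by rw [sdiff_sdiff_cancel_left h.subset]; exact h.nonempty
  eq_of_inc e he e' he' x hx hx' := by
    rw [sdiff_sdiff_cancel_left h.subset] at he'
    exact h.eq_of_inc e' he' e he x hx' hx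

/-- The first edge of a walk outside `D` meets the preceding edges at a common end, which can only
be `v`. So a walk either stays in `D` or reaches `v` while still inside it. -/
theorem IsSplit.reflTransGen {v : α} {D : Set β} (h : IsSplit H v D) {x y : α}
    (hxy : Relation.ReflTransGen H.Adj x y) (hx : x ∈ V(edgeSpan H D)) :
    (y ∈ V(edgeSpan H D) ∧ Relation.ReflTransGen (edgeSpan H D).Adj x y) ∨
      (v ∈ V(edgeSpan H D) ∧ Relation.ReflTransGen (edgeSpan H D).Adj x v) := by
  induction hxy with
  | refl => exact Or.inl ⟨hx, .refl⟩
  | @tail y z _ hyz ih =>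
    rcases ih with ⟨hy, ih⟩ | ih
    · obtain ⟨e, he⟩ := hyz
      by_cases hD : e ∈ D
      · exact Or.inl ⟨⟨e, hD, he.inc_right⟩, ih.tail ⟨e, hD, he⟩⟩
      · obtain ⟨e', he', hy'⟩ := hy
        obtain rfl := h.eq_of_inc e' he' e ⟨he.edge_mem, hD⟩ y hy' he.inc_left
        exact Or.inr ⟨⟨e', he', hy'⟩, ih⟩
    · exact Or.inr ih

theorem IsSplit.mem_edgeSpan {v : α} {D : Set β} (h : IsSplit H v D) (hH : GraphConnected H) :
    v ∈ V(edgeSpan H D) := by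
  obtain ⟨e, he⟩ := h.nonempty
  obtain ⟨e', he'⟩ := h.compl_nonempty
  obtain ⟨x, y, hxy⟩ := H.exists_isLink_of_mem_edgeSet (h.subset he)
  obtain ⟨x', y', hxy'⟩ := H.exists_isLink_of_mem_edgeSet he'.1
  rcases h.reflTransGen (hH.2 x hxy.left_mem x' hxy'.left_mem) ⟨e, he, hxy.inc_left⟩ with
    ⟨⟨f, hf, hfx⟩, -⟩ | h'
  · obtain rfl := h.eq_of_inc f hf e' he' x' hfx hxy'.inc_left
    exact ⟨f, hf, hfx⟩
  · exact h'.1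

theorem graphConnected_of_center {v : α} (hv : v ∈ V(H))
    (h : ∀ x ∈ V(H), Relation.ReflTransGen H.Adj x v) : GraphConnected H := by
  refine ⟨⟨v, hv⟩, fun x hx y hy => (h x hx).trans ?_⟩
  have : ∀ x, Relation.ReflTransGen H.Adj x v → Relation.ReflTransGen H.Adj v x := by
    intro x hx
    induction hx using Relation.ReflTransGen.head_induction_on with
    | refl => exact .refl
    | head h _ ih => exact ih.tail h.symm
  exact this y (h y hy)

theorem IsSplit.graphConnected {v : α} {D : Set β} (h : IsSplit H v D) (hH : GraphConnected H) :
    GraphConnected (edgeSpan H D) := by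
  have hv := h.mem_edgeSpan hH
  refine graphConnected_of_center hv fun x hx => ?_
  rcases h.reflTransGen (hH.2 x ((edgeSpan_le D).1 hx) v ((edgeSpan_le D).1 hv)) hx with h | h
  exacts [h.2, h.2]

/-- Together with `IsSeparatingVertex.exists_isSplit` this replaces pairs of subgraphs by a single
set of edges. Connectedness of the two halves is automatic, because every walk in a half that tries
to leave it passes `v`. -/
theorem IsSplit.isSeparatingVertex {v : α} {D : Set β} (h : IsSplit H v D)
    (hH : GraphConnected H) : IsSeparatingVertex H v := by
  have hne : E(H).Nonempty := h.nonempty.mono h.subset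
  refine ⟨edgeSpan H D, edgeSpan H (E(H) \ D), edgeSpan_le _, edgeSpan_le _, h.graphConnected hH,
    h.compl.graphConnected hH, ?_, ?_, ?_, ?_, ?_, ?_⟩
  · rw [edgeSet_edgeSpan h.subset]; exact h.nonempty
  · rw [edgeSet_edgeSpan sdiff_subset]; exact h.compl_nonempty
  · rw [edgeSet_edgeSpan h.subset, edgeSet_edgeSpan sdiff_subset]; exact disjoint_sdiff_right
  · rw [edgeSet_edgeSpan h.subset, edgeSet_edgeSpan sdiff_subset]; exact union_sdiff_cancel h.subset
  · apply Subset.antisymm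
    · exact union_subset (edgeSpan_le _).1 (edgeSpan_le _).1
    · intro x hx
      obtain ⟨e, he⟩ := hH.exists_inc hne hx
      by_cases hD : e ∈ D
      · exact Or.inl ⟨e, hD, he⟩
      · exact Or.inr ⟨e, ⟨he.edge_mem, hD⟩, he⟩
  · apply Subset.antisymm
    · rintro x ⟨⟨e, he, hx⟩, ⟨e', he', hx'⟩⟩
      exact h.eq_of_inc e he e' he' x hx hx'
    · rintro x rfl
      exact ⟨h.mem_edgeSpan hH, h.compl.mem_edgeSpan hH⟩

theorem IsSeparatingVertex.exists_isSplit {v : α} (h : IsSeparatingVertex H v) :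
    v ∈ V(H) ∧ ∃ D, IsSplit H v D := by
  obtain ⟨H₁, H₂, h₁, h₂, -, -, hE₁, hE₂, hd, hE, -, hV⟩ := h
  have hdiff : E(H) \ E(H₁) = E(H₂) := by
    rw [← hE, union_sdiff_left, hd.symm.sdiff_eq_left]
  have hv : v ∈ V(H₁) ∩ V(H₂) := hV ▸ rfl
  refine ⟨h₁.1 hv.1, E(H₁), h₁.edgeSet_mono, hE₁, hdiff ▸ hE₂, ?_⟩
  rw [hdiff]
  intro e he e' he' x hx hx'
  have : x ∈ V(H₁) ∩ V(H₂) :=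
    ⟨((h₁.inc_congr he).2 hx).vertex_mem, ((h₂.inc_congr he').2 hx').vertex_mem⟩
  rw [hV] at this
  exact this

/-- Otherwise `E(K) ∩ D` would be a split of `K` itself. So a split never cuts through a block. -/
theorem IsNonseparable.subset_or_disjoint (hK : IsNonseparable K) (hle : K ≤ H) {v : α}
    {D : Set β} (h : IsSplit H v D) : E(K) ⊆ D ∨ Disjoint E(K) D := by
  by_contra hcon
  rw [not_or, not_subset, not_disjoint_iff] at hcon
  obtain ⟨⟨e', he', heD'⟩, e, he, heD⟩ := hcon
  refine hK.2 v (IsSplit.isSeparatingVertex (D := E(K) ∩ D)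
    ⟨inter_subset_left, ⟨e, he, heD⟩, ⟨e', he', fun h => heD' h.2⟩, ?_⟩ hK.1)
  intro f hf f' hf' x hx hx'
  exact h.eq_of_inc f hf.2 f' ⟨hle.edgeSet_mono hf'.1, fun h => hf'.2 ⟨hf'.1, h⟩⟩ x
    (hx.mono hle) (hx'.mono hle)

theorem isNonseparable_edgeSpan_singleton {e : β} (he : e ∈ E(H)) :
    IsNonseparable (edgeSpan H {e}) := by
  obtain ⟨x, y, hxy⟩ := H.exists_isLink_of_mem_edgeSet he
  refine ⟨graphConnected_of_center (v := x) ⟨e, rfl, hxy.inc_left⟩ ?_, ?_⟩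
  · rintro z ⟨e', rfl, hz⟩
    rcases hz.eq_or_eq_of_isLink hxy with rfl | rfl
    · exact .refl
    · exact .single ⟨_, rfl, hxy.symm⟩
  · intro v hv
    obtain ⟨-, D, hD⟩ := hv.exists_isSplit
    obtain ⟨f, hf⟩ := hD.nonempty
    obtain ⟨f', hf', hfD⟩ := hD.compl_nonempty
    have h1 := hD.subset hf
    rw [edgeSet_edgeSpan (singleton_subset_iff.2 he)] at h1 hf'
    rw [mem_singleton_iff] at h1 hf'
    exact hfD (hf' ▸ h1 ▸ hf)

/-! ### Existence of blocks -/

theorem finite_subgraphs (hV : V(H).Finite) (hE : E(H).Finite) : {K | K ≤ H}.Finite := by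
  have : Set.InjOn (fun K : Graph α β => (V(K), E(K))) {K | K ≤ H} := by
    intro K hK K' hK' h
    simp only [Prod.mk.injEq] at h
    exact (Graph.Compatible.of_le_le hK hK').ext h.1 h.2
  refine Set.Finite.of_finite_image ((hV.finite_subsets.prod hE.finite_subsets).subset ?_) this
  rintro _ ⟨K, hK, rfl⟩
  exact ⟨Graph.IsSubgraph.vertexSet_mono hK, Graph.IsSubgraph.edgeSet_mono hK⟩

theorem exists_isBlock_ge (hV : V(H).Finite) (hE : E(H).Finite) (hle : K ≤ H)
    (hK : IsNonseparable K) : ∃ B, IsBlock H B ∧ K ≤ B := by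
  obtain ⟨B, hB, hmax⟩ := ((finite_subgraphs hV hE).subset
    (fun K (h : K ≤ H ∧ IsNonseparable K) => h.1)).exists_le_maximal ⟨hle, hK⟩
  exact ⟨B, hmax, hB⟩

theorem exists_isBlock_mem (hV : V(H).Finite) (hE : E(H).Finite) {e : β} (he : e ∈ E(H)) :
    ∃ B, IsBlock H B ∧ e ∈ E(B) := by
  obtain ⟨B, hB, hle⟩ := exists_isBlock_ge hV hE (edgeSpan_le {e})
    (isNonseparable_edgeSpan_singleton he)
  refine ⟨B, hB, hle.edgeSet_mono ?_⟩
  rw [edgeSet_edgeSpan (singleton_subset_iff.2 he)]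
  rfl

/-- A connected multigraph without edges has only one vertex, so it is contained in any edge at that
vertex. -/
theorem IsNonseparable.le_edgeSpan_of_edgeSet_eq_empty (hK : IsNonseparable K)
    (hKE : E(K) = ∅) {e : β} {x : α} (hx : x ∈ V(K)) (he : H.Inc e x) : K ≤ edgeSpan H {e} := by
  have hno : ∀ a b, ¬ K.Adj a b := by
    rintro a b ⟨f, hf⟩
    have := hf.edge_mem
    rw [hKE] at this
    exact this
  refine ⟨fun y hy => ?_, fun f a b h => absurd ⟨f, h⟩ (hno a b)⟩
  rcases Relation.ReflTransGen.cases_head (hK.1.2 x hx y hy) with rfl | ⟨z, hz, -⟩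
  · exact ⟨e, rfl, he⟩
  · exact absurd hz (hno _ _)

/-- A single vertex is never maximal here, because an edge with its ends is already non-separable,
even when it is a loop. -/
theorem IsBlock.edgeSet_nonempty (hH : GraphConnected H) (hne : E(H).Nonempty) {B : Graph α β}
    (hB : IsBlock H B) : E(B).Nonempty := by
  by_contra hcon
  rw [not_nonempty_iff_eq_empty] at hcon
  obtain ⟨x, hx⟩ := hB.prop.2.1.1
  obtain ⟨e, he⟩ := hH.exists_inc hne (hB.prop.1.1 hx)
  have hle := hB.prop.2.le_edgeSpan_of_edgeSet_eq_empty hcon hx he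
  have := hB.le_of_ge ⟨edgeSpan_le {e}, isNonseparable_edgeSpan_singleton he.edge_mem⟩ hle
  have h2 := this.edgeSet_mono
  rw [edgeSet_edgeSpan (singleton_subset_iff.2 he.edge_mem), hcon] at h2
  exact h2 rfl

theorem blockGraph_adj_inl_inr {B : {B : Graph α β // IsBlock H B}}
    {v : {v : α // IsSeparatingVertex H v}} :
    (blockGraph H).Adj (Sum.inl B) (Sum.inr v) ↔ v.1 ∈ V(B.1) := by
  simp [blockGraph]

theorem not_blockGraph_adj_inl_inl {B B' : {B : Graph α β // IsBlock H B}} :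
    ¬ (blockGraph H).Adj (Sum.inl B) (Sum.inl B') := by
  simp [blockGraph]

theorem not_blockGraph_adj_inr_inr {v v' : {v : α // IsSeparatingVertex H v}} :
    ¬ (blockGraph H).Adj (Sum.inr v) (Sum.inr v') := by
  simp [blockGraph]

/-- If the block graph is a path, each split consists of the blocks on one side of its vertex. -/
theorem IsSplit.eq_lower_or_upper (hV : V(H).Finite) (hE : E(H).Finite) (hH : GraphConnected H)
    {n : ℕ} (ψ : blockGraph H ≃g SimpleGraph.pathGraph n) {v : α} {D : Set β}
    (h : IsSplit H v D) :
    (∀ B, E(B.1) ⊆ D ↔ ψ (Sum.inl B) < ψ (Sum.inr ⟨v, h.isSeparatingVertex hH⟩)) ∨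
      (∀ B, E(B.1) ⊆ D ↔ ψ (Sum.inr ⟨v, h.isSeparatingVertex hH⟩) < ψ (Sum.inl B)) := by
  have hne : E(H).Nonempty := h.nonempty.mono h.subset
  set p := ψ (Sum.inr ⟨v, h.isSeparatingVertex hH⟩) with hp
  have hadj : ∀ a b, (blockGraph H).Adj a b ↔
      (ψ a : ℕ) + 1 = ψ b ∨ (ψ b : ℕ) + 1 = ψ a := by
    intro a b
    rw [← ψ.map_adj_iff, SimpleGraph.pathGraph_adj]
  have hpB : ∀ B, ψ (Sum.inl B) ≠ p := fun B hB => by simpa using ψ.injective hB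
  -- Blocks that share a vertex other than `v` lie on the same side of the split, since edges in `D`
  -- and outside `D` meet only in `v`.
  have hstep : ∀ (B B' : {B : Graph α β // IsBlock H B}) (w : {v : α // IsSeparatingVertex H v}),
      w.1 ≠ v → w.1 ∈ V(B.1) → w.1 ∈ V(B'.1) → (E(B.1) ⊆ D → E(B'.1) ⊆ D) := by
    intro B B' w hw hB hB' hD
    obtain ⟨e, he⟩ := B.2.prop.2.1.exists_inc (B.2.edgeSet_nonempty hH hne) hB
    obtain ⟨e', he'⟩ := B'.2.prop.2.1.exists_inc (B'.2.edgeSet_nonempty hH hne) hB'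
    rcases B'.2.prop.2.subset_or_disjoint B'.2.prop.1 h with h' | h'
    · exact h'
    · refine absurd (h.eq_of_inc e (hD he.edge_mem) e' ⟨B'.2.prop.1.edgeSet_mono he'.edge_mem,
        fun h => h'.le_bot ⟨he'.edge_mem, h⟩⟩ w (he.mono B.2.prop.1) (he'.mono B'.2.prop.1)) hw
  -- Blocks and separating vertices alternate along the path, so one moves from block to block in
  -- steps of two. The separating vertex in between is not `v` as long as `p` is not passed.
  have hchain : ∀ (d : ℕ) (B B' : {B : Graph α β // IsBlock H B}),
      (ψ (Sum.inl B) : ℕ) + d = ψ (Sum.inl B') →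
      ((ψ (Sum.inl B') : ℕ) < p ∨ (p : ℕ) < ψ (Sum.inl B)) →
      (E(B.1) ⊆ D ↔ E(B'.1) ⊆ D) := by
    intro d
    induction d using Nat.strong_induction_on with
    | _ d ih =>
      intro B B' hd hlt
      rcases Nat.lt_or_ge d 2 with h2 | h2
      · interval_cases d
        · have : B = B' := by
            have := ψ.injective (Fin.ext (by simpa using hd))
            simpa using this
          rw [this]
        · exact absurd ((hadj _ _).2 (Or.inl hd)) not_blockGraph_adj_inl_inl
      · have hlt' := (ψ (Sum.inl B')).2
        obtain ⟨a, ha⟩ := ψ.surjective ⟨(ψ (Sum.inl B) : ℕ) + 1, by omega⟩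
        obtain ⟨b, hb⟩ := ψ.surjective ⟨(ψ (Sum.inl B) : ℕ) + 2, by omega⟩
        have ha' : (ψ a : ℕ) = (ψ (Sum.inl B) : ℕ) + 1 := by rw [ha]
        have hb' : (ψ b : ℕ) = (ψ (Sum.inl B) : ℕ) + 2 := by rw [hb]
        have hBa : (blockGraph H).Adj (Sum.inl B) a := (hadj _ _).2 (Or.inl ha'.symm)
        have hba : (blockGraph H).Adj b a := (hadj _ _).2 (Or.inr (by omega))
        rcases a with a | w
        · exact absurd hBa not_blockGraph_adj_inl_inl
        rcases b with B'' | b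
        swap
        · exact absurd hba not_blockGraph_adj_inr_inr
        rw [blockGraph_adj_inl_inr] at hBa hba
        have hw : w.1 ≠ v := by
          intro hw
          have : (ψ (Sum.inr w) : ℕ) = p := by
            rw [hp]; congr 3; exact Subtype.ext hw
          omega
        rw [← ih (d - 2) (by omega) B'' B' (by omega) (by omega)]
        exact ⟨hstep B B'' w hw hBa hba, hstep B'' B w hw hba hBa⟩
  have hlow : ∀ B B', ψ (Sum.inl B) < p → ψ (Sum.inl B') < p →
      (E(B.1) ⊆ D ↔ E(B'.1) ⊆ D) := by
    intro B B' h1 h2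
    rw [Fin.lt_def] at h1 h2
    rcases le_total (ψ (Sum.inl B) : ℕ) (ψ (Sum.inl B')) with hle | hle
    · exact hchain _ B B' (Nat.add_sub_cancel' hle) (Or.inl h2)
    · exact (hchain _ B' B (Nat.add_sub_cancel' hle) (Or.inl h1)).symm
  have hupp : ∀ B B', p < ψ (Sum.inl B) → p < ψ (Sum.inl B') →
      (E(B.1) ⊆ D ↔ E(B'.1) ⊆ D) := by
    intro B B' h1 h2
    rw [Fin.lt_def] at h1 h2
    rcases le_total (ψ (Sum.inl B) : ℕ) (ψ (Sum.inl B')) with hle | hle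
    · exact hchain _ B B' (Nat.add_sub_cancel' hle) (Or.inr h1)
    · exact (hchain _ B' B (Nat.add_sub_cancel' hle) (Or.inr h2)).symm
  obtain ⟨e, he⟩ := h.nonempty
  obtain ⟨e', he', heD'⟩ := h.compl_nonempty
  obtain ⟨B, hB, heB⟩ := exists_isBlock_mem hV hE (h.subset he)
  obtain ⟨B', hB', heB'⟩ := exists_isBlock_mem hV hE he'
  have hBD : E(B) ⊆ D := (hB.prop.2.subset_or_disjoint hB.prop.1 h).resolve_right
    fun hd => hd.le_bot ⟨heB, he⟩
  have hBD' : ¬ E(B') ⊆ D := fun hs => heD' (hs heB')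
  rcases lt_or_gt_of_ne (hpB ⟨B, hB⟩) with h1 | h1
  · have h2 : p < ψ (Sum.inl ⟨B', hB'⟩) := by
      rcases lt_or_gt_of_ne (hpB ⟨B', hB'⟩) with h2 | h2
      · exact absurd ((hlow ⟨B, hB⟩ ⟨B', hB'⟩ h1 h2).1 hBD) hBD'
      · exact h2
    refine Or.inl fun C => ⟨fun hC => ?_, fun hC => (hlow ⟨B, hB⟩ C h1 hC).1 hBD⟩
    rcases lt_or_gt_of_ne (hpB C) with h3 | h3
    · exact h3
    · exact absurd ((hupp C ⟨B', hB'⟩ h3 h2).1 hC) hBD'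
  · have h2 : ψ (Sum.inl ⟨B', hB'⟩) < p := by
      rcases lt_or_gt_of_ne (hpB ⟨B', hB'⟩) with h2 | h2
      · exact h2
      · exact absurd ((hupp ⟨B, hB⟩ ⟨B', hB'⟩ h1 h2).1 hBD) hBD'
    refine Or.inr fun C => ⟨fun hC => ?_, fun hC => (hupp ⟨B, hB⟩ C h1 hC).1 hBD⟩
    rcases lt_or_gt_of_ne (hpB C) with h3 | h3
    · exact absurd ((hlow C ⟨B', hB'⟩ h3 h2).1 hC) hBD'
    · exact h3

/-- A multigraph with three disjoint splits has a block graph that is not a path. -/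
theorem not_isPathGraph_of_isSplit (hV : V(H).Finite) (hE : E(H).Finite) (hH : GraphConnected H)
    {v : Fin 3 → α} {D : Fin 3 → Set β} (h : ∀ i, IsSplit H (v i) (D i))
    (hd : ∀ i j, i ≠ j → Disjoint (D i) (D j)) : ¬ IsPathGraph (blockGraph H) := by
  rintro ⟨n, -, ⟨ψ⟩⟩
  have hblock : ∀ i, ∃ B : {B : Graph α β // IsBlock H B}, E(B.1).Nonempty ∧ E(B.1) ⊆ D i := by
    intro i
    obtain ⟨e, he⟩ := (h i).nonempty
    obtain ⟨B, hB, heB⟩ := exists_isBlock_mem hV hE ((h i).subset he)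
    exact ⟨⟨B, hB⟩, ⟨e, heB⟩, (hB.prop.2.subset_or_disjoint hB.prop.1 (h i)).resolve_right
      fun hd => hd.le_bot ⟨heB, he⟩⟩
  have hnot : ∀ i j, i ≠ j → ∀ B : {B : Graph α β // IsBlock H B}, E(B.1).Nonempty →
      E(B.1) ⊆ D i → ¬ E(B.1) ⊆ D j := by
    rintro i j hij B ⟨e, he⟩ h1 h2
    exact (hd i j hij).le_bot ⟨h1 he, h2 he⟩
  have hdich := fun i => (h i).eq_lower_or_upper hV hE hH ψ
  have hpair : ∀ i j, i ≠ j → ¬ ((∀ B, E(B.1) ⊆ D i ↔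
        ψ (Sum.inl B) < ψ (Sum.inr ⟨v i, (h i).isSeparatingVertex hH⟩)) ∧
      (∀ B, E(B.1) ⊆ D j ↔
        ψ (Sum.inl B) < ψ (Sum.inr ⟨v j, (h j).isSeparatingVertex hH⟩))) := by
    rintro i j hij ⟨hi, hj⟩
    obtain ⟨B, hB, hBi⟩ := hblock i
    obtain ⟨B', hB', hBj⟩ := hblock j
    rcases le_total (ψ (Sum.inr ⟨v i, (h i).isSeparatingVertex hH⟩))
      (ψ (Sum.inr ⟨v j, (h j).isSeparatingVertex hH⟩)) with hle | hle
    · exact hnot i j hij B hB hBi ((hj B).2 (((hi B).1 hBi).trans_le hle))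
    · exact hnot j i hij.symm B' hB' hBj ((hi B').2 (((hj B').1 hBj).trans_le hle))
  have hpair' : ∀ i j, i ≠ j → ¬ ((∀ B, E(B.1) ⊆ D i ↔
        ψ (Sum.inr ⟨v i, (h i).isSeparatingVertex hH⟩) < ψ (Sum.inl B)) ∧
      (∀ B, E(B.1) ⊆ D j ↔
        ψ (Sum.inr ⟨v j, (h j).isSeparatingVertex hH⟩) < ψ (Sum.inl B))) := by
    rintro i j hij ⟨hi, hj⟩
    obtain ⟨B, hB, hBi⟩ := hblock i
    obtain ⟨B', hB', hBj⟩ := hblock j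
    rcases le_total (ψ (Sum.inr ⟨v i, (h i).isSeparatingVertex hH⟩))
      (ψ (Sum.inr ⟨v j, (h j).isSeparatingVertex hH⟩)) with hle | hle
    · exact hnot j i hij.symm B' hB' hBj ((hi B').2 (hle.trans_lt ((hj B').1 hBj)))
    · exact hnot i j hij B hB hBi ((hj B).2 (hle.trans_lt ((hi B).1 hBi)))
  -- Among three splits two are of the same kind, both lower or both upper, hence nested; disjoint
  -- non-empty sets are not.
  rcases hdich 0 with h0 | h0 <;> rcases hdich 1 with h1 | h1 <;> rcases hdich 2 with h2 | h2
  · exact hpair 0 1 (by decide) ⟨h0, h1⟩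
  · exact hpair 0 1 (by decide) ⟨h0, h1⟩
  · exact hpair 0 2 (by decide) ⟨h0, h2⟩
  · exact hpair' 1 2 (by decide) ⟨h1, h2⟩
  · exact hpair 1 2 (by decide) ⟨h1, h2⟩
  · exact hpair' 0 2 (by decide) ⟨h0, h2⟩
  · exact hpair' 0 1 (by decide) ⟨h0, h1⟩
  · exact hpair' 0 1 (by decide) ⟨h0, h1⟩

end Splits

/-! ## Sweeps of a multigraph -/

section Sweeps

open scoped Graph

variable {α β : Type*} {H K : Graph α β} {f : α → ℝ} {a b : β → ℝ}

/-- A sweep of `H` gives each vertex `x` a height `f x`, and each edge `e` an interval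
`(a e, b e)` between the heights of its ends; only the lowest vertex may carry a loop below it,
and only the highest one a loop above it. Every vertex but the lowest has an edge below it, and
every vertex but the highest has an edge above it. -/
structure Sweep (H : Graph α β) (f : α → ℝ) (a b : β → ℝ) : Prop where
  inj : InjOn f V(H)
  lt : ∀ e ∈ E(H), a e < b e
  link : ∀ e ∈ E(H), ∃ x y, H.IsLink e x y ∧ ((f x = a e ∧ f y = b e) ∨
    (x = y ∧ f x = b e ∧ ∀ z ∈ V(H), f x ≤ f z) ∨ (x = y ∧ f x = a e ∧ ∀ z ∈ V(H), f z ≤ f x))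
  down : ∀ x ∈ V(H), (∃ z ∈ V(H), f z < f x) → ∃ e y, H.IsLink e y x ∧ f y = a e ∧ f x = b e
  up : ∀ x ∈ V(H), (∃ z ∈ V(H), f x < f z) → ∃ e y, H.IsLink e x y ∧ f x = a e ∧ f y = b e
  low_unique : ∀ e ∈ E(H), ∀ e' ∈ E(H), (∀ z ∈ V(H), a e < f z) → (∀ z ∈ V(H), a e' < f z) →
    e = e'
  high_unique : ∀ e ∈ E(H), ∀ e' ∈ E(H), (∀ z ∈ V(H), f z < b e) → (∀ z ∈ V(H), f z < b e') →
    e = e'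

/-- Turning the sweep upside down exchanges the two exceptional loops; statements about the top
follow from those about the bottom. -/
theorem Sweep.neg (h : Sweep H f a b) :
    Sweep H (fun x => -f x) (fun e => -b e) (fun e => -a e) where
  inj x hx y hy hxy := h.inj hx hy (neg_injective hxy)
  lt e he := neg_lt_neg (h.lt e he)
  link e he := by
    obtain ⟨x, y, hxy, h1 | h1 | h1⟩ := h.link e he
    · exact ⟨y, x, hxy.symm, Or.inl ⟨by rw [h1.2], by rw [h1.1]⟩⟩
    · exact ⟨x, y, hxy, Or.inr (Or.inr ⟨h1.1, by rw [h1.2.1], fun z hz => neg_le_neg (h1.2.2 z hz)⟩)⟩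
    · exact ⟨x, y, hxy, Or.inr (Or.inl ⟨h1.1, by rw [h1.2.1], fun z hz => neg_le_neg (h1.2.2 z hz)⟩)⟩
  down x hx hz := by
    obtain ⟨z, hz, hlt⟩ := hz
    obtain ⟨e, y, hl, h1, h2⟩ := h.up x hx ⟨z, hz, by linarith⟩
    exact ⟨e, y, hl.symm, by rw [h2], by rw [h1]⟩
  up x hx hz := by
    obtain ⟨z, hz, hlt⟩ := hz
    obtain ⟨e, y, hl, h1, h2⟩ := h.down x hx ⟨z, hz, by linarith⟩
    exact ⟨e, y, hl.symm, by rw [h2], by rw [h1]⟩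
  low_unique e he e' he' h1 h2 := h.high_unique e he e' he'
    (fun z hz => neg_lt_neg_iff.1 (h1 z hz)) (fun z hz => neg_lt_neg_iff.1 (h2 z hz))
  high_unique e he e' he' h1 h2 := h.low_unique e he e' he'
    (fun z hz => neg_lt_neg_iff.1 (h1 z hz)) (fun z hz => neg_lt_neg_iff.1 (h2 z hz))

/-- Induction along the heights. -/
theorem finite_induction_on_height {S : Set α} (hS : S.Finite) (g : α → ℝ) {P : α → Prop}
    (h : ∀ x ∈ S, (∀ y ∈ S, g y < g x → P y) → P x) : ∀ x ∈ S, P x := by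
  by_contra! hcon
  obtain ⟨x, ⟨hx, hPx⟩, hmin⟩ := Set.exists_min_image {x ∈ S | ¬ P x} g
    (hS.subset fun x hx => hx.1) (by obtain ⟨x, hx⟩ := hcon; exact ⟨x, hx⟩)
  exact hPx (h x hx fun y hy hlt => by
    by_contra hPy
    exact absurd (hmin y ⟨hy, hPy⟩) (not_le.2 hlt))

/-- Every vertex descends along edges to the lowest one. -/
theorem Sweep.graphConnected (h : Sweep H f a b) (hV : V(H).Finite) (hne : V(H).Nonempty) :
    GraphConnected H := by
  obtain ⟨v, hv, hmin⟩ := Set.exists_min_image V(H) f hV hne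
  refine graphConnected_of_center hv (finite_induction_on_height hV f fun x hx ih => ?_)
  by_cases hxv : x = v
  · rw [hxv]
  have hlt : f v < f x := lt_of_le_of_ne (hmin x hx) fun h' => hxv (h.inj hx hv h'.symm)
  obtain ⟨e, y, hl, h1, h2⟩ := h.down x hx ⟨v, hv, hlt⟩
  exact .head ⟨e, hl.symm⟩ (ih y hl.left_mem (by rw [h1, h2]; exact h.lt e hl.edge_mem))

theorem Sweep.eq_or_eq_of_inc (h : Sweep H f a b) {e : β} {x : α} (hx : H.Inc e x) :
    f x = a e ∨ f x = b e := by
  obtain ⟨y, z, hl, h1⟩ := h.link e hx.edge_mem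
  rcases hx.eq_or_eq_of_isLink hl with rfl | rfl
  · tauto
  · rcases h1 with h1 | ⟨rfl, h1⟩ | ⟨rfl, h1⟩ <;> tauto

theorem Sweep.le_of_inc (h : Sweep H f a b) {e : β} {x : α} (hx : H.Inc e x) :
    a e ≤ f x ∧ f x ≤ b e := by
  have := h.lt e hx.edge_mem
  rcases h.eq_or_eq_of_inc hx with h1 | h1 <;> constructor <;> linarith

/-- An edge has an end at its lower height, or it is the loop below the lowest vertex. -/
theorem Sweep.exists_low_end (h : Sweep H f a b) {e : β} (he : e ∈ E(H)) :
    (∃ x, H.Inc e x ∧ f x = a e) ∨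
      ((∀ z ∈ V(H), a e < f z) ∧ ∃ x, H.IsLink e x x ∧ f x = b e ∧ ∀ z ∈ V(H), f x ≤ f z) := by
  have hlt := h.lt e he
  obtain ⟨x, y, hl, h1 | h1 | h1⟩ := h.link e he
  · exact Or.inl ⟨x, hl.inc_left, h1.1⟩
  · obtain ⟨rfl, h1, h2⟩ := h1
    exact Or.inr ⟨fun z hz => by have := h2 z hz; linarith, x, hl, h1, h2⟩
  · exact Or.inl ⟨x, hl.inc_left, h1.2.1⟩

/-! ### Separating vertices of a sweep -/

/-- A vertex with edges below it and above it and no edge passing by. -/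
structure IsCut (H : Graph α β) (f : α → ℝ) (a b : β → ℝ) (v : α) : Prop where
  mem : v ∈ V(H)
  below : ∃ e ∈ E(H), b e ≤ f v
  above : ∃ e ∈ E(H), f v ≤ a e
  not_cross : ∀ e ∈ E(H), a e < f v → b e ≤ f v

theorem IsCut.neg {v : α} (h : IsCut H f a b v) :
    IsCut H (fun x => -f x) (fun e => -b e) (fun e => -a e) v where
  mem := h.mem
  below := by obtain ⟨e, he, h1⟩ := h.above; exact ⟨e, he, neg_le_neg h1⟩
  above := by obtain ⟨e, he, h1⟩ := h.below; exact ⟨e, he, neg_le_neg h1⟩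
  not_cross e he h1 := by
    by_contra h2
    have := h.not_cross e he (by linarith)
    linarith

theorem IsCut.isSplit {v : α} (hv : IsCut H f a b v) (h : Sweep H f a b) :
    IsSplit H v {e ∈ E(H) | b e ≤ f v} where
  subset e he := he.1
  nonempty := hv.below
  compl_nonempty := by
    obtain ⟨e, he, h1⟩ := hv.above
    exact ⟨e, he, fun h2 => by have := h.lt e he; have := h2.2; linarith⟩
  eq_of_inc e he e' he' x hx hx' := by
    have h1 := (h.le_of_inc hx).2
    have h2 := (h.le_of_inc hx').1
    have h3 : f v ≤ a e' := by
      by_contra h3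
      exact he'.2 ⟨he'.1, hv.not_cross e' he'.1 (not_le.1 h3)⟩
    exact h.inj hx.vertex_mem hv.mem (le_antisymm (h1.trans he.2) (h3.trans h2))

theorem IsSplit.mem_iff_of_inc {v x : α} {D : Set β} (hD : IsSplit H v D) {e e' : β}
    (hx : H.Inc e x) (hx' : H.Inc e' x) (hv : x ≠ v) : e ∈ D ↔ e' ∈ D := by
  constructor
  · intro h
    by_contra h'
    exact hv (hD.eq_of_inc e h e' ⟨hx'.edge_mem, h'⟩ x hx hx')
  · intro h
    by_contra h'
    exact hv (hD.eq_of_inc e' h e ⟨hx.edge_mem, h'⟩ x hx' hx)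

/-- An edge that starts below `v` can be continued downwards through vertices below `v`, none of
which is `v`, until it meets the lowest edge. Along this descent the side of the split cannot
change. -/
theorem Sweep.mem_split_iff (h : Sweep H f a b) (hE : E(H).Finite) {v : α} {D : Set β}
    (hD : IsSplit H v D) :
    ∃ P : Prop, ∀ e ∈ E(H), a e < f v → (e ∈ D ↔ P) := by
  obtain ⟨m, hm, hmin⟩ := Set.exists_min_image E(H) a hE (hD.nonempty.mono hD.subset)
  refine ⟨m ∈ D, finite_induction_on_height hE a fun e he ih hlt => ?_⟩
  rcases h.exists_low_end he with ⟨x, hx, hfx⟩ | ⟨hlow, -⟩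
  · have hxv : x ≠ v := by rintro rfl; exact absurd hfx hlt.ne'
    by_cases hz : ∃ z ∈ V(H), f z < f x
    · obtain ⟨e', y, hl, h1, h2⟩ := h.down x hx.vertex_mem hz
      have := h.lt e' hl.edge_mem
      rw [hD.mem_iff_of_inc hx hl.inc_right hxv]
      exact ih e' hl.edge_mem (by linarith) (by linarith)
    -- Now `x` is the lowest vertex, and the edge `m` with the least lower height must be incident
    -- with it, whether it starts there or is the loop below.
    · push Not at hz
      have hme := hmin e he
      rcases h.exists_low_end hm with ⟨x', hx', hfx'⟩ | ⟨hlow, x', hx', h1, h2⟩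
      · obtain rfl : x' = x := h.inj hx'.vertex_mem hx.vertex_mem
          (le_antisymm (by linarith) (hz x' hx'.vertex_mem))
        exact hD.mem_iff_of_inc hx hx' hxv
      · obtain rfl : x' = x := h.inj hx'.left_mem hx.vertex_mem
          (le_antisymm (h2 x hx.vertex_mem) (hz x' hx'.left_mem))
        exact hD.mem_iff_of_inc hx hx'.inc_left hxv
  · rw [h.low_unique e he m hm hlow fun z hz => (hmin e he).trans_lt (hlow z hz)]

/-- All edges that start below `v` are on one side of the split, and all edges that end above `v`
are on one side too. Every edge is of at least one of these kinds, so the two sides must differ, and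
then no edge is of both kinds, that is, none crosses the height of `v`. -/
theorem Sweep.isCut_of_isSplit (h : Sweep H f a b) (hE : E(H).Finite) {v : α} (hv : v ∈ V(H))
    {D : Set β} (hD : IsSplit H v D) : IsCut H f a b v := by
  obtain ⟨P, hP⟩ := h.mem_split_iff hE hD
  obtain ⟨Q, hQ⟩ := h.neg.mem_split_iff hE hD
  have hQ' : ∀ e ∈ E(H), f v < b e → (e ∈ D ↔ Q) := fun e he hlt => hQ e he (neg_lt_neg hlt)
  have hor : ∀ e ∈ E(H), a e < f v ∨ f v < b e := fun e he => by
    by_contra! hcon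
    have := h.lt e he
    linarith
  obtain ⟨e₁, he₁⟩ := hD.nonempty
  obtain ⟨e₂, he₂, he₂'⟩ := hD.compl_nonempty
  have hPQ : ¬ (P ↔ Q) := by
    intro hPQ
    rcases hor e₁ (hD.subset he₁) with h1 | h1 <;> rcases hor e₂ he₂ with h2 | h2
    · exact he₂' ((hP e₂ he₂ h2).2 ((hP e₁ (hD.subset he₁) h1).1 he₁))
    · exact he₂' ((hQ' e₂ he₂ h2).2 (hPQ.1 ((hP e₁ (hD.subset he₁) h1).1 he₁)))
    · exact he₂' ((hP e₂ he₂ h2).2 (hPQ.2 ((hQ' e₁ (hD.subset he₁) h1).1 he₁)))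
    · exact he₂' ((hQ' e₂ he₂ h2).2 ((hQ' e₁ (hD.subset he₁) h1).1 he₁))
  have hnc : ∀ e ∈ E(H), a e < f v → b e ≤ f v := by
    intro e he h1
    by_contra h2
    exact hPQ ((hP e he h1).symm.trans (hQ' e he (not_le.1 h2)))
  refine ⟨hv, ?_, ?_, hnc⟩
  · by_contra! hcon
    exact he₂' ((hQ' e₂ he₂ (hcon e₂ he₂)).2
      ((hQ' e₁ (hD.subset he₁) (hcon e₁ (hD.subset he₁))).1 he₁))
  · by_contra! hcon
    exact he₂' ((hP e₂ he₂ (hcon e₂ he₂)).2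
      ((hP e₁ (hD.subset he₁) (hcon e₁ (hD.subset he₁))).1 he₁))

theorem Sweep.isSeparatingVertex_iff (h : Sweep H f a b) (hV : V(H).Finite) (hE : E(H).Finite)
    {v : α} : IsSeparatingVertex H v ↔ IsCut H f a b v := by
  constructor
  · intro hv
    obtain ⟨hmem, D, hD⟩ := hv.exists_isSplit
    exact h.isCut_of_isSplit hE hmem hD
  · intro hv
    exact (hv.isSplit h).isSeparatingVertex (h.graphConnected hV ⟨v, hv.mem⟩)

/-- For a cut that is not the lowest vertex this is the descent condition of the sweep. The lowest
vertex can be a cut only through the loop hanging from it. -/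
theorem IsCut.exists_below (h : Sweep H f a b) {v : α} (hv : IsCut H f a b v) :
    ∃ e, H.Inc e v ∧ f v = b e := by
  by_cases hz : ∃ z ∈ V(H), f z < f v
  · obtain ⟨e, y, hl, -, h2⟩ := h.down v hv.mem hz
    exact ⟨e, hl.inc_right, h2⟩
  push Not at hz
  obtain ⟨e, he, hle⟩ := hv.below
  have hlt := h.lt e he
  rcases h.exists_low_end he with ⟨x, hx, hfx⟩ | ⟨-, x, hx, h1, h2⟩
  · have := hz x hx.vertex_mem
    linarith
  · obtain rfl : x = v := h.inj hx.left_mem hv.mem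
      (le_antisymm (h2 v hv.mem) (hz x hx.left_mem))
    exact ⟨e, hx.inc_left, h1⟩

theorem IsCut.exists_above (h : Sweep H f a b) {v : α} (hv : IsCut H f a b v) :
    ∃ e, H.Inc e v ∧ f v = a e := by
  obtain ⟨e, he, h1⟩ := hv.neg.exists_below h.neg
  exact ⟨e, he, neg_injective h1⟩

/-! ### Blocks of a sweep -/

/-- The number of cuts below an edge. -/
noncomputable def cutRank (H : Graph α β) (f : α → ℝ) (a b : β → ℝ) (e : β) : ℕ :=
  {c | IsCut H f a b c ∧ f c ≤ a e}.ncard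

/-- The number of cuts below a vertex. -/
noncomputable def cutPos (H : Graph α β) (f : α → ℝ) (a b : β → ℝ) (v : α) : ℕ :=
  {c | IsCut H f a b c ∧ f c < f v}.ncard

theorem finite_cuts (hV : V(H).Finite) (p : α → Prop) : {c | IsCut H f a b c ∧ p c}.Finite :=
  hV.subset fun _ hc => hc.1.mem

theorem Sweep.le_iff_of_isCut (h : Sweep H f a b) {c : α} (hc : IsCut H f a b c) {e : β}
    (he : e ∈ E(H)) : f c ≤ a e ↔ f c < b e := by
  refine ⟨fun h1 => h1.trans_lt (h.lt e he), fun h1 => ?_⟩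
  by_contra h2
  exact absurd (hc.not_cross e he (not_le.1 h2)) (not_le.2 h1)

theorem Sweep.cutRank_eq (h : Sweep H f a b) {e : β} (he : e ∈ E(H)) :
    cutRank H f a b e = {c | IsCut H f a b c ∧ f c < b e}.ncard := by
  unfold cutRank
  congr 1
  ext c
  exact and_congr_right fun hc => h.le_iff_of_isCut hc he

/-- No edge crosses a cut, so a cut below the start of `e` and hence below the finish of `e'` is
already below the start of `e'`. In particular, edges that overlap in height have equal rank. -/
theorem Sweep.cutRank_le_cutRank (h : Sweep H f a b) (hV : V(H).Finite) {e e' : β}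
    (he' : e' ∈ E(H)) (hlt : a e < b e') : cutRank H f a b e ≤ cutRank H f a b e' := by
  rw [h.cutRank_eq he']
  exact ncard_le_ncard (fun c hc => ⟨hc.1, hc.2.trans_lt hlt⟩) (finite_cuts hV _)

theorem Sweep.cutRank_of_eq_upper (h : Sweep H f a b) {e : β} (he : e ∈ E(H)) {v : α}
    (hv : f v = b e) : cutRank H f a b e = cutPos H f a b v := by
  rw [h.cutRank_eq he, cutPos, hv]

/-- An edge rising from the cut `v` has `v` itself among the cuts below it, which accounts for the
`+ 1`; an edge arriving at `v` does not. -/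
theorem Sweep.cutRank_of_eq_lower (h : Sweep H f a b) (hV : V(H).Finite) {e : β}
    {v : α} (hc : IsCut H f a b v) (hv : f v = a e) :
    cutRank H f a b e = cutPos H f a b v + 1 := by
  rw [cutPos, ← ncard_insert_of_notMem (a := v) (fun h => lt_irrefl _ h.2) (finite_cuts hV _)]
  unfold cutRank
  congr 1
  ext c
  simp only [mem_ofPred_eq, mem_insert_iff, ← hv]
  constructor
  · rintro ⟨h1, h2⟩
    rcases h2.lt_or_eq with h3 | h3
    · exact Or.inr ⟨h1, h3⟩
    · exact Or.inl (h.inj h1.mem hc.mem h3)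
  · rintro (rfl | h1)
    · exact ⟨hc, le_rfl⟩
    · exact ⟨h1.1, h1.2.le⟩

/-- The part of a swept multigraph between two consecutive cuts. -/
def cutBlock (H : Graph α β) (f : α → ℝ) (a b : β → ℝ) (i : ℕ) : Graph α β :=
  edgeSpan H {e ∈ E(H) | cutRank H f a b e = i}

theorem edgeSet_cutBlock (i : ℕ) :
    E(cutBlock H f a b i) = {e ∈ E(H) | cutRank H f a b e = i} :=
  edgeSet_edgeSpan fun _ he => he.1

/-- The edge of the whole sweep that leads down from `x` has its rank squeezed between the ranks of
two edges of the layer, so it belongs to the layer. -/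
theorem Sweep.down_cutBlock (h : Sweep H f a b) (hV : V(H).Finite) (i : ℕ) :
    ∀ x ∈ V(cutBlock H f a b i), (∃ z ∈ V(cutBlock H f a b i), f z < f x) →
      ∃ e y, (cutBlock H f a b i).IsLink e y x ∧ f y = a e ∧ f x = b e := by
  rintro x ⟨e₁, ⟨he₁, hr₁⟩, hx⟩ ⟨z, ⟨e₂, ⟨he₂, hr₂⟩, hz⟩, hlt⟩
  obtain ⟨e, y, hl, h1, h2⟩ := h.down x hx.vertex_mem ⟨z, hz.vertex_mem, hlt⟩
  refine ⟨e, y, ⟨⟨hl.edge_mem, le_antisymm ?_ ?_⟩, hl⟩, h1, h2⟩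
  · rw [← hr₁]
    exact h.cutRank_le_cutRank hV he₁
      ((h.lt e hl.edge_mem).trans_le (h2.symm.trans_le (h.le_of_inc hx).2))
  · rw [← hr₂]
    exact h.cutRank_le_cutRank hV hl.edge_mem (by have := (h.le_of_inc hz).1; linarith)

theorem Sweep.up_cutBlock (h : Sweep H f a b) (hV : V(H).Finite) (i : ℕ) :
    ∀ x ∈ V(cutBlock H f a b i), (∃ z ∈ V(cutBlock H f a b i), f x < f z) →
      ∃ e y, (cutBlock H f a b i).IsLink e x y ∧ f x = a e ∧ f y = b e := by
  rintro x ⟨e₁, ⟨he₁, hr₁⟩, hx⟩ ⟨z, ⟨e₂, ⟨he₂, hr₂⟩, hz⟩, hlt⟩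
  obtain ⟨e, y, hl, h1, h2⟩ := h.up x hx.vertex_mem ⟨z, hz.vertex_mem, hlt⟩
  refine ⟨e, y, ⟨⟨hl.edge_mem, le_antisymm ?_ ?_⟩, hl⟩, h1, h2⟩
  · rw [← hr₂]
    exact h.cutRank_le_cutRank hV he₂ (by have := (h.le_of_inc hz).2; linarith)
  · rw [← hr₁]
    exact h.cutRank_le_cutRank hV hl.edge_mem
      (by have := (h.le_of_inc hx).1; have := h.lt e hl.edge_mem; linarith)

theorem Sweep.low_of_low_cutBlock (h : Sweep H f a b) {i : ℕ} {e : β}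
    (he : e ∈ E(cutBlock H f a b i)) (hlow : ∀ z ∈ V(cutBlock H f a b i), a e < f z) :
    ∀ z ∈ V(H), a e < f z := by
  rw [edgeSet_cutBlock] at he
  rcases h.exists_low_end he.1 with ⟨x, hx, hfx⟩ | ⟨h1, -⟩
  · exact absurd hfx (hlow x ⟨e, he, hx⟩).ne'
  · exact h1

theorem Sweep.high_of_high_cutBlock (h : Sweep H f a b) {i : ℕ} {e : β}
    (he : e ∈ E(cutBlock H f a b i)) (hhigh : ∀ z ∈ V(cutBlock H f a b i), f z < b e) :
    ∀ z ∈ V(H), f z < b e := by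
  rw [edgeSet_cutBlock] at he
  rcases h.neg.exists_low_end he.1 with ⟨x, hx, hfx⟩ | ⟨h1, -⟩
  · exact absurd (neg_injective hfx) (hhigh x ⟨e, he, hx⟩).ne
  · exact fun z hz => neg_lt_neg_iff.1 (h1 z hz)

theorem Sweep.cutBlock (h : Sweep H f a b) (hV : V(H).Finite) (i : ℕ) :
    Sweep (cutBlock H f a b i) f a b where
  inj := h.inj.mono (edgeSpan_le _).1
  lt e he := h.lt e ((edgeSpan_le _).edgeSet_mono he)
  link e he := by
    have he' := he
    rw [edgeSet_cutBlock] at he'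
    have hsub : V(TangleDivision.cutBlock H f a b i) ⊆ V(H) := (edgeSpan_le _).1
    obtain ⟨x, y, hl, h1⟩ := h.link e he'.1
    refine ⟨x, y, ⟨he', hl⟩, h1.imp_right (Or.imp ?_ ?_)⟩
    · exact fun h2 => ⟨h2.1, h2.2.1, fun z hz => h2.2.2 z (hsub hz)⟩
    · exact fun h2 => ⟨h2.1, h2.2.1, fun z hz => h2.2.2 z (hsub hz)⟩
  down := h.down_cutBlock hV i
  up := h.up_cutBlock hV i
  low_unique e he e' he' h1 h2 := h.low_unique e ((edgeSpan_le _).edgeSet_mono he) e'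
    ((edgeSpan_le _).edgeSet_mono he') (h.low_of_low_cutBlock he h1) (h.low_of_low_cutBlock he' h2)
  high_unique e he e' he' h1 h2 := h.high_unique e ((edgeSpan_le _).edgeSet_mono he) e'
    ((edgeSpan_le _).edgeSet_mono he') (h.high_of_high_cutBlock he h1)
    (h.high_of_high_cutBlock he' h2)

/-- An edge of the whole multigraph crossing the height of such a vertex would have rank `i` and
belong to the layer, so a cut of the layer is a cut of the whole. It would then separate the ranks
of an edge below it and an edge above it, which are both `i`. -/
theorem Sweep.not_isCut_cutBlock (h : Sweep H f a b) (hV : V(H).Finite) (i : ℕ) (v : α) :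
    ¬ IsCut (TangleDivision.cutBlock H f a b i) f a b v := by
  intro hv
  obtain ⟨e₁, he₁, h1⟩ := hv.below
  obtain ⟨e₂, he₂, h2⟩ := hv.above
  have hnc := hv.not_cross
  rw [edgeSet_cutBlock] at he₁ he₂ hnc
  have hcut : IsCut H f a b v := by
    refine ⟨(edgeSpan_le _).1 hv.mem, ⟨e₁, he₁.1, h1⟩, ⟨e₂, he₂.1, h2⟩, fun e he hlt => ?_⟩
    by_contra hcross
    refine hcross (hnc e ⟨he, le_antisymm ?_ ?_⟩ hlt)
    · rw [← he₂.2]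
      exact h.cutRank_le_cutRank hV he₂.1 (by have := h.lt e₂ he₂.1; linarith)
    · rw [← he₁.2]
      exact h.cutRank_le_cutRank hV he (by have := h.lt e₁ he₁.1; linarith)
  have : cutRank H f a b e₁ < cutRank H f a b e₂ := by
    apply ncard_lt_ncard _ (finite_cuts hV _)
    have := h.lt e₁ he₁.1
    refine ⟨fun c hc => ⟨hc.1, by have := hc.2; linarith⟩, fun hsub => ?_⟩
    have := (hsub (show v ∈ _ from ⟨hcut, h2⟩)).2
    linarith
  exact this.ne (he₁.2.trans he₂.2.symm)

theorem Sweep.isNonseparable_cutBlock (h : Sweep H f a b) (hV : V(H).Finite) (hE : E(H).Finite)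
    {i : ℕ} (hi : ∃ e ∈ E(H), cutRank H f a b e = i) :
    IsNonseparable (TangleDivision.cutBlock H f a b i) := by
  have hV' : V(TangleDivision.cutBlock H f a b i).Finite := hV.subset (edgeSpan_le _).1
  obtain ⟨e, he, hr⟩ := hi
  obtain ⟨x, y, hl⟩ := H.exists_isLink_of_mem_edgeSet he
  refine ⟨(h.cutBlock hV i).graphConnected hV' ⟨x, e, ⟨he, hr⟩, hl.inc_left⟩, fun v hv => ?_⟩
  rw [(h.cutBlock hV i).isSeparatingVertex_iff hV'
    (hE.subset (edgeSpan_le _).edgeSet_mono)] at hv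
  exact h.not_isCut_cutBlock hV i v hv

/-- Each cut is a split, and a non-separable subgraph lies on one side of it. Exchanging `e` and
`e'` gives equality. -/
theorem Sweep.cutRank_le_of_isNonseparable (h : Sweep H f a b) (hV : V(H).Finite)
    (hK : IsNonseparable K) (hle : K ≤ H) {e e' : β} (he : e ∈ E(K)) (he' : e' ∈ E(K)) :
    cutRank H f a b e' ≤ cutRank H f a b e := by
  apply ncard_le_ncard _ (finite_cuts hV _)
  rintro c ⟨hc, h1⟩
  refine ⟨hc, ?_⟩
  by_contra h2
  have h3 := hc.not_cross e (hle.edgeSet_mono he) (not_le.1 h2)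
  have hlt := h.lt e' (hle.edgeSet_mono he')
  rcases hK.subset_or_disjoint hle (hc.isSplit h) with h4 | h4
  · have := (h4 he').2
    linarith
  · exact h4.le_bot ⟨he, hle.edgeSet_mono he, h3⟩

/-- A non-separable subgraph lies between two consecutive cuts. -/
theorem Sweep.exists_le_cutBlock (h : Sweep H f a b) (hV : V(H).Finite) (hne : E(H).Nonempty)
    (hK : IsNonseparable K) (hle : K ≤ H) :
    ∃ e ∈ E(H), K ≤ TangleDivision.cutBlock H f a b (cutRank H f a b e) ∧
      (E(K).Nonempty → e ∈ E(K)) := by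
  by_cases hKE : E(K).Nonempty
  · obtain ⟨e, he⟩ := hKE
    refine ⟨e, hle.edgeSet_mono he, le_edgeSpan hle (fun x hx => hK.1.exists_inc ⟨e, he⟩ hx) ?_,
      fun _ => he⟩
    intro e' he'
    exact ⟨hle.edgeSet_mono he', le_antisymm (h.cutRank_le_of_isNonseparable hV hK hle he he')
      (h.cutRank_le_of_isNonseparable hV hK hle he' he)⟩
  · obtain ⟨x, hx⟩ := hK.1.1
    obtain ⟨e, he⟩ := (h.graphConnected hV ⟨x, hle.1 hx⟩).exists_inc hne (hle.1 hx)
    refine ⟨e, he.edge_mem, ?_, fun h => absurd h hKE⟩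
    refine (hK.le_edgeSpan_of_edgeSet_eq_empty (not_nonempty_iff_eq_empty.1 hKE) hx he).trans ?_
    refine ⟨?_, ?_⟩
    · rintro y ⟨e', rfl, hy⟩; exact ⟨_, ⟨hy.edge_mem, rfl⟩, hy⟩
    · rintro e' y z ⟨rfl, hy⟩; exact ⟨⟨hy.edge_mem, rfl⟩, hy⟩

theorem Sweep.isBlock_iff (h : Sweep H f a b) (hV : V(H).Finite) (hE : E(H).Finite)
    (hne : E(H).Nonempty) {B : Graph α β} :
    IsBlock H B ↔ ∃ e ∈ E(H), B = TangleDivision.cutBlock H f a b (cutRank H f a b e) := by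
  constructor
  · intro hB
    obtain ⟨e, he, hle, -⟩ := h.exists_le_cutBlock hV hne hB.prop.2 hB.prop.1
    exact ⟨e, he, hB.eq_of_le ⟨edgeSpan_le _, h.isNonseparable_cutBlock hV hE ⟨e, he, rfl⟩⟩ hle⟩
  · rintro ⟨e, he, rfl⟩
    refine ⟨⟨edgeSpan_le _, h.isNonseparable_cutBlock hV hE ⟨e, he, rfl⟩⟩, ?_⟩
    rintro K ⟨hKH, hK⟩ hle
    have heK : e ∈ E(K) := hle.edgeSet_mono (by rw [edgeSet_cutBlock]; exact ⟨he, rfl⟩)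
    obtain ⟨e', he', hle', heK'⟩ := h.exists_le_cutBlock hV hne hK hKH
    have : cutRank H f a b e' = cutRank H f a b e :=
      le_antisymm (h.cutRank_le_of_isNonseparable hV hK hKH heK (heK' ⟨e, heK⟩))
        (h.cutRank_le_of_isNonseparable hV hK hKH (heK' ⟨e, heK⟩) heK)
    rw [← this]
    exact hle'

theorem Sweep.mem_cutBlock_iff (h : Sweep H f a b) (hV : V(H).Finite) {v : α}
    (hv : IsCut H f a b v) {i : ℕ} :
    v ∈ V(TangleDivision.cutBlock H f a b i) ↔ i = cutPos H f a b v ∨ i = cutPos H f a b v + 1 := by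
  constructor
  · rintro ⟨e, ⟨he, rfl⟩, hve⟩
    rcases h.eq_or_eq_of_inc hve with h1 | h1
    · exact Or.inr (h.cutRank_of_eq_lower hV hv h1)
    · exact Or.inl (h.cutRank_of_eq_upper he h1)
  · rintro (rfl | rfl)
    · obtain ⟨e, he, h1⟩ := hv.exists_below h
      exact ⟨e, ⟨he.edge_mem, h.cutRank_of_eq_upper he.edge_mem h1⟩, he⟩
    · obtain ⟨e, he, h1⟩ := hv.exists_above h
      exact ⟨e, ⟨he.edge_mem, h.cutRank_of_eq_lower hV hv h1⟩, he⟩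

theorem Sweep.cutPos_injOn (h : Sweep H f a b) (hV : V(H).Finite) :
    InjOn (cutPos H f a b) {c | IsCut H f a b c} := by
  have key : ∀ c c', IsCut H f a b c → f c < f c' → cutPos H f a b c < cutPos H f a b c' := by
    intro c c' hc hlt
    apply ncard_lt_ncard _ (finite_cuts hV _)
    exact ⟨fun d hd => ⟨hd.1, hd.2.trans hlt⟩, fun hsub =>
      lt_irrefl _ (hsub (show c ∈ _ from ⟨hc, hlt⟩)).2⟩
  intro c hc c' hc' heq
  rcases lt_trichotomy (f c) (f c') with h1 | h1 | h1
  · exact absurd heq (key c c' hc h1).ne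
  · exact h.inj hc.mem hc'.mem h1
  · exact absurd heq (key c' c hc' h1).ne'

theorem cutRank_le (hV : V(H).Finite) (e : β) :
    cutRank H f a b e ≤ {c | IsCut H f a b c}.ncard :=
  ncard_le_ncard (fun _ hc => hc.1) (hV.subset fun _ hc => hc.mem)

theorem cutPos_lt (hV : V(H).Finite) {v : α} (hv : IsCut H f a b v) :
    cutPos H f a b v < {c | IsCut H f a b c}.ncard :=
  ncard_lt_ncard ⟨fun _ hc => hc.1, fun hsub => lt_irrefl _ (hsub (show v ∈ _ from hv)).2⟩
    (hV.subset fun _ hc => hc.mem)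

theorem Sweep.exists_cutPos_eq (h : Sweep H f a b) (hV : V(H).Finite) {i : ℕ}
    (hi : i < {c | IsCut H f a b c}.ncard) : ∃ c, IsCut H f a b c ∧ cutPos H f a b c = i := by
  have hfin : {c | IsCut H f a b c}.Finite := hV.subset fun _ hc => hc.mem
  have : cutPos H f a b '' {c | IsCut H f a b c} = Iio {c | IsCut H f a b c}.ncard := by
    refine Set.eq_of_subset_of_ncard_le ?_ ?_ (finite_Iio _)
    · rintro _ ⟨c, hc, rfl⟩; exact cutPos_lt hV hc
    · rw [(h.cutPos_injOn hV).ncard_image]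
      simp
  obtain ⟨c, hc, h1⟩ := this.symm.subset hi
  exact ⟨c, hc, h1⟩

theorem Sweep.exists_cutRank_eq (h : Sweep H f a b) (hV : V(H).Finite) (hne : E(H).Nonempty)
    {i : ℕ} (hi : i ≤ {c | IsCut H f a b c}.ncard) : ∃ e ∈ E(H), cutRank H f a b e = i := by
  rcases hi.lt_or_eq with hlt | heq
  · obtain ⟨c, hc, rfl⟩ := h.exists_cutPos_eq hV hlt
    obtain ⟨e, he, h1⟩ := hc.exists_below h
    exact ⟨e, he.edge_mem, h.cutRank_of_eq_upper he.edge_mem h1⟩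
  · cases i with
    | zero =>
      obtain ⟨e, he⟩ := hne
      refine ⟨e, he, ?_⟩
      have := cutRank_le (f := f) (a := a) (b := b) hV e
      omega
    | succ i =>
      obtain ⟨c, hc, rfl⟩ := h.exists_cutPos_eq (i := i) hV (by omega)
      obtain ⟨e, he, h1⟩ := hc.exists_above h
      exact ⟨e, he.edge_mem, h.cutRank_of_eq_lower hV hc h1⟩

theorem cutBlock_injective {e e' : β} (he : e ∈ E(H))
    (heq : cutBlock H f a b (cutRank H f a b e) = cutBlock H f a b (cutRank H f a b e')) :
    cutRank H f a b e = cutRank H f a b e' := by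
  have : e ∈ E(cutBlock H f a b (cutRank H f a b e)) := by
    rw [edgeSet_cutBlock]; exact ⟨he, rfl⟩
  rw [heq, edgeSet_cutBlock] at this
  exact this.2

/-- The block graph of a swept multigraph is a path. -/
theorem Sweep.isPathGraph (h : Sweep H f a b) (hV : V(H).Finite) (hE : E(H).Finite)
    (hne : E(H).Nonempty) : IsPathGraph (blockGraph H) := by
  set N := {c | IsCut H f a b c}.ncard with hN
  have hblock : ∀ B : {B : Graph α β // IsBlock H B}, ∃ e ∈ E(H),
      B.1 = TangleDivision.cutBlock H f a b (cutRank H f a b e) :=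
    fun B => (h.isBlock_iff hV hE hne).1 B.2
  choose edge hedge hedge' using hblock
  have hcut : ∀ v : {v : α // IsSeparatingVertex H v}, IsCut H f a b v.1 :=
    fun v => (h.isSeparatingVertex_iff hV hE).1 v.2
  -- With `N` cuts there are `N + 1` layers. The layer of rank `i` goes to place `2 * i`, and the
  -- cut at the top of it to place `2 * i + 1`.
  let idx : {B : Graph α β // IsBlock H B} ⊕ {v : α // IsSeparatingVertex H v} →
      Fin (2 * N + 1) :=
    Sum.elim (fun B => ⟨2 * cutRank H f a b (edge B), by
        have := cutRank_le (f := f) (a := a) (b := b) hV (edge B); omega⟩)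
      (fun v => ⟨2 * cutPos H f a b v.1 + 1, by have := cutPos_lt hV (hcut v); omega⟩)
  have hl : ∀ B, (idx (Sum.inl B) : ℕ) = 2 * cutRank H f a b (edge B) := fun B => rfl
  have hr : ∀ v, (idx (Sum.inr v) : ℕ) = 2 * cutPos H f a b v.1 + 1 := fun v => rfl
  have hbij : Function.Bijective idx := by
    constructor
    · rintro (B | v) (B' | v') heq
      · have := congrArg Fin.val heq
        rw [hl, hl] at this
        congr 1
        apply Subtype.ext
        rw [hedge' B, hedge' B', Nat.eq_of_mul_eq_mul_left two_pos this]
      · have := congrArg Fin.val heq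
        rw [hl, hr] at this
        omega
      · have := congrArg Fin.val heq
        rw [hl, hr] at this
        omega
      · have := congrArg Fin.val heq
        rw [hr, hr] at this
        congr 1
        exact Subtype.ext (h.cutPos_injOn hV (hcut v) (hcut v') (by omega))
    · rintro ⟨i, hi⟩
      rcases Nat.even_or_odd' i with ⟨j, rfl | rfl⟩
      · obtain ⟨e, he, hej⟩ := h.exists_cutRank_eq hV hne (i := j) (by omega)
        let B : {B : Graph α β // IsBlock H B} :=
          ⟨TangleDivision.cutBlock H f a b (cutRank H f a b e),
            (h.isBlock_iff hV hE hne).2 ⟨e, he, rfl⟩⟩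
        refine ⟨Sum.inl B, Fin.ext ?_⟩
        rw [hl, ← cutBlock_injective he (hedge' B), hej]
      · obtain ⟨c, hc, hcj⟩ := h.exists_cutPos_eq hV (i := j) (by omega)
        refine ⟨Sum.inr ⟨c, (h.isSeparatingVertex_iff hV hE).2 hc⟩, Fin.ext ?_⟩
        rw [hr]
        simp only [hcj]
  have hmem : ∀ B v, (blockGraph H).Adj (Sum.inl B) (Sum.inr v) ↔
      cutRank H f a b (edge B) = cutPos H f a b v.1 ∨
        cutRank H f a b (edge B) = cutPos H f a b v.1 + 1 := by
    intro B v
    rw [blockGraph_adj_inl_inr, hedge' B, h.mem_cutBlock_iff hV (hcut v)]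
  refine ⟨2 * N + 1, by omega, ⟨⟨Equiv.ofBijective idx hbij, ?_⟩⟩⟩
  intro x y
  rw [SimpleGraph.pathGraph_adj]
  simp only [Equiv.ofBijective_apply]
  rcases x with B | v <;> rcases y with B' | v'
  · simp only [hl, not_blockGraph_adj_inl_inl, iff_false]; omega
  · rw [hmem, hl, hr]; omega
  · rw [SimpleGraph.adj_comm, hmem, hl, hr]; omega
  · simp only [hr, not_blockGraph_adj_inr_inr, iff_false]; omega

end Sweeps

/-! ## The space of a tangle -/

section Space

variable {T : Type*} [TopologicalSpace T]

instance locallyPathConnectedSpace_unitInterval : LocallyPathConnectedSpace unitInterval :=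
  (convex_Icc (0 : ℝ) 1).locallyPathConnectedSpace

theorem finite_endpoints (n : ℕ) : {a : Fin n × unitInterval | a.2 = 0 ∨ a.2 = 1}.Finite := by
  refine ((finite_univ (α := Fin n)).prod ((finite_singleton (1 : unitInterval)).insert 0)).subset ?_
  rintro a (h | h) <;> simp [h]

/-- Saturating a closed set adds only end points of the intervals, of which there are finitely many.
-/
theorem isClosedMap_of_identify {n : ℕ} {q : Fin n × unitInterval → T}
    (hq : Topology.IsQuotientMap q)
    (h : ∀ a b, q a = q b → a = b ∨ ((a.2 = 0 ∨ a.2 = 1) ∧ (b.2 = 0 ∨ b.2 = 1))) :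
    IsClosedMap q := by
  intro C hC
  rw [← hq.isClosed_preimage]
  have : q ⁻¹' (q '' C) = C ∪ (q ⁻¹' (q '' C) ∩ {a | a.2 = 0 ∨ a.2 = 1}) := by
    ext a
    constructor
    · intro ha
      obtain ⟨b, hb, hab⟩ := ha
      rcases h a b hab.symm with rfl | h'
      · exact Or.inl hb
      · exact Or.inr ⟨⟨b, hb, hab⟩, h'.1⟩
    · rintro (ha | ha)
      · exact ⟨a, ha, rfl⟩
      · exact ha.1
  rw [this]
  exact hC.union ((finite_endpoints n).subset inter_subset_right).isClosed

/-- Disjoint closed fibres are separated by open sets upstairs; the complements of the images of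
their complements are open because the map is closed, and they separate the two points. -/
theorem t2Space_of_isClosedMap {X : Type*} [TopologicalSpace X] [NormalSpace X] [T1Space X]
    {q : X → T} (hc : Continuous q) (hs : Function.Surjective q) (hq : IsClosedMap q) :
    T2Space T := by
  refine ⟨fun x y hxy => ?_⟩
  have hcl : ∀ x, IsClosed (q ⁻¹' {x}) := by
    intro x
    obtain ⟨a, rfl⟩ := hs x
    have : IsClosed (q '' {a}) := hq _ isClosed_singleton
    rw [image_singleton] at this
    exact this.preimage hc
  obtain ⟨U, V, hU, hV, hxU, hyV, hUV⟩ := normal_separation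
    (hcl x) (hcl y) (by
      rw [Set.disjoint_left]
      rintro a rfl h
      exact hxy h)
  refine ⟨(q '' Uᶜ)ᶜ, (q '' Vᶜ)ᶜ, (hq _ hU.isClosed_compl).isOpen_compl,
    (hq _ hV.isClosed_compl).isOpen_compl, ?_, ?_, ?_⟩
  · rintro ⟨a, ha, rfl⟩; exact ha (hxU rfl)
  · rintro ⟨a, ha, rfl⟩; exact ha (hyV rfl)
  · rw [Set.disjoint_left]
    intro z hz hz'
    obtain ⟨a, rfl⟩ := hs z
    have h1 : a ∈ U := by by_contra h; exact hz ⟨a, h, rfl⟩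
    have h2 : a ∈ V := by by_contra h; exact hz' ⟨a, h, rfl⟩
    exact hUV.le_bot ⟨h1, h2⟩

/-- The components of the union of a family of disjoint connected open sets are its members. -/
theorem componentsOf_sUnion {P : Set (Set T)} (ho : ∀ e ∈ P, IsOpen e)
    (hc : ∀ e ∈ P, IsConnected e) (hd : ∀ e ∈ P, ∀ e' ∈ P, (e ∩ e').Nonempty → e = e') :
    componentsOf (⋃₀ P) = P := by
  have key : ∀ e ∈ P, ∀ x ∈ e, connectedComponentIn (⋃₀ P) x = e := by
    intro e he x hx
    have hxS : x ∈ ⋃₀ P := ⟨e, he, hx⟩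
    apply Subset.antisymm
    · refine isPreconnected_connectedComponentIn.subset_left_of_subset_union (ho e he)
        (isOpen_sUnion fun e' (he' : e' ∈ P \ {e}) => ho e' he'.1) ?_ ?_
        ⟨x, mem_connectedComponentIn hxS, hx⟩
      · rw [Set.disjoint_left]
        rintro y hy ⟨e', he', hy'⟩
        exact he'.2 (hd e he e' he'.1 ⟨y, hy, hy'⟩).symm
      · refine (connectedComponentIn_subset _ _).trans ?_
        rintro y ⟨e', he', hy⟩
        by_cases h : e' = e
        · exact Or.inl (h ▸ hy)
        · exact Or.inr ⟨e', ⟨he', h⟩, hy⟩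
    · exact (hc e he).isPreconnected.subset_connectedComponentIn hx (subset_sUnion_of_mem he)
  ext e
  constructor
  · rintro ⟨x, ⟨e', he', hx⟩, rfl⟩
    rw [key e' he' x hx]
    exact he'
  · intro he
    obtain ⟨x, hx⟩ := (hc e he).nonempty
    exact ⟨x, ⟨e, he, hx⟩, (key e he x hx).symm⟩

end Space

/-! ## Drawings -/

section Drawings

variable {T : Type*} [TopologicalSpace T]

/-- The space is drawn with the vertex set `V` and the arcs `φ i`. -/
structure Drawing {ι : Type*} (V : Set T) (φ : ι → unitInterval → T) : Prop where
  finite : V.Finite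
  cont : ∀ i, Continuous (φ i)
  zero_mem : ∀ i, φ i 0 ∈ V
  one_mem : ∀ i, φ i 1 ∈ V
  notMem : ∀ i, ∀ t ∈ Ioo (0 : unitInterval) 1, φ i t ∉ V
  inj : ∀ i j, ∀ s ∈ Ioo (0 : unitInterval) 1, ∀ t ∈ Ioo (0 : unitInterval) 1,
    φ i s = φ j t → i = j ∧ s = t
  cover : ∀ x, x ∈ V ∨ ∃ i, ∃ t ∈ Ioo (0 : unitInterval) 1, φ i t = x

theorem unitInterval_trichotomy (t : unitInterval) :
    t = 0 ∨ t = 1 ∨ t ∈ Ioo (0 : unitInterval) 1 := by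
  rcases eq_or_ne t 0 with h | h
  · exact Or.inl h
  rcases eq_or_ne t 1 with h' | h'
  · exact Or.inr (Or.inl h')
  · exact Or.inr (Or.inr ⟨unitInterval.pos_iff_ne_zero.2 h, unitInterval.lt_one_iff_ne_one.2 h'⟩)

variable {ι : Type*} {V : Set T} {φ : ι → unitInterval → T}

theorem Drawing.mem_or (h : Drawing V φ) (i : ι) (t : unitInterval) :
    φ i t ∈ V ∨ t ∈ Ioo (0 : unitInterval) 1 := by
  rcases unitInterval_trichotomy t with rfl | rfl | ht
  exacts [Or.inl (h.zero_mem i), Or.inl (h.one_mem i), Or.inr ht]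

theorem Drawing.eq_of_eq (h : Drawing V φ) {i j : ι} {s t : unitInterval}
    (hs : s ∈ Ioo (0 : unitInterval) 1) (heq : φ i s = φ j t) : i = j ∧ s = t := by
  rcases h.mem_or j t with ht | ht
  · exact absurd (heq ▸ ht) (h.notMem i s hs)
  · exact h.inj i j s hs t ht heq

/-- The standard test: a set is open when its complement consists of vertices and finitely many
compact pieces of arcs. -/
theorem Drawing.isClosed_union [Finite ι] [T2Space T] (h : Drawing V φ) {V' : Set T}
    (hV : V' ⊆ V) {J : ι → Set unitInterval} (hJ : ∀ i, IsClosed (J i)) :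
    IsClosed (V' ∪ ⋃ i, φ i '' J i) :=
  (h.finite.subset hV).isClosed.union
    (isClosed_iUnion_of_finite fun i => ((hJ i).isCompact.image (h.cont i)).isClosed)

theorem Drawing.isOpen_image [Finite ι] [T2Space T] (h : Drawing V φ) (i : ι)
    {U : Set unitInterval} (hU : IsOpen U) (hU' : U ⊆ Ioo 0 1) : IsOpen (φ i '' U) := by
  classical
  have hcl : IsClosed (V ∪ ⋃ j, φ j '' (if j = i then Uᶜ else univ)) := by
    apply h.isClosed_union Subset.rfl
    intro j
    split_ifs
    exacts [hU.isClosed_compl, isClosed_univ]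
  have : φ i '' U = (V ∪ ⋃ j, φ j '' (if j = i then Uᶜ else univ))ᶜ := by
    ext x
    constructor
    · rintro ⟨t, ht, rfl⟩ (hV | hx)
      · exact h.notMem i t (hU' ht) hV
      · obtain ⟨j, s, hs, hst⟩ := mem_iUnion.1 hx
        obtain ⟨rfl, rfl⟩ := h.eq_of_eq (hU' ht) hst.symm
        rw [if_pos rfl] at hs
        exact hs ht
    · intro hx
      rw [mem_compl_iff, mem_union, not_or] at hx
      rcases h.cover x with hV | ⟨j, t, ht, rfl⟩
      · exact absurd hV hx.1
      · by_cases hji : j = i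
        · subst hji
          refine ⟨t, ?_, rfl⟩
          by_contra htU
          exact hx.2 (mem_iUnion.2 ⟨j, t, by rwa [if_pos rfl], rfl⟩)
        · exact (hx.2 (mem_iUnion.2 ⟨j, t, by rw [if_neg hji]; trivial, rfl⟩)).elim
  rw [this]
  exact hcl.isOpen_compl

/-- The arc `φ i` without its ends. -/
def openArc (φ : ι → unitInterval → T) (i : ι) : Set T := φ i '' Ioo 0 1

theorem Drawing.isOpen_openArc [Finite ι] [T2Space T] (h : Drawing V φ) (i : ι) :
    IsOpen (openArc φ i) := h.isOpen_image i isOpen_Ioo Subset.rfl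

theorem Drawing.isConnected_openArc (h : Drawing V φ) (i : ι) : IsConnected (openArc φ i) := by
  refine ⟨?_, isPreconnected_Ioo.image _ (h.cont i).continuousOn⟩
  exact (nonempty_Ioo.2 zero_lt_one).image _

theorem Drawing.openArc_inj (h : Drawing V φ) {i j : ι}
    (hij : (openArc φ i ∩ openArc φ j).Nonempty) : i = j := by
  obtain ⟨_, ⟨s, hs, rfl⟩, t, ht, hst⟩ := hij
  exact (h.inj i j s hs t ht hst.symm).1

theorem Drawing.openArc_injective (h : Drawing V φ) : Function.Injective (openArc φ) := by
  intro i j hij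
  apply h.openArc_inj
  rw [hij, inter_self]
  exact (h.isConnected_openArc j).nonempty

theorem Drawing.compl_eq (h : Drawing V φ) : Vᶜ = ⋃₀ range (openArc φ) := by
  ext x
  constructor
  · intro hx
    rcases h.cover x with h' | ⟨i, t, ht, rfl⟩
    · exact absurd h' hx
    · exact ⟨openArc φ i, ⟨i, rfl⟩, t, ht, rfl⟩
  · rintro ⟨_, ⟨i, rfl⟩, t, ht, rfl⟩
    exact h.notMem i t ht

theorem Drawing.componentsOf_compl [Finite ι] [T2Space T] (h : Drawing V φ) :
    componentsOf Vᶜ = range (openArc φ) := by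
  rw [h.compl_eq]
  apply componentsOf_sUnion
  · rintro _ ⟨i, rfl⟩; exact h.isOpen_openArc i
  · rintro _ ⟨i, rfl⟩; exact h.isConnected_openArc i
  · rintro _ ⟨i, rfl⟩ _ ⟨j, rfl⟩ hij
    rw [h.openArc_inj hij]

theorem closure_Ioo_unitInterval : closure (Ioo (0 : unitInterval) 1) = univ := by
  rw [closure_Ioo zero_ne_one]
  ext t
  simp [unitInterval.le_one']

theorem Drawing.range_eq_closure [T2Space T] (h : Drawing V φ) (i : ι) :
    range (φ i) = closure (openArc φ i) := by
  apply Subset.antisymm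
  · rw [← image_univ, ← closure_Ioo_unitInterval]
    exact image_closure_subset_closure_image (h.cont i)
  · apply closure_minimal (image_subset_range _ _)
    exact (isCompact_range (h.cont i)).isClosed

theorem Drawing.closure_diff [T2Space T] (h : Drawing V φ) (i : ι) :
    closure (openArc φ i) \ openArc φ i = {φ i 0, φ i 1} := by
  rw [← h.range_eq_closure]
  ext x
  constructor
  · rintro ⟨⟨t, rfl⟩, hx⟩
    rcases unitInterval_trichotomy t with rfl | rfl | ht
    · exact Or.inl rfl
    · exact Or.inr rfl
    · exact absurd ⟨t, ht, rfl⟩ hx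
  · rintro (rfl | rfl)
    · exact ⟨⟨0, rfl⟩, fun ⟨t, ht, heq⟩ => h.notMem i t ht (heq ▸ h.zero_mem i)⟩
    · exact ⟨⟨1, rfl⟩, fun ⟨t, ht, heq⟩ => h.notMem i t ht (heq ▸ h.one_mem i)⟩

/-! ### Subdividing an arc -/

/-- The affine map from `[0, 1]` to the interval between `s` and `t`. -/
noncomputable def seg (s t : unitInterval) (r : unitInterval) : unitInterval :=
  ⟨s + r * (t - s), by
    have := s.2.1; have := s.2.2; have := t.2.1; have := t.2.2; have := r.2.1; have := r.2.2
    constructor <;> nlinarith⟩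

theorem coe_seg (s t r : unitInterval) : (seg s t r : ℝ) = s + r * (t - s) := rfl

theorem continuous_seg (s t : unitInterval) : Continuous (seg s t) := by
  unfold seg
  fun_prop

theorem seg_zero (s t : unitInterval) : seg s t 0 = s := by ext; simp [seg]

theorem seg_one (s t : unitInterval) : seg s t 1 = t := by ext; simp [seg]

theorem seg_injective {s t : unitInterval} (h : s ≠ t) : Function.Injective (seg s t) := by
  intro a b hab
  have h' : (t : ℝ) - s ≠ 0 := sub_ne_zero.2 fun h' => h (Subtype.ext h'.symm)
  have := congrArg Subtype.val hab
  rw [coe_seg, coe_seg, add_right_inj] at this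
  exact Subtype.ext (mul_right_cancel₀ h' this)

theorem seg_image_Ioo {s t : unitInterval} (h : s < t) : seg s t '' Ioo 0 1 = Ioo s t := by
  have h' : (0 : ℝ) < t - s := sub_pos.2 h
  ext r
  constructor
  · rintro ⟨a, ⟨h0, h1⟩, rfl⟩
    have h0 : (0 : ℝ) < a := h0
    have h1 : (a : ℝ) < 1 := h1
    constructor
    · change (s : ℝ) < s + a * (t - s); nlinarith
    · change (s : ℝ) + a * (t - s) < t; nlinarith
  · rintro ⟨h0, h1⟩
    have h0 : (s : ℝ) < r := h0
    have h1 : (r : ℝ) < t := h1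
    refine ⟨⟨(r - s) / (t - s), div_nonneg (by linarith) h'.le, by rw [div_le_one h']; linarith⟩, ⟨?_, ?_⟩, ?_⟩
    · change (0 : ℝ) < (r - s) / (t - s)
      exact div_pos (by linarith) h'
    · change ((r : ℝ) - s) / (t - s) < 1
      rw [div_lt_one h']; linarith
    · ext
      rw [coe_seg]
      field_simp
      ring

theorem seg_mem_Ioo {s t r : unitInterval} (h : s < t) (hr : r ∈ Ioo (0 : unitInterval) 1) :
    seg s t r ∈ Ioo s t := by
  rw [← seg_image_Ioo h]
  exact ⟨r, hr, rfl⟩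

open Classical in
/-- Subdividing the arc `φ i` at `φ i t`. -/
noncomputable def subdivideArc (φ : ι → unitInterval → T) (i : ι) (t : unitInterval) :
    Option ι → unitInterval → T
  | none => φ i ∘ seg t 1
  | some j => if j = i then φ i ∘ seg 0 t else φ j

/-- This makes any chosen point a vertex, so that its degree can be read off from half-edges, and so
that the base point of the circle is available as a vertex. -/
theorem Drawing.insert (h : Drawing V φ) (i : ι) {t : unitInterval}
    (ht : t ∈ Ioo (0 : unitInterval) 1) :
    Drawing (insert (φ i t) V) (subdivideArc φ i t) := by
  have hl : ∀ s ∈ Ioo (0 : unitInterval) 1, seg 0 t s ∈ Ioo (0 : unitInterval) 1 ∧ seg 0 t s < t :=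
    fun s hs => by
      have := seg_mem_Ioo ht.1 hs
      exact ⟨⟨this.1, this.2.trans ht.2⟩, this.2⟩
  have hr : ∀ s ∈ Ioo (0 : unitInterval) 1, seg t 1 s ∈ Ioo (0 : unitInterval) 1 ∧ t < seg t 1 s :=
    fun s hs => by
      have := seg_mem_Ioo ht.2 hs
      exact ⟨⟨ht.1.trans this.1, this.2⟩, this.1⟩
  refine ⟨h.finite.insert _, ?_, ?_, ?_, ?_, ?_, ?_⟩
  · rintro (_ | j)
    · exact (h.cont i).comp (continuous_seg _ _)
    · unfold subdivideArc; dsimp only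
      split_ifs
      · exact (h.cont i).comp (continuous_seg _ _)
      · exact h.cont j
  · rintro (_ | j)
    · simp [subdivideArc, seg_zero]
    · unfold subdivideArc; dsimp only
      split_ifs
      · simpa [seg_zero] using Or.inr (h.zero_mem i)
      · exact Or.inr (h.zero_mem j)
  · rintro (_ | j)
    · simpa [subdivideArc, seg_one] using Or.inr (h.one_mem i)
    · unfold subdivideArc; dsimp only
      split_ifs
      · simp [seg_one]
      · exact Or.inr (h.one_mem j)
  · rintro (_ | j) s hs (h1 | h1)
    · exact (hr s hs).2.ne' (h.eq_of_eq (hr s hs).1 h1).2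
    · exact h.notMem _ _ (hr s hs).1 h1
    · unfold subdivideArc at h1; dsimp only at h1
      split_ifs at h1 with hji
      · exact (hl s hs).2.ne (h.eq_of_eq (hl s hs).1 h1).2
      · exact hji (h.eq_of_eq hs h1).1
    · unfold subdivideArc at h1; dsimp only at h1
      split_ifs at h1 with hji
      · exact h.notMem _ _ (hl s hs).1 h1
      · exact h.notMem _ _ hs h1
  · rintro (_ | j) (_ | k) s hs r hr' heq
    · exact ⟨rfl, seg_injective ht.2.ne (h.eq_of_eq (hr s hs).1 heq).2⟩
    · unfold subdivideArc at heq; dsimp only at heq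
      split_ifs at heq with hk
      · have := (h.eq_of_eq (hr s hs).1 heq).2
        exact absurd ((hl r hr').2.trans (hr s hs).2) (this ▸ lt_irrefl _)
      · exact absurd (h.eq_of_eq (hr s hs).1 heq).1.symm hk
    · unfold subdivideArc at heq; dsimp only at heq
      split_ifs at heq with hk
      · have := (h.eq_of_eq (hl s hs).1 heq).2
        exact absurd ((hl s hs).2.trans (hr r hr').2) (this ▸ lt_irrefl _)
      · exact absurd (h.eq_of_eq hs heq).1 hk
    · unfold subdivideArc at heq; dsimp only at heq
      split_ifs at heq with hj hk hk
      · exact ⟨by rw [hj, hk], seg_injective ht.1.ne (h.eq_of_eq (hl s hs).1 heq).2⟩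
      · exact absurd (h.eq_of_eq (hl s hs).1 heq).1.symm hk
      · exact absurd (h.eq_of_eq hs heq).1 hj
      · exact ⟨congrArg some (h.eq_of_eq hs heq).1, (h.eq_of_eq hs heq).2⟩
  · intro x
    rcases h.cover x with hx | ⟨j, s, hs, rfl⟩
    · exact Or.inl (Or.inr hx)
    · by_cases hj : j = i
      · subst hj
        rcases lt_trichotomy s t with hst | rfl | hst
        · obtain ⟨r, hr1, rfl⟩ : s ∈ seg 0 t '' Ioo 0 1 := by
            rw [seg_image_Ioo ht.1]; exact ⟨hs.1, hst⟩
          exact Or.inr ⟨some j, r, hr1, by simp [subdivideArc]⟩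
        · exact Or.inl (Or.inl rfl)
        · obtain ⟨r, hr1, rfl⟩ : s ∈ seg t 1 '' Ioo 0 1 := by
            rw [seg_image_Ioo ht.2]; exact ⟨hst, hs.2⟩
          exact Or.inr ⟨none, r, hr1, rfl⟩
      · exact Or.inr ⟨some j, s, hs, by simp [subdivideArc, hj]⟩

end Drawings

/-! ## Degrees -/

section Degrees

/-- Two quotients of one space by the same equivalence relation agree. -/
theorem exists_homeomorph_of_isQuotientMap {X A B : Type*} [TopologicalSpace X]
    [TopologicalSpace A] [TopologicalSpace B] {f : X → A} {g : X → B}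
    (hf : Topology.IsQuotientMap f) (hg : Topology.IsQuotientMap g)
    (h : ∀ a b, f a = f b ↔ g a = g b) : ∃ e : A ≃ₜ B, ∀ a, e (f a) = g a := by
  have h1 : ∀ a, g (Function.surjInv hf.surjective (f a)) = g a :=
    fun a => (h _ _).1 (Function.surjInv_eq hf.surjective _)
  have h2 : ∀ a, f (Function.surjInv hg.surjective (g a)) = f a :=
    fun a => (h _ _).2 (Function.surjInv_eq hg.surjective _)
  refine ⟨⟨⟨fun x => g (Function.surjInv hf.surjective x),
    fun y => f (Function.surjInv hg.surjective y), ?_, ?_⟩, ?_, ?_⟩, h1⟩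
  · intro x
    obtain ⟨a, rfl⟩ := hf.surjective x
    simp only [h1, h2]
  · intro y
    obtain ⟨a, rfl⟩ := hg.surjective y
    simp only [h1, h2]
  · rw [hf.continuous_iff]
    exact hg.continuous.congr fun a => (h1 a).symm
  · rw [hg.continuous_iff]
    exact hf.continuous.congr fun a => (h2 a).symm

/-- A closed map stays closed when restricted over any subset of its target, whereas a general
quotient map need not stay a quotient map. This allows the half-open star. -/
theorem isQuotientMap_restrictPreimage {X Y : Type*} [TopologicalSpace X] [CompactSpace X]
    [TopologicalSpace Y] [T2Space Y] {f : X → Y} (hf : Continuous f) {S : Set Y}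
    (hS : S ⊆ range f) : Topology.IsQuotientMap (S.restrictPreimage f) := by
  refine IsClosedMap.isQuotientMap (hf.isClosedMap.restrictPreimage S) hf.restrictPreimage ?_
  rintro ⟨y, hy⟩
  obtain ⟨x, rfl⟩ := hS hy
  exact ⟨⟨x, hy⟩, rfl⟩

/-- The rays of the star. -/
noncomputable def starRay (k : ℕ) (a : Fin k × unitInterval) : Fin k → ℝ :=
  Pi.single a.1 (a.2 : ℝ)

theorem continuous_starRay (k : ℕ) : Continuous (starRay k) := by
  rw [continuous_prod_of_discrete_left]
  intro i
  exact (continuous_single i).comp continuous_subtype_val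

theorem starRay_mem_iff {k : ℕ} (a : Fin k × unitInterval) : starRay k a ∈ Star k ↔ a.2 < 1 := by
  obtain ⟨i, s⟩ := a
  constructor
  · intro h
    have := (h.1 i).2
    simpa [starRay] using this
  · intro h
    have h : (s : ℝ) < 1 := h
    refine ⟨fun j => ?_, fun j j' hj hj' => ?_⟩
    · by_cases hj : j = i
      · subst hj; simpa [starRay] using ⟨s.2.1, h⟩
      · simp [starRay, hj]
    · have : ∀ j, (starRay k (i, s)) j ≠ 0 → j = i := by
        intro j hj
        by_contra hne
        exact hj (by simp [starRay, hne])
      rw [this j hj, this j' hj']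

theorem starRay_eq_iff {k : ℕ} (a b : Fin k × unitInterval) :
    starRay k a = starRay k b ↔ (a.2 = 0 ∧ b.2 = 0) ∨ a = b := by
  obtain ⟨i, s⟩ := a
  obtain ⟨j, t⟩ := b
  constructor
  · intro h
    by_cases hij : i = j
    · subst hij
      right
      have := congrFun h i
      simp only [starRay, Pi.single_eq_same] at this
      rw [Subtype.ext this]
    · left
      have h1 := congrFun h i
      have h2 := congrFun h j
      simp only [starRay, Pi.single_eq_same, Pi.single_eq_of_ne hij,
        Pi.single_eq_of_ne (Ne.symm hij)] at h1 h2
      exact ⟨Subtype.ext h1, Subtype.ext h2.symm⟩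
  · rintro (⟨h1, h2⟩ | h)
    · simp only at h1 h2
      simp [starRay, h1, h2]
    · rw [h]

theorem star_subset_range {k : ℕ} (hk : 0 < k) : Star k ⊆ range (starRay k) := by
  intro v hv
  by_cases h : ∃ i, v i ≠ 0
  · obtain ⟨i, hi⟩ := h
    refine ⟨(i, ⟨v i, (hv.1 i).1, (hv.1 i).2.le⟩), ?_⟩
    funext j
    by_cases hj : j = i
    · subst hj; simp [starRay]
    · have : v j = 0 := by
        by_contra h0
        exact hj (hv.2 j i h0 hi)
      simp [starRay, hj, this]
  · push Not at h
    refine ⟨(⟨0, hk⟩, 0), ?_⟩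
    funext j
    simp [starRay, h j]

variable {T : Type*} [TopologicalSpace T]

/-- The union of the rays without their far ends and the model star are both quotients of the same
space of pairs (ray, parameter below 1), by the identification of the zeros. -/
theorem hasDegree_of_rays [T2Space T] {κ : Type*} [Finite κ] [Nonempty κ] {x : T}
    (ψ : κ → unitInterval → T) (hc : ∀ i, Continuous (ψ i)) (h0 : ∀ i, ψ i 0 = x)
    (hinj : ∀ i j s t, ψ i s = ψ j t → (s = 0 ∧ t = 0) ∨ (i = j ∧ s = t))
    (ho : IsOpen (⋃ i, ψ i '' Iio 1)) : HasDegree x (Nat.card κ) := by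
  let e : Fin (Nat.card κ) ≃ κ := (Finite.equivFin κ).symm
  set k := Nat.card κ
  have hk : 0 < k := Nat.card_pos
  let Ψ : Fin k × unitInterval → T := fun a => ψ (e a.1) a.2
  have hΨ : Continuous Ψ := by
    rw [continuous_prod_of_discrete_left]
    exact fun i => hc (e i)
  have hΨeq : ∀ a b, Ψ a = Ψ b ↔ (a.2 = 0 ∧ b.2 = 0) ∨ a = b := by
    rintro ⟨i, s⟩ ⟨j, t⟩
    constructor
    · intro h
      refine (hinj _ _ _ _ h).imp_right fun h' => ?_
      rw [Prod.mk.injEq]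
      exact ⟨e.injective h'.1, h'.2⟩
    · rintro (⟨h1, h2⟩ | h)
      · simp only at h1 h2
        simp only [Ψ, h1, h2, h0]
      · rw [h]
  set U : Set T := ⋃ i, ψ i '' Iio 1 with hU
  have hUmem : ∀ a, Ψ a ∈ U ↔ a.2 < 1 := by
    rintro ⟨i, s⟩
    constructor
    · intro h
      obtain ⟨j, t, ht, hts⟩ := mem_iUnion.1 h
      rcases hinj _ _ _ _ hts with ⟨-, h2⟩ | ⟨-, h2⟩
      · rw [h2]; exact zero_lt_one
      · exact h2 ▸ ht
    · intro h
      exact mem_iUnion.2 ⟨e i, s, h, rfl⟩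
  have hUr : U ⊆ range Ψ := by
    intro y hy
    obtain ⟨j, t, ht, rfl⟩ := mem_iUnion.1 hy
    exact ⟨(e.symm j, t), by simp [Ψ]⟩
  have q1 := isQuotientMap_restrictPreimage hΨ hUr
  have q2 := isQuotientMap_restrictPreimage (continuous_starRay k) (star_subset_range hk)
  have hset : Ψ ⁻¹' U = starRay k ⁻¹' Star k := by
    ext a
    rw [mem_preimage, mem_preimage, hUmem, starRay_mem_iff]
  have q3 := q2.comp (Homeomorph.setCongr hset).isQuotientMap
  obtain ⟨E, hE⟩ := exists_homeomorph_of_isQuotientMap q1 q3 (by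
    rintro ⟨a, ha⟩ ⟨b, hb⟩
    rw [Subtype.ext_iff, Subtype.ext_iff]
    exact (hΨeq a b).trans (starRay_eq_iff a b).symm)
  let a₀ : Fin k × unitInterval := (⟨0, hk⟩, 0)
  have ha₀ : Ψ a₀ = x := h0 _
  have ha₀U : Ψ a₀ ∈ U := (hUmem a₀).2 zero_lt_one
  refine ⟨U, ha₀ ▸ ha₀U, E, ho, ?_⟩
  have := hE ⟨a₀, ha₀U⟩
  have h2 : (U.restrictPreimage Ψ ⟨a₀, ha₀U⟩) = ⟨x, ha₀ ▸ ha₀U⟩ := Subtype.ext ha₀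
  rw [h2] at this
  rw [this]
  change starRay k a₀ = 0
  simp [starRay, a₀]

/-! ### Uniqueness of the degree -/

theorem starRay_mem_star {k : ℕ} (i : Fin k) {s : ℝ} (hs : s ∈ Ico (0 : ℝ) 1) :
    (Pi.single i s : Fin k → ℝ) ∈ Star k :=
  (starRay_mem_iff (i, ⟨s, hs.1, hs.2.le⟩)).2 hs.2

/-- A punctured small ray of the first star is connected and avoids the centre, so it runs inside
one ray of the second. Every ray of the second star is met in this way arbitrarily close to `x`.
Choosing for each of the `l` rays one of the `k` rays that runs into it is therefore injective. -/
theorem HasDegree.le {x : T} {k l : ℕ} (hk : HasDegree x k) (hl : HasDegree x l) : l ≤ k := by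
  obtain ⟨U, hxU, h, hU, h0⟩ := hk
  obtain ⟨U', hxU', h', hU', h0'⟩ := hl
  -- a small star inside both neighbourhoods
  obtain ⟨r, hr, hr1, hball⟩ : ∃ r : ℝ, 0 < r ∧ r ≤ 1 ∧
      ∀ v : Star k, (∀ i, v.1 i < r) → (h.symm v : T) ∈ U' := by
    have hopen : IsOpen {v : Star k | (h.symm v : T) ∈ U'} :=
      hU'.preimage (continuous_subtype_val.comp h.symm.continuous)
    have hmem : h ⟨x, hxU⟩ ∈ {v : Star k | (h.symm v : T) ∈ U'} := by simpa using hxU'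
    obtain ⟨r, hr, hball⟩ := Metric.isOpen_iff.1 hopen _ hmem
    refine ⟨min r 1, lt_min hr one_pos, min_le_right _ _, fun v hv => hball ?_⟩
    rw [Metric.mem_ball, Subtype.dist_eq, h0, dist_zero_right, pi_norm_lt_iff hr]
    intro i
    rw [Real.norm_of_nonneg (v.2.1 i).1]
    exact (hv i).trans_le (min_le_left _ _)
  have hx0 : ∀ v : Star k, (h.symm v : T) = x → v.1 = 0 := by
    intro v hv
    have : h.symm v = ⟨x, hxU⟩ := Subtype.ext hv
    rw [← h0, ← this, h.apply_symm_apply]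
  have hx0' : ∀ (y : T) (hy : y ∈ U'), (h' ⟨y, hy⟩ : Fin l → ℝ) = 0 → y = x := by
    intro y hy h1
    have : h' ⟨y, hy⟩ = h' ⟨x, hxU'⟩ := Subtype.ext (h1.trans h0'.symm)
    exact congrArg Subtype.val (h'.injective this)
  -- the image of each small ray
  let p : Fin k → Ioo (0 : ℝ) r → Star k := fun i s =>
    ⟨Pi.single i s.1, starRay_mem_star i ⟨s.2.1.le, s.2.2.trans_le hr1⟩⟩
  have hp : ∀ i s, (h.symm (p i s) : T) ∈ U' := by
    intro i s
    apply hball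
    intro j
    by_cases hj : j = i
    · subst hj; simpa [p] using s.2.2
    · simpa [p, hj] using hr
  let g : Fin k → Ioo (0 : ℝ) r → Fin l → ℝ := fun i s => (h' ⟨h.symm (p i s), hp i s⟩).1
  have hg : ∀ i, Continuous (g i) := by
    intro i
    apply continuous_subtype_val.comp
    apply h'.continuous.comp
    apply Continuous.subtype_mk
    apply continuous_subtype_val.comp
    apply h.symm.continuous.comp
    apply Continuous.subtype_mk
    exact (continuous_single i).comp continuous_subtype_val
  have hgS : ∀ i s, g i s ∈ Star l := fun i s => (h' _).2
  have hg0 : ∀ i s, g i s ≠ 0 := by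
    intro i s hgs
    have := hx0 _ (hx0' _ _ hgs)
    have := congrFun this i
    simp only [p, Pi.single_eq_same] at this
    exact s.2.1.ne' this
  -- Off the centre exactly one coordinate is non-zero, so non-vanishing of the `j`-th coordinate is
  -- a clopen condition on the connected punctured ray.
  have hconst : ∀ i j s t, g i s j ≠ 0 → g i t j ≠ 0 := by
    intro i j s t hs
    have : PreconnectedSpace (Ioo (0 : ℝ) r) :=
      isPreconnected_iff_preconnectedSpace.1 isPreconnected_Ioo
    have hopen : ∀ m, IsOpen {s | g i s m ≠ 0} := fun m =>
      isOpen_ne.preimage ((continuous_apply m).comp (hg i))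
    have hcompl : {s | g i s j ≠ 0}ᶜ = ⋃ m ∈ {m | m ≠ j}, {s | g i s m ≠ 0} := by
      ext u
      simp only [mem_compl_iff, mem_ofPred_eq, not_not, mem_iUnion, exists_prop]
      constructor
      · intro hu
        obtain ⟨m, hm⟩ := Function.ne_iff.1 (hg0 i u)
        exact ⟨m, fun hmj => hm (hmj ▸ hu), hm⟩
      · rintro ⟨m, hmj, hm⟩
        by_contra hu
        exact hmj ((hgS i u).2 m j hm hu)
    have hclopen : IsClopen {s | g i s j ≠ 0} := by
      refine ⟨⟨?_⟩, hopen j⟩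
      rw [hcompl]
      exact isOpen_biUnion fun m _ => hopen m
    rcases isClopen_iff.1 hclopen with h1 | h1
    · exact absurd hs (h1 ▸ notMem_empty s : s ∉ {s | g i s j ≠ 0})
    · exact (h1 ▸ mem_univ t : t ∈ {s | g i s j ≠ 0})
  have hsurj : ∀ j : Fin l, ∃ i, ∃ s, g i s j ≠ 0 := by
    intro j
    -- points of the ray `j` close to `x`
    let y : Ico (0 : ℝ) 1 → T := fun s => h'.symm ⟨Pi.single j s.1, starRay_mem_star j s.2⟩
    have hy : Continuous y := by
      apply continuous_subtype_val.comp
      apply h'.symm.continuous.comp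
      apply Continuous.subtype_mk
      exact (continuous_single j).comp continuous_subtype_val
    have hy0 : y ⟨0, le_rfl, one_pos⟩ = x := by
      have : (⟨Pi.single j 0, starRay_mem_star j ⟨le_rfl, one_pos⟩⟩ : Star l) = h' ⟨x, hxU'⟩ :=
        Subtype.ext (by rw [h0']; simp)
      simp only [y, this, Homeomorph.symm_apply_apply]
    have hW : IsOpen {z : T | ∃ hz : z ∈ U, ∀ i, (h ⟨z, hz⟩).1 i < r} := by
      have : {z : T | ∃ hz : z ∈ U, ∀ i, (h ⟨z, hz⟩).1 i < r} =
          Subtype.val '' {z : U | ∀ i, (h z).1 i < r} := by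
        ext z
        constructor
        · rintro ⟨hz, h1⟩; exact ⟨⟨z, hz⟩, h1, rfl⟩
        · rintro ⟨⟨z, hz⟩, h1, rfl⟩; exact ⟨hz, h1⟩
      rw [this]
      apply hU.isOpenMap_subtype_val
      have : {z : U | ∀ i, (h z).1 i < r} = ⋂ i, {z : U | (h z).1 i < r} := by ext; simp
      rw [this]
      exact isOpen_iInter_of_finite fun i => isOpen_lt
        ((continuous_apply i).comp (continuous_subtype_val.comp h.continuous)) continuous_const
    have hmem : (⟨0, le_rfl, one_pos⟩ : Ico (0 : ℝ) 1) ∈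
        y ⁻¹' {z : T | ∃ hz : z ∈ U, ∀ i, (h ⟨z, hz⟩).1 i < r} := by
      rw [mem_preimage, hy0]
      exact ⟨hxU, fun i => by rw [h0]; exact hr⟩
    obtain ⟨δ, hδ, hball⟩ := Metric.isOpen_iff.1 (hW.preimage hy) _ hmem
    -- Half the radius stays strictly inside the ball; the cap keeps the parameter below 1.
    have hs1 : min (δ / 2) (1 / 2) ∈ Ico (0 : ℝ) 1 :=
      ⟨by positivity, (min_le_right _ _).trans_lt (by norm_num)⟩
    have hs0 : (0 : ℝ) < min (δ / 2) (1 / 2) := by positivity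
    obtain ⟨hzU, hz⟩ := hball (show (⟨_, hs1⟩ : Ico (0 : ℝ) 1) ∈ _ by
      rw [Metric.mem_ball, Subtype.dist_eq, Real.dist_eq, sub_zero, abs_of_pos hs0]
      exact (min_le_left _ _).trans_lt (by linarith))
    set z := y ⟨_, hs1⟩ with hzdef
    have hzU' : z ∈ U' := Subtype.coe_prop _
    have hhz : h' ⟨z, hzU'⟩ = ⟨Pi.single j (min (δ / 2) (1 / 2)), starRay_mem_star j hs1⟩ :=
      h'.apply_symm_apply _
    have hne : (h ⟨z, hzU⟩).1 ≠ 0 := by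
      intro h1
      have h2 : h ⟨z, hzU⟩ = h ⟨x, hxU⟩ := Subtype.ext (h1.trans h0.symm)
      have h3 : z = x := congrArg Subtype.val (h.injective h2)
      have h4 : h' ⟨z, hzU'⟩ = h' ⟨x, hxU'⟩ := by congr 1; exact Subtype.ext h3
      rw [hhz] at h4
      have h5 := congrFun ((congrArg Subtype.val h4).trans h0') j
      simp only [Pi.single_eq_same, Pi.zero_apply] at h5
      exact hs0.ne' h5
    obtain ⟨i, hi⟩ := Function.ne_iff.1 hne
    have hpos : 0 < (h ⟨z, hzU⟩).1 i := lt_of_le_of_ne ((h ⟨z, hzU⟩).2.1 i).1 (Ne.symm hi)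
    refine ⟨i, ⟨_, hpos, hz i⟩, ?_⟩
    have hpz : p i ⟨_, hpos, hz i⟩ = h ⟨z, hzU⟩ := by
      apply Subtype.ext
      funext m
      by_cases hm : m = i
      · subst hm; simp [p]
      · have : (h ⟨z, hzU⟩).1 m = 0 := by
          by_contra h1
          exact hm ((h ⟨z, hzU⟩).2.2 m i h1 hi)
        simp [p, hm, this]
    have hgz : g i ⟨_, hpos, hz i⟩ = (h' ⟨z, hzU'⟩).1 := by
      simp only [g, hpz, Homeomorph.symm_apply_apply]
    rw [hgz, hhz]
    simpa using hs0.ne'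
  choose σ s hσ using hsurj
  have hinj : Function.Injective σ := by
    intro j j' hjj
    have h1 := hσ j
    have h2 := hσ j'
    rw [← hjj] at h2
    exact (hgS (σ j) (s j)).2 j j' h1 (hconst _ _ _ _ h2)
  simpa using Fintype.card_le_of_injective σ hinj

theorem HasDegree.unique {x : T} {k l : ℕ} (hk : HasDegree x k) (hl : HasDegree x l) : k = l :=
  le_antisymm (hl.le hk) (hk.le hl)

end Degrees

/-! ## Half-edges of a drawing -/

section HalfEdges

variable {T : Type*} [TopologicalSpace T] {ι : Type*} {V : Set T} {φ : ι → unitInterval → T}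

/-- The end of an arc: its start for `false`, its finish for `true`. -/
def endPt (φ : ι → unitInterval → T) (h : ι × Bool) : T := φ h.1 (if h.2 then 1 else 0)

/-- The half-edges of a drawing at the point `v`. -/
def halfEdges (φ : ι → unitInterval → T) (v : T) : Set (ι × Bool) := {h | endPt φ h = v}

/-- A parametrization of the first or the last third of `[0, 1]`, starting at the end. -/
noncomputable def nearEnd (b : Bool) : unitInterval → unitInterval :=
  if b then seg 1 ⟨2 / 3, by norm_num, by norm_num⟩ else seg 0 ⟨1 / 3, by norm_num, by norm_num⟩

theorem continuous_nearEnd (b : Bool) : Continuous (nearEnd b) := by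
  unfold nearEnd
  split_ifs <;> exact continuous_seg _ _

theorem nearEnd_zero (b : Bool) : nearEnd b 0 = if b then 1 else 0 := by
  unfold nearEnd
  split_ifs <;> exact seg_zero _ _

theorem coe_nearEnd_true (s : unitInterval) : (nearEnd true s : ℝ) = 1 - s / 3 := by
  simp only [nearEnd, if_true, coe_seg, Icc.coe_one]
  ring

theorem coe_nearEnd_false (s : unitInterval) : (nearEnd false s : ℝ) = s / 3 := by
  simp only [nearEnd, Bool.false_eq_true, if_false, coe_seg, Icc.coe_zero]
  ring

theorem nearEnd_mem_Ioo (b : Bool) {s : unitInterval} (hs : s ≠ 0) :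
    nearEnd b s ∈ Ioo (0 : unitInterval) 1 := by
  have h0 : (0 : ℝ) < s := unitInterval.pos_iff_ne_zero.2 hs
  have h1 : (s : ℝ) ≤ 1 := s.2.2
  cases b
  · constructor
    · change (0 : ℝ) < (nearEnd false s : ℝ); rw [coe_nearEnd_false]; linarith
    · change (nearEnd false s : ℝ) < 1; rw [coe_nearEnd_false]; linarith
  · constructor
    · change (0 : ℝ) < (nearEnd true s : ℝ); rw [coe_nearEnd_true]; linarith
    · change (nearEnd true s : ℝ) < 1; rw [coe_nearEnd_true]; linarith

theorem nearEnd_inj {b c : Bool} {s t : unitInterval} (h : nearEnd b s = nearEnd c t) :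
    b = c ∧ s = t := by
  have h' := congrArg Subtype.val h
  have := s.2.2; have := t.2.2
  cases b <;> cases c
  · rw [coe_nearEnd_false, coe_nearEnd_false] at h'
    exact ⟨rfl, Subtype.ext (by linarith)⟩
  · rw [coe_nearEnd_false, coe_nearEnd_true] at h'
    linarith
  · rw [coe_nearEnd_true, coe_nearEnd_false] at h'
    linarith
  · rw [coe_nearEnd_true, coe_nearEnd_true] at h'
    exact ⟨rfl, Subtype.ext (by linarith)⟩

/-- A vertex that has a half-edge has the degree given by the number of its half-edges. -/
theorem Drawing.hasDegree [Finite ι] [T2Space T] (h : Drawing V φ) {v : T} (hv : v ∈ V)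
    (hne : (halfEdges φ v).Nonempty) : HasDegree v (halfEdges φ v).ncard := by
  have : Nonempty (halfEdges φ v) := hne.to_subtype
  let ψ : halfEdges φ v → unitInterval → T := fun e => φ e.1.1 ∘ nearEnd e.1.2
  have hψ0 : ∀ e, ψ e 0 = v := by
    intro e
    simp only [ψ, Function.comp_apply, nearEnd_zero]
    exact e.2
  refine hasDegree_of_rays ψ (fun e => (h.cont _).comp (continuous_nearEnd _)) hψ0 ?_ ?_
  · intro e e' s t heq
    by_cases hs : s = 0
    · subst hs
      rw [hψ0] at heq
      left
      refine ⟨rfl, ?_⟩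
      by_contra ht
      exact h.notMem _ _ (nearEnd_mem_Ioo _ ht) (heq ▸ hv : ψ e' t ∈ V)
    · right
      obtain ⟨h1, h2⟩ := h.eq_of_eq (nearEnd_mem_Ioo _ hs) heq
      obtain ⟨h3, h4⟩ := nearEnd_inj h2
      exact ⟨Subtype.ext (Prod.ext h1 h3), h4⟩
  -- What is left of an arc after removing the outer third at each of its ends that lies at `v`.
  -- With the other vertices this is the closed complement of the neighbourhood of `v`.
  · let J : ι → Set unitInterval := fun i =>
      {t | (φ i 0 = v → (1 / 3 : ℝ) ≤ t) ∧ (φ i 1 = v → (t : ℝ) ≤ 2 / 3)}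
    have hJ : ∀ i, IsClosed (J i) := by
      intro i
      have h1 : IsClosed {t : unitInterval | φ i 0 = v → (1 / 3 : ℝ) ≤ t} := by
        by_cases hi : φ i 0 = v
        · simpa only [hi, forall_const] using isClosed_le continuous_const continuous_subtype_val
        · simp [hi]
      have h2 : IsClosed {t : unitInterval | φ i 1 = v → (t : ℝ) ≤ 2 / 3} := by
        by_cases hi : φ i 1 = v
        · simpa only [hi, forall_const] using isClosed_le continuous_subtype_val continuous_const
        · simp [hi]
      exact h1.inter h2
    have hcl := h.isClosed_union (V' := V \ {v}) sdiff_subset hJ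
    have heq : (⋃ e, ψ e '' Iio 1) = ((V \ {v}) ∪ ⋃ i, φ i '' J i)ᶜ := by
      ext x
      constructor
      · intro hx
        obtain ⟨e, s, hs, rfl⟩ := mem_iUnion.1 hx
        have hs : (s : ℝ) < 1 := hs
        rintro (hV | hx)
        · by_cases hs0 : s = 0
          · subst hs0; exact hV.2 (hψ0 e)
          · exact h.notMem _ _ (nearEnd_mem_Ioo _ hs0) hV.1
        · obtain ⟨i, t, ht, hts⟩ := mem_iUnion.1 hx
          by_cases hs0 : s = 0
          · subst hs0
            rw [hψ0] at hts
            rcases unitInterval_trichotomy t with rfl | rfl | ht'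
            · have := ht.1 hts; norm_num at this
            · have := ht.2 hts; norm_num at this
            · exact h.notMem i t ht' (hts ▸ hv)
          · obtain ⟨h1, h2⟩ := h.eq_of_eq (nearEnd_mem_Ioo _ hs0) hts.symm
            obtain ⟨⟨j, b⟩, hjb⟩ := e
            simp only at h1 h2
            subst h1 h2
            cases b
            · have := ht.1 hjb
              rw [coe_nearEnd_false] at this
              linarith
            · have := ht.2 hjb
              rw [coe_nearEnd_true] at this
              linarith
      · intro hx
        rw [mem_compl_iff, mem_union, not_or] at hx
        rcases h.cover x with hV | ⟨i, t, ht, rfl⟩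
        · have : x = v := by
            by_contra hxv
            exact hx.1 ⟨hV, hxv⟩
          obtain ⟨e⟩ := ‹Nonempty (halfEdges φ v)›
          exact mem_iUnion.2 ⟨e, 0, mem_Iio.2 zero_lt_one, by rw [hψ0, this]⟩
        · have htJ : t ∉ J i := fun htJ => hx.2 (mem_iUnion.2 ⟨i, t, htJ, rfl⟩)
          have ht0 : (0 : ℝ) < t := ht.1
          have ht1 : (t : ℝ) < 1 := ht.2
          rw [mem_ofPred_eq, not_and_or, Classical.not_imp, Classical.not_imp, not_le,
            not_le] at htJ
          rcases htJ with ⟨hi, hlt⟩ | ⟨hi, hlt⟩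
          · refine mem_iUnion.2 ⟨⟨(i, false), hi⟩, ⟨3 * t, by linarith, by linarith⟩, ?_, ?_⟩
            · change (3 * t : ℝ) < 1; linarith
            · change φ i (nearEnd false _) = φ i t
              congr 1
              apply Subtype.ext
              rw [coe_nearEnd_false]
              ring
          · refine mem_iUnion.2 ⟨⟨(i, true), hi⟩, ⟨3 * (1 - t), by linarith, by linarith⟩, ?_, ?_⟩
            · change (3 * (1 - t) : ℝ) < 1; linarith
            · change φ i (nearEnd true _) = φ i t
              congr 1
              apply Subtype.ext
              rw [coe_nearEnd_true]
              ring
    rw [heq]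
    exact hcl.isOpen_compl

/-- A vertex that ends no arc would form a clopen set by itself. -/
theorem Drawing.halfEdges_nonempty [Finite ι] [T2Space T] [ConnectedSpace T] [Nontrivial T]
    (h : Drawing V φ) {v : T} (hv : v ∈ V) : (halfEdges φ v).Nonempty := by
  by_contra hne
  rw [not_nonempty_iff_eq_empty, eq_empty_iff_forall_notMem] at hne
  have hcl := h.isClosed_union (V' := V \ {v}) sdiff_subset (J := fun _ => univ)
    fun _ => isClosed_univ
  have heq : ({v} : Set T) = ((V \ {v}) ∪ ⋃ i, φ i '' univ)ᶜ := by
    ext x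
    constructor
    · rintro rfl (hx | hx)
      · exact hx.2 rfl
      · obtain ⟨i, t, -, ht⟩ := mem_iUnion.1 hx
        rcases unitInterval_trichotomy t with rfl | rfl | ht'
        · exact hne (i, false) ht
        · exact hne (i, true) ht
        · exact h.notMem i t ht' (ht ▸ hv)
    · intro hx
      rw [mem_compl_iff, mem_union, not_or] at hx
      rcases h.cover x with hV | ⟨i, t, -, rfl⟩
      · by_contra hxv
        exact hx.1 ⟨hV, hxv⟩
      · exact (hx.2 (mem_iUnion.2 ⟨i, t, trivial, rfl⟩)).elim
  have hclopen : IsClopen ({v} : Set T) := ⟨isClosed_singleton, heq ▸ hcl.isOpen_compl⟩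
  rcases isClopen_iff.1 hclopen with h1 | h1
  · exact singleton_ne_empty v h1
  · obtain ⟨w, hw⟩ := exists_ne v
    exact hw (h1.symm.subset (mem_univ w))

theorem Drawing.isSingular_iff [Finite ι] [T2Space T] [ConnectedSpace T] [Nontrivial T]
    (h : Drawing V φ) {v : T} (hv : v ∈ V) : IsSingular v ↔ (halfEdges φ v).ncard ≠ 2 := by
  have hne := h.halfEdges_nonempty hv
  have hd := h.hasDegree hv hne
  have hpos : 0 < (halfEdges φ v).ncard := (ncard_pos (toFinite _)).2 hne
  constructor
  · rintro ⟨k, hk, hdk⟩ heq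
    rw [hdk.unique hd] at hk
    omega
  · intro h2
    exact ⟨_, by omega, hd⟩

/-- Once the point is made a vertex, its half-edges are the finish of the first part of the arc and
the start of the second. -/
theorem Drawing.not_isSingular_of_mem_arc [Finite ι] [T2Space T] [ConnectedSpace T]
    [Nontrivial T] (h : Drawing V φ) (i : ι) {t : unitInterval}
    (ht : t ∈ Ioo (0 : unitInterval) 1) : ¬ IsSingular (φ i t) := by
  rw [(h.insert i ht).isSingular_iff (mem_insert _ _), not_not, ncard_eq_two]
  refine ⟨(some i, true), (none, false), by simp, ?_⟩
  have hne : ∀ {x}, x ∈ V → x ≠ φ i t := fun hx h' => h.notMem i t ht (h' ▸ hx)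
  ext ⟨o, b⟩
  simp only [halfEdges, endPt, mem_ofPred_eq, mem_insert_iff, mem_singleton_iff, Prod.mk.injEq]
  rcases o with _ | j
  · cases b
    · simp [subdivideArc, seg_zero]
    · simpa [subdivideArc, seg_one] using hne (h.one_mem i)
  · by_cases hj : j = i
    · subst hj
      cases b
      · simpa [subdivideArc, seg_zero] using hne (h.zero_mem j)
      · simp [subdivideArc, seg_one]
    · cases b
      · simpa [subdivideArc, hj] using hne (h.zero_mem j)
      · simpa [subdivideArc, hj] using hne (h.one_mem j)

end HalfEdges

/-! ## Suppressing vertices of degree two -/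

section Suppress

variable {T : Type*} [TopologicalSpace T] {ι : Type*} {V : Set T} {φ : ι → unitInterval → T}

theorem symm_mem_Ioo {t : unitInterval} (ht : t ∈ Ioo (0 : unitInterval) 1) :
    unitInterval.symm t ∈ Ioo (0 : unitInterval) 1 := by
  have h0 : (0 : ℝ) < t := ht.1
  have h1 : (t : ℝ) < 1 := ht.2
  constructor
  · change (0 : ℝ) < 1 - t; linarith
  · change (1 - t : ℝ) < 1; linarith

/-- Reversing some arcs. -/
def flipArcs (φ : ι → unitInterval → T) (b : ι → Bool) (i : ι) : unitInterval → T :=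
  if b i then φ i ∘ unitInterval.symm else φ i

theorem Drawing.flip (h : Drawing V φ) (b : ι → Bool) : Drawing V (flipArcs φ b) := by
  have key : ∀ i t, t ∈ Ioo (0 : unitInterval) 1 → ∃ t' ∈ Ioo (0 : unitInterval) 1,
      flipArcs φ b i t = φ i t' ∧ t' = if b i then unitInterval.symm t else t := by
    intro i t ht
    unfold flipArcs
    cases b i
    · exact ⟨t, ht, by simp⟩
    · exact ⟨_, symm_mem_Ioo ht, by simp⟩
  refine ⟨h.finite, ?_, ?_, ?_, ?_, ?_, ?_⟩
  · intro i
    unfold flipArcs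
    split_ifs
    · exact (h.cont i).comp unitInterval.continuous_symm
    · exact h.cont i
  · intro i
    unfold flipArcs
    split_ifs
    · simpa using h.one_mem i
    · exact h.zero_mem i
  · intro i
    unfold flipArcs
    split_ifs
    · simpa using h.zero_mem i
    · exact h.one_mem i
  · intro i t ht
    obtain ⟨t', ht', heq, -⟩ := key i t ht
    rw [heq]
    exact h.notMem i t' ht'
  · intro i j s hs t ht heq
    obtain ⟨s', hs', h1, h1'⟩ := key i s hs
    obtain ⟨t', ht', h2, h2'⟩ := key j t ht
    rw [h1, h2] at heq
    obtain ⟨rfl, rfl⟩ := h.inj i j s' hs' t' ht' heq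
    refine ⟨rfl, ?_⟩
    rw [h1'] at h2'
    split_ifs at h2'
    · simpa using h2'
    · exact h2'
  · intro x
    rcases h.cover x with hx | ⟨i, t, ht, rfl⟩
    · exact Or.inl hx
    · right
      by_cases hb : b i
      · exact ⟨i, unitInterval.symm t, symm_mem_Ioo ht, by simp [flipArcs, hb]⟩
      · exact ⟨i, t, ht, by simp [flipArcs, hb]⟩

theorem endPt_flipArcs {T ι : Type*} {φ : ι → unitInterval → T} (b : ι → Bool) (i : ι) (c : Bool) :
    endPt (flipArcs φ b) (i, c) = endPt φ (i, xor c (b i)) := by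
  unfold endPt flipArcs
  cases b i <;> cases c <;> simp

/-- The arc that runs through `γ` and then through `γ'`. -/
noncomputable def joinArc (γ γ' : unitInterval → T) (s : unitInterval) : T :=
  if h : (s : ℝ) ≤ 1 / 2 then γ ⟨2 * s, by have := s.2.1; linarith, by linarith⟩
  else γ' ⟨2 * s - 1, by linarith, by have := s.2.2; linarith⟩

theorem continuous_joinArc {γ γ' : unitInterval → T} (hγ : Continuous γ) (hγ' : Continuous γ')
    (h : γ 1 = γ' 0) : Continuous (joinArc γ γ') := by
  let p : Path (γ 0) (γ 1) := ⟨⟨γ, hγ⟩, rfl, rfl⟩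
  let p' : Path (γ 1) (γ' 1) := ⟨⟨γ', hγ'⟩, h.symm, rfl⟩
  have : joinArc γ γ' = p.trans p' := by
    funext s
    rw [Path.trans_apply]
    rfl
  rw [this]
  exact (p.trans p').continuous

theorem joinArc_cases {T : Type*} {γ γ' : unitInterval → T} {s : unitInterval}
    (hs : s ∈ Ioo (0 : unitInterval) 1) :
    (∃ u ∈ Ioo (0 : unitInterval) 1, joinArc γ γ' s = γ u ∧ (u : ℝ) = 2 * s) ∨
      (joinArc γ γ' s = γ 1 ∧ (s : ℝ) = 1 / 2) ∨
      (∃ u ∈ Ioo (0 : unitInterval) 1, joinArc γ γ' s = γ' u ∧ (u : ℝ) = 2 * s - 1) := by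
  have h0 : (0 : ℝ) < s := hs.1
  have h1 : (s : ℝ) < 1 := hs.2
  rcases lt_trichotomy (s : ℝ) (1 / 2) with h | h | h
  · refine Or.inl ⟨⟨2 * s, by linarith, by linarith⟩, ⟨?_, ?_⟩, ?_, rfl⟩
    · change (0 : ℝ) < 2 * s; linarith
    · change (2 * s : ℝ) < 1; linarith
    · rw [joinArc, dif_pos h.le]
  · refine Or.inr (Or.inl ⟨?_, h⟩)
    rw [joinArc, dif_pos h.le]
    congr 1
    apply Subtype.ext
    change (2 * s : ℝ) = 1
    linarith
  · refine Or.inr (Or.inr ⟨⟨2 * s - 1, by linarith, by linarith⟩, ⟨?_, ?_⟩, ?_, rfl⟩)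
    · change (0 : ℝ) < 2 * s - 1; linarith
    · change (2 * s - 1 : ℝ) < 1; linarith
    · rw [joinArc, dif_neg (not_le.2 h)]

open Classical in
/-- Joining the arcs `i₁` and `i₂`. -/
noncomputable def mergeArcs (φ : ι → unitInterval → T) (i₁ i₂ : ι) (j : {j // j ≠ i₂}) :
    unitInterval → T :=
  if j = i₁ then joinArc (φ i₁) (φ i₂) else φ j

/-- The condition `hends` ensures that no other arc loses its end when `v` is removed; `v` becomes
the midpoint of the joined arc. -/
theorem Drawing.merge (h : Drawing V φ) {i₁ i₂ : ι} (hne : i₁ ≠ i₂) {v : T} (hv : v ∈ V)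
    (h1 : φ i₁ 1 = v) (h2 : φ i₂ 0 = v)
    (hends : ∀ i c, endPt φ (i, c) = v → (i, c) = (i₁, true) ∨ (i, c) = (i₂, false)) :
    Drawing (V \ {v}) (mergeArcs φ i₁ i₂) := by
  have hz : ∀ i, i ≠ i₂ → φ i 0 ≠ v := by
    intro i hi h'
    have := hends i false h'
    simp [hi] at this
  have ho : ∀ i, i ≠ i₁ → φ i 1 ≠ v := by
    intro i hi h'
    have := hends i true h'
    simp [hi] at this
  have hm : mergeArcs φ i₁ i₂ ⟨i₁, hne⟩ = joinArc (φ i₁) (φ i₂) := by simp [mergeArcs]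
  have hm' : ∀ j : {j // j ≠ i₂}, j.1 ≠ i₁ → mergeArcs φ i₁ i₂ j = φ j := by
    intro j hj; simp [mergeArcs, hj]
  have hj0 : joinArc (φ i₁) (φ i₂) 0 = φ i₁ 0 := by
    rw [joinArc, dif_pos (by norm_num)]; congr 1; apply Subtype.ext; norm_num
  have hj1 : joinArc (φ i₁) (φ i₂) 1 = φ i₂ 1 := by
    rw [joinArc, dif_neg (by norm_num)]; congr 1; apply Subtype.ext; norm_num
  have hcases : ∀ j : {j // j ≠ i₂}, j = ⟨i₁, hne⟩ ∨ j.1 ≠ i₁ := by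
    intro j
    by_cases hj : j.1 = i₁
    · exact Or.inl (Subtype.ext hj)
    · exact Or.inr hj
  refine ⟨h.finite.sdiff, ?_, ?_, ?_, ?_, ?_, ?_⟩
  · intro j
    rcases hcases j with rfl | hj
    · rw [hm]; exact continuous_joinArc (h.cont _) (h.cont _) (h1.trans h2.symm)
    · rw [hm' j hj]; exact h.cont _
  · intro j
    rcases hcases j with rfl | hj
    · rw [hm, hj0]; exact ⟨h.zero_mem _, hz _ hne⟩
    · rw [hm' j hj]; exact ⟨h.zero_mem _, hz _ j.2⟩
  · intro j
    rcases hcases j with rfl | hj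
    · rw [hm, hj1]; exact ⟨h.one_mem _, ho _ hne.symm⟩
    · rw [hm' j hj]; exact ⟨h.one_mem _, ho _ hj⟩
  · intro j t ht
    rcases hcases j with rfl | hj
    · rw [hm]
      rcases joinArc_cases (γ := φ i₁) (γ' := φ i₂) ht with ⟨u, hu, heq, -⟩ | ⟨heq, -⟩ | ⟨u, hu, heq, -⟩
      · rw [heq]; exact fun h' => h.notMem _ _ hu h'.1
      · rw [heq, h1]; exact fun h' => h'.2 rfl
      · rw [heq]; exact fun h' => h.notMem _ _ hu h'.1
    · rw [hm' j hj]; exact fun h' => h.notMem _ _ ht h'.1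
  · have key : ∀ (k : {j // j ≠ i₂}), k.1 ≠ i₁ → ∀ s ∈ Ioo (0 : unitInterval) 1,
        ∀ t ∈ Ioo (0 : unitInterval) 1, joinArc (φ i₁) (φ i₂) s ≠ φ k t := by
      intro k hk s hs t ht heq
      rcases joinArc_cases (γ := φ i₁) (γ' := φ i₂) hs with ⟨u, hu, h3, -⟩ | ⟨h3, -⟩ | ⟨u, hu, h3, -⟩
      · rw [h3] at heq; exact hk (h.inj _ _ _ hu _ ht heq).1.symm
      · rw [h3, h1] at heq; exact h.notMem _ _ ht (heq ▸ hv)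
      · rw [h3] at heq; exact k.2 (h.inj _ _ _ hu _ ht heq).1.symm
    intro j k s hs t ht heq
    rcases hcases j with rfl | hj <;> rcases hcases k with rfl | hk
    · rw [hm] at heq
      refine ⟨rfl, Subtype.ext ?_⟩
      rcases joinArc_cases (γ := φ i₁) (γ' := φ i₂) hs with ⟨u, hu, h3, h4⟩ | ⟨h3, h4⟩ | ⟨u, hu, h3, h4⟩ <;>
      rcases joinArc_cases (γ := φ i₁) (γ' := φ i₂) ht with ⟨w, hw, h5, h6⟩ | ⟨h5, h6⟩ | ⟨w, hw, h5, h6⟩ <;>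
      rw [h3, h5] at heq
      · have := congrArg Subtype.val (h.inj _ _ _ hu _ hw heq).2
        linarith
      · exact absurd (heq.trans h1 ▸ hv) (h.notMem _ _ hu)
      · exact absurd (h.inj _ _ _ hu _ hw heq).1 hne
      · exact absurd (heq.symm.trans h1 ▸ hv) (h.notMem _ _ hw)
      · linarith
      · exact absurd (heq.symm.trans h1 ▸ hv) (h.notMem _ _ hw)
      · exact absurd (h.inj _ _ _ hu _ hw heq).1.symm hne
      · exact absurd (heq.trans h1 ▸ hv) (h.notMem _ _ hu)
      · have := congrArg Subtype.val (h.inj _ _ _ hu _ hw heq).2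
        linarith
    · rw [hm, hm' k hk] at heq
      exact absurd heq (key k hk s hs t ht)
    · rw [hm, hm' j hj] at heq
      exact absurd heq.symm (key j hj t ht s hs)
    · rw [hm' j hj, hm' k hk] at heq
      obtain ⟨h3, h4⟩ := h.inj _ _ _ hs _ ht heq
      exact ⟨Subtype.ext h3, h4⟩
  · intro x
    rcases h.cover x with hx | ⟨i, t, ht, rfl⟩
    · by_cases hxv : x = v
      · refine Or.inr ⟨⟨i₁, hne⟩, ⟨1 / 2, by norm_num, by norm_num⟩, ⟨?_, ?_⟩, ?_⟩
        · change (0 : ℝ) < 1 / 2; norm_num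
        · change (1 / 2 : ℝ) < 1; norm_num
        · rw [hm, joinArc, dif_pos le_rfl, hxv, ← h1]
          congr 1; apply Subtype.ext; norm_num
      · exact Or.inl ⟨hx, hxv⟩
    · right
      have ht0 : (0 : ℝ) < t := ht.1
      have ht1 : (t : ℝ) < 1 := ht.2
      by_cases hi2 : i = i₂
      · subst hi2
        refine ⟨⟨i₁, hne⟩, ⟨(t + 1) / 2, by linarith, by linarith⟩, ⟨?_, ?_⟩, ?_⟩
        · change (0 : ℝ) < (t + 1) / 2; linarith
        · change ((t + 1) / 2 : ℝ) < 1; linarith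
        · rw [hm, joinArc, dif_neg (by simp only [not_le]; linarith)]
          congr 1; apply Subtype.ext; simp only; ring
      by_cases hi1 : i = i₁
      · subst hi1
        refine ⟨⟨i, hne⟩, ⟨t / 2, by linarith, by linarith⟩, ⟨?_, ?_⟩, ?_⟩
        · change (0 : ℝ) < t / 2; linarith
        · change (t / 2 : ℝ) < 1; linarith
        · rw [hm, joinArc, dif_pos (by simp only; linarith)]
          congr 1; apply Subtype.ext; simp only; ring
      · exact ⟨⟨i, hi2⟩, t, ht, by rw [hm' _ hi1]⟩

/-- A loop whose vertex has degree two is the whole space. -/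
theorem Drawing.eq_singleton_of_loop [Finite ι] [T2Space T] [ConnectedSpace T]
    (h : Drawing V φ) {i : ι} {v : T} (h0 : φ i 0 = v) (h1 : φ i 1 = v)
    (hends : ∀ j c, endPt φ (j, c) = v → j = i) : V = {v} := by
  classical
  have hcl := h.isClosed_union (V' := V \ {v}) sdiff_subset
    (J := fun j => if j = i then ∅ else univ) fun j => by
      split_ifs; exacts [isClosed_empty, isClosed_univ]
  have heq : range (φ i) = ((V \ {v}) ∪ ⋃ j, φ j '' (if j = i then ∅ else univ))ᶜ := by
    ext x
    constructor
    · rintro ⟨t, rfl⟩ (hx | hx)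
      · rcases unitInterval_trichotomy t with rfl | rfl | ht
        · exact hx.2 h0
        · exact hx.2 h1
        · exact h.notMem _ _ ht hx.1
      · obtain ⟨j, s, hs, hst⟩ := mem_iUnion.1 hx
        by_cases hj : j = i
        · rw [if_pos hj] at hs; exact hs
        rcases h.mem_or j s with hs' | hs'
        · rcases unitInterval_trichotomy t with rfl | rfl | ht
          · rw [h0] at hst
            rcases unitInterval_trichotomy s with rfl | rfl | hs''
            · exact hj (hends j false hst)
            · exact hj (hends j true hst)
            · exact h.notMem _ _ hs'' hs'
          · rw [h1] at hst
            rcases unitInterval_trichotomy s with rfl | rfl | hs''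
            · exact hj (hends j false hst)
            · exact hj (hends j true hst)
            · exact h.notMem _ _ hs'' hs'
          · exact h.notMem _ _ ht (hst ▸ hs')
        · exact hj (h.eq_of_eq hs' hst).1
    · intro hx
      rw [mem_compl_iff, mem_union, not_or] at hx
      rcases h.cover x with hV | ⟨j, t, -, rfl⟩
      · have : x = v := by
          by_contra hxv
          exact hx.1 ⟨hV, hxv⟩
        exact ⟨0, h0.trans this.symm⟩
      · by_cases hj : j = i
        · exact ⟨t, by rw [hj]⟩
        · exact (hx.2 (mem_iUnion.2 ⟨j, t, by rw [if_neg hj]; trivial, rfl⟩)).elim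
  have hclopen : IsClopen (range (φ i)) :=
    ⟨(isCompact_range (h.cont i)).isClosed, heq ▸ hcl.isOpen_compl⟩
  have huniv : range (φ i) = univ :=
    (isClopen_iff.1 hclopen).resolve_left (range_nonempty _).ne_empty
  apply Subset.antisymm
  · intro x hx
    obtain ⟨t, rfl⟩ := huniv.symm.subset (mem_univ x)
    rcases unitInterval_trichotomy t with rfl | rfl | ht
    · exact h0
    · exact h1
    · exact absurd hx (h.notMem _ _ ht)
  · rintro _ rfl
    exact h0 ▸ h.zero_mem i

/-- A nonsingular vertex has exactly two half-edges. They belong to different arcs unless the space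
is a circle with this single vertex, which the last hypothesis excludes. -/
theorem Drawing.exists_suppress {ι : Type} {φ : ι → unitInterval → T} [Finite ι] [T2Space T]
    [ConnectedSpace T] [Nontrivial T] (h : Drawing V φ) {v : T} (hv : v ∈ V)
    (hs : ¬ IsSingular v) (hV : V ≠ {v}) :
    ∃ (ι' : Type) (_ : Finite ι') (φ' : ι' → unitInterval → T), Drawing (V \ {v}) φ' := by
  rw [h.isSingular_iff hv, not_not, ncard_eq_two] at hs
  obtain ⟨⟨i₁, b₁⟩, ⟨i₂, b₂⟩, hne, heq⟩ := hs
  have hmem : ∀ i c, endPt φ (i, c) = v ↔ (i, c) = (i₁, b₁) ∨ (i, c) = (i₂, b₂) := by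
    intro i c
    have : (i, c) ∈ halfEdges φ v ↔ (i, c) ∈ ({(i₁, b₁), (i₂, b₂)} : Set (ι × Bool)) := by rw [heq]
    simpa [halfEdges] using this
  have hi : i₁ ≠ i₂ := by
    rintro rfl
    have hb : ∀ c : Bool, c = b₁ ∨ c = b₂ := by
      intro c
      have : b₁ ≠ b₂ := fun hb => hne (by rw [hb])
      cases b₁ <;> cases b₂ <;> cases c <;> simp_all
    have hc : ∀ c, endPt φ (i₁, c) = v := by
      intro c
      rw [hmem]
      rcases hb c with h | h <;> simp [h]
    refine hV (h.eq_singleton_of_loop (i := i₁) (hc false) (hc true) fun j c hj => ?_)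
    rw [hmem] at hj
    rcases hj with hj | hj <;> exact congrArg Prod.fst hj
  classical
  -- The directions are chosen so that the first arc finishes at `v` and the second starts there.
  let b : ι → Bool := fun i => if i = i₁ then !b₁ else if i = i₂ then b₂ else false
  have hb1 : b i₁ = !b₁ := by simp [b]
  have hb2 : b i₂ = b₂ := by simp [b, hi.symm]
  refine ⟨{j // j ≠ i₂}, inferInstance, mergeArcs (flipArcs φ b) i₁ i₂,
    (h.flip b).merge hi hv ?_ ?_ ?_⟩
  · have := endPt_flipArcs (φ := φ) b i₁ true
    rw [hb1, Bool.true_xor, Bool.not_not, (hmem i₁ b₁).2 (Or.inl rfl)] at this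
    exact this
  · have := endPt_flipArcs (φ := φ) b i₂ false
    rw [hb2, Bool.false_xor, (hmem i₂ b₂).2 (Or.inr rfl)] at this
    exact this
  · intro i c hc
    rw [endPt_flipArcs, hmem, Prod.mk.injEq, Prod.mk.injEq] at hc
    rcases hc with ⟨rfl, hc⟩ | ⟨rfl, hc⟩
    · left
      rw [hb1] at hc
      congr 1
      revert hc; cases c <;> cases b₁ <;> decide
    · right
      rw [hb2] at hc
      congr 1
      revert hc; cases c <;> cases b₂ <;> decide

/-- Superfluous vertices are suppressed one at a time. Since `K` is non-empty, the last vertex is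
never the one to be removed. -/
theorem Drawing.exists_drawing_of_subset {K : Set T} [T2Space T] [ConnectedSpace T] [Nontrivial T]
    (hK : K.Nonempty) (hsing : ∀ x, x ∉ K → ¬ IsSingular x) :
    ∀ (n : ℕ) {V : Set T} {ι : Type} [Finite ι] {φ : ι → unitInterval → T}, Drawing V φ →
      K ⊆ V → V.ncard = n →
      ∃ (ι' : Type) (_ : Finite ι') (φ' : ι' → unitInterval → T), Drawing K φ' := by
  intro n
  induction n with
  | zero =>
    intro V ι _ φ h hKV hn
    rw [ncard_eq_zero h.finite] at hn
    exact absurd hK (not_nonempty_iff_eq_empty.2 (subset_empty_iff.1 (hn ▸ hKV)))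
  | succ n ih =>
    intro V ι hι φ h hKV hn
    by_cases hVK : V ⊆ K
    · obtain rfl := Subset.antisymm hKV hVK
      exact ⟨ι, hι, φ, h⟩
    · obtain ⟨v, hv, hvK⟩ := not_subset.1 hVK
      have hne : V ≠ {v} := by
        rintro rfl
        obtain ⟨x, hx⟩ := hK
        exact hvK ((hKV hx : x = v) ▸ hx)
      obtain ⟨ι', hι', φ', h'⟩ := h.exists_suppress hv (hsing v hvK) hne
      refine ih h' (fun x hx => ⟨hKV hx, fun hxv => hvK (hxv ▸ hx)⟩) ?_
      rw [ncard_sdiff_singleton_of_mem hv, hn]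
      rfl

end Suppress

/-! ## The standard drawing of a tangle -/

section Standard

variable {T : Type*} [TopologicalSpace T]

/-- The vertices of the multigraph of a tangle. -/
def tangleVertices (p : T) : Set T := {x : T | IsSingular x ∨ ((∀ y : T, ¬ IsSingular y) ∧ x = p)}

theorem IsTangle.facts (hT : IsTangle T) :
    T2Space T ∧ ConnectedSpace T ∧ Nontrivial T ∧ LocallyConnectedSpace T := by
  obtain ⟨hconn, n, q, hq, hid⟩ := hT
  refine ⟨t2Space_of_isClosedMap hq.continuous hq.surjective (isClosedMap_of_identify hq hid),
    hconn, ?_, ?_⟩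
  · obtain ⟨x⟩ := hconn.toNonempty
    obtain ⟨⟨i, -⟩, -⟩ := hq.surjective x
    refine ⟨q (i, 0), q (i, ⟨1 / 2, by norm_num, by norm_num⟩), fun h => ?_⟩
    rcases hid _ _ h with h | ⟨-, h | h⟩
    · have := congrArg (fun a => (a.2 : ℝ)) h
      norm_num at this
    · have := congrArg Subtype.val h
      norm_num at this
    · have := congrArg Subtype.val h
      norm_num at this
  · have := hq.locallyPathConnectedSpace
    infer_instance

/-- The images of the end points of the intervals are the vertices of a first drawing. The base
point `p` is added when necessary, and every vertex outside the desired set is suppressed. -/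
theorem IsTangle.exists_drawing (hT : IsTangle T) (p : T) :
    ∃ (ι : Type) (_ : Finite ι) (φ : ι → unitInterval → T), Drawing (tangleVertices p) φ := by
  obtain ⟨_, _, _, -⟩ := hT.facts
  obtain ⟨-, n, q, hq, hid⟩ := hT
  have hmid : ∀ t ∈ Ioo (0 : unitInterval) 1, ¬ (t = 0 ∨ t = 1) := by
    rintro t ht (rfl | rfl)
    exacts [lt_irrefl _ ht.1, lt_irrefl _ ht.2]
  have h0 : Drawing (q '' {a | a.2 = 0 ∨ a.2 = 1}) (fun i t => q (i, t)) := by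
    refine ⟨(finite_endpoints n).image q, ?_, ?_, ?_, ?_, ?_, ?_⟩
    · exact fun i => hq.continuous.comp (by fun_prop)
    · exact fun i => ⟨(i, 0), Or.inl rfl, rfl⟩
    · exact fun i => ⟨(i, 1), Or.inr rfl, rfl⟩
    · rintro i t ht ⟨a, ha, heq⟩
      rcases hid _ _ heq with rfl | ⟨-, h⟩
      exacts [hmid t ht ha, hmid t ht h]
    · intro i j s hs t ht heq
      rcases hid _ _ heq with h | ⟨h, -⟩
      · exact Prod.mk.injEq .. ▸ h
      · exact absurd h (hmid s hs)
    · intro x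
      obtain ⟨⟨i, t⟩, rfl⟩ := hq.surjective x
      rcases unitInterval_trichotomy t with rfl | rfl | ht
      · exact Or.inl ⟨_, Or.inl rfl, rfl⟩
      · exact Or.inl ⟨_, Or.inr rfl, rfl⟩
      · exact Or.inr ⟨i, t, ht, rfl⟩
  have hK : (tangleVertices p).Nonempty := by
    by_cases h : ∃ y : T, IsSingular y
    · obtain ⟨y, hy⟩ := h
      exact ⟨y, Or.inl hy⟩
    · exact ⟨p, Or.inr ⟨not_exists.1 h, rfl⟩⟩
  have hsing : ∀ x, x ∉ tangleVertices p → ¬ IsSingular x := fun x hx h => hx (Or.inl h)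
  -- Inner points of arcs are nonsingular, so the vertices of any drawing include all singular
  -- points.
  have main : ∀ {V : Set T} {ι : Type} [Finite ι] {φ : ι → unitInterval → T}, Drawing V φ →
      p ∈ V → ∃ (ι : Type) (_ : Finite ι) (φ : ι → unitInterval → T),
        Drawing (tangleVertices p) φ := by
    intro V ι _ φ h hp
    refine Drawing.exists_drawing_of_subset hK hsing V.ncard h ?_ rfl
    rintro x (hx | ⟨-, rfl⟩)
    · rcases h.cover x with hxV | ⟨i, t, ht, rfl⟩
      · exact hxV
      · exact absurd hx (h.not_isSingular_of_mem_arc i ht)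
    · exact hp
  rcases h0.cover p with hp | ⟨i, t, ht, hp⟩
  · exact main h0 hp
  · exact main (h0.insert i ht) (Or.inl hp.symm)

end Standard

/-! ## Cutsets of cardinality one -/

section Cutsets

variable {T : Type*} [TopologicalSpace T]

/-- Three disjoint connected open sets, each with at most one boundary point. -/
structure ThreeEnds (C : Fin 3 → Set T) (s : Fin 3 → T) : Prop where
  isOpen : ∀ i, IsOpen (C i)
  nonempty : ∀ i, (C i).Nonempty
  disjoint : ∀ i j, i ≠ j → Disjoint (C i) (C j)
  closure_subset : ∀ i, closure (C i) ⊆ insert (s i) (C i)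

theorem ThreeEnds.comp {C : Fin 3 → Set T} {s : Fin 3 → T} (h : ThreeEnds C s)
    (σ : Equiv.Perm (Fin 3)) : ThreeEnds (C ∘ σ) (s ∘ σ) where
  isOpen _ := h.isOpen _
  nonempty _ := h.nonempty _
  disjoint _ _ hij := h.disjoint _ _ (σ.injective.ne hij)
  closure_subset _ := h.closure_subset _

/-- The set `C i` and the complement of its closure are open, and only the point `s i` can lie
between them. -/
theorem ThreeEnds.subset {C : Fin 3 → Set T} {s : Fin 3 → T} (h : ThreeEnds C s) {A : Set T}
    (hA : IsPreconnected A) {i : Fin 3} (hs : s i ∉ A) (hi : (A ∩ C i).Nonempty) : A ⊆ C i := by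
  refine hA.subset_left_of_subset_union (h.isOpen i) isClosed_closure.isOpen_compl
    (disjoint_compl_right.mono_left subset_closure) (fun x hx => ?_) hi
  by_cases hx' : x ∈ closure (C i)
  · rcases h.closure_subset i hx' with rfl | hx''
    · exact absurd hx hs
    · exact Or.inl hx''
  · exact Or.inr hx'

/-- One of the parts of a partition into two connected sets meets at most one of the ends. -/
theorem ThreeEnds.meets_one {C : Fin 3 → Set T} {s : Fin 3 → T} (h : ThreeEnds C s)
    {A : Fin 2 → Set T} (hA : ∀ k, IsPreconnected (A k)) (hd : Disjoint (A 0) (A 1)) :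
    ∃ k, ∀ i j, (A k ∩ C i).Nonempty → (A k ∩ C j).Nonempty → i = j := by
  -- A part that misses two boundary points lies inside one of these two ends if it meets it, and
  -- then meets no other. If it meets neither, only the third end remains. Since each boundary point
  -- is missing from one of the two parts, some part misses two of the three.
  have key : ∀ k i j, i ≠ j → s i ∉ A k → s j ∉ A k →
      ∃ k, ∀ i j, (A k ∩ C i).Nonempty → (A k ∩ C j).Nonempty → i = j := by
    intro k i j hij hi hj
    have main : ∀ l, s l ∉ A k → (A k ∩ C l).Nonempty → ∀ m, (A k ∩ C m).Nonempty → m = l := by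
      intro l hl hne m hm
      by_contra hml
      obtain ⟨x, hx, hxm⟩ := hm
      exact (h.disjoint m l hml).le_bot ⟨hxm, h.subset (hA k) hl hne hx⟩
    refine ⟨k, fun l m hl hm => ?_⟩
    by_cases hi' : (A k ∩ C i).Nonempty
    · rw [main i hi hi' l hl, main i hi hi' m hm]
    by_cases hj' : (A k ∩ C j).Nonempty
    · rw [main j hj hj' l hl, main j hj hj' m hm]
    have h1 : ∀ n, (A k ∩ C n).Nonempty → n ≠ i ∧ n ≠ j := fun n hn =>
      ⟨fun h => hi' (h ▸ hn), fun h => hj' (h ▸ hn)⟩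
    have := h1 l hl
    have := h1 m hm
    omega
  have h01 : ∀ x, x ∉ A 0 ∨ x ∉ A 1 := fun x => by
    by_contra hx
    push Not at hx
    exact hd.le_bot hx
  rcases h01 (s 0) with h0 | h0 <;> rcases h01 (s 1) with h1 | h1 <;>
    rcases h01 (s 2) with h2 | h2
  · exact key 0 0 1 (by decide) h0 h1
  · exact key 0 0 1 (by decide) h0 h1
  · exact key 0 0 2 (by decide) h0 h2
  · exact key 1 1 2 (by decide) h1 h2
  · exact key 0 1 2 (by decide) h1 h2
  · exact key 1 0 2 (by decide) h0 h2
  · exact key 1 0 1 (by decide) h0 h1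
  · exact key 1 0 1 (by decide) h0 h1

theorem infinite_of_isOpen [T2Space T] [ConnectedSpace T] [Nontrivial T] {U : Set T}
    (hU : IsOpen U) (hne : U.Nonempty) : U.Infinite := by
  obtain ⟨x, hx⟩ := hne
  exact infinite_of_mem_nhds x (hU.mem_nhds hx)

/-- Pick a point in each end and consider the middle one, `c`. If its end contained another point,
cutting the order just before or just after `c` would give two connected parts that each meet two
ends. So the middle end would be a single point, but non-empty open sets are infinite. -/
theorem ThreeEnds.not_hasBipolarOrdering [T2Space T] [ConnectedSpace T] [Nontrivial T]
    {C : Fin 3 → Set T} {s : Fin 3 → T} (h : ThreeEnds C s) : ¬ HasBipolarOrdering T := by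
  rintro ⟨_, hord⟩
  choose c hc using h.nonempty
  have hinj : Function.Injective c := by
    intro i j hij
    by_contra hne
    exact (h.disjoint i j hne).le_bot ⟨hc i, hij ▸ hc j⟩
  have hmono : StrictMono (c ∘ Tuple.sort c) :=
    (Tuple.monotone_sort c).strictMono_of_injective (hinj.comp (Equiv.injective _))
  have h' := h.comp (Tuple.sort c)
  set σ := Tuple.sort c
  have hc' : ∀ i, c (σ i) ∈ C (σ i) := fun i => hc _
  have h01 : c (σ 0) < c (σ 1) := hmono (by decide)
  have h12 : c (σ 1) < c (σ 2) := hmono (by decide)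
  -- Below `c (σ 1)` lie the first chosen point and `x`; from `c (σ 1)` upwards lie the other two
  -- chosen points.
  have hlow : ∀ x ∈ C (σ 1), ¬ x < c (σ 1) := by
    intro x hx hlt
    obtain ⟨k, hk⟩ := h'.meets_one (A := ![{x | x < c (σ 1)}, {x | c (σ 1) ≤ x}])
      (fun k => by
        fin_cases k
        exacts [(hord _).1, (hord _).2.2.2])
      (Set.disjoint_left.2 fun y hy hy' => not_le_of_gt hy hy')
    fin_cases k
    · exact absurd (hk 0 1 ⟨_, h01, hc' 0⟩ ⟨x, hlt, hx⟩) (by decide)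
    · exact absurd (hk 1 2 ⟨_, le_rfl, hc' 1⟩ ⟨_, h12.le, hc' 2⟩) (by decide)
  have hup : ∀ x ∈ C (σ 1), ¬ c (σ 1) < x := by
    intro x hx hlt
    obtain ⟨k, hk⟩ := h'.meets_one (A := ![{x | x ≤ c (σ 1)}, {x | c (σ 1) < x}])
      (fun k => by
        fin_cases k
        exacts [(hord _).2.1, (hord _).2.2.1])
      (Set.disjoint_left.2 fun y hy hy' => not_le_of_gt hy' hy)
    fin_cases k
    · exact absurd (hk 0 1 ⟨_, h01.le, hc' 0⟩ ⟨_, le_rfl, hc' 1⟩) (by decide)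
    · exact absurd (hk 1 2 ⟨x, hlt, hx⟩ ⟨_, h12, hc' 2⟩) (by decide)
  refine infinite_of_isOpen (h.isOpen (σ 1)) (h.nonempty _) ((finite_singleton (c (σ 1))).subset ?_)
  intro x hx
  exact le_antisymm (not_lt.1 (hup x hx)) (not_lt.1 (hlow x hx))

end Cutsets

/-! ## The edges of a tangle -/

section Edges

variable {T : Type*} [TopologicalSpace T]

theorem tangleVertices_eq (p : T) (h : ∃ y : T, IsSingular y) :
    tangleVertices p = {x | IsSingular x} := by
  ext x
  refine ⟨?_, Or.inl⟩
  rintro (hx | ⟨hx, -⟩)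
  · exact hx
  · obtain ⟨y, hy⟩ := h
    exact absurd hy (hx y)

theorem edges_eq_of_singular (p : T) (h : ∃ y : T, IsSingular y) :
    edges T = componentsOf (tangleVertices p)ᶜ := by
  rw [tangleVertices_eq p h]
  rfl

theorem edges_eq_of_circle [ConnectedSpace T] (h : ∀ y : T, ¬ IsSingular y) :
    edges T = {univ} := by
  have : {x : T | ¬ IsSingular x} = univ := eq_univ_of_forall h
  rw [edges, this]
  ext e
  constructor
  · rintro ⟨x, -, rfl⟩
    rw [connectedComponentIn_univ, PreconnectedSpace.connectedComponent_eq_univ]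
    rfl
  · rintro rfl
    obtain ⟨x⟩ := (inferInstance : Nonempty T)
    refine ⟨x, trivial, ?_⟩
    rw [connectedComponentIn_univ, PreconnectedSpace.connectedComponent_eq_univ]

theorem IsTangle.finite_edges (hT : IsTangle T) : (edges T).Finite := by
  obtain ⟨_, hconn, _, -⟩ := hT.facts
  by_cases h : ∃ y : T, IsSingular y
  · obtain ⟨p⟩ := hconn.toNonempty
    obtain ⟨ι, _, φ, hφ⟩ := hT.exists_drawing p
    rw [edges_eq_of_singular p h, hφ.componentsOf_compl]
    exact finite_range _
  · rw [edges_eq_of_circle (not_exists.1 h)]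
    exact finite_singleton _

theorem IsTangle.finite_singular (hT : IsTangle T) : {x : T | IsSingular x}.Finite := by
  obtain ⟨_, hconn, _, -⟩ := hT.facts
  obtain ⟨p⟩ := hconn.toNonempty
  obtain ⟨ι, _, φ, hφ⟩ := hT.exists_drawing p
  exact hφ.finite.subset fun x hx => Or.inl hx

/-- Replacing its edges by their closures adds only points of `A`, and there are finitely many
edges. -/
theorem IsTangle.isClosed_subtangle (hT : IsTangle T) {X : Set T} (hX : IsSubtangle X) :
    IsClosed X := by
  obtain ⟨_, _, _, -⟩ := hT.facts
  obtain ⟨A, F, -, hA, hF, hends, rfl⟩ := hX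
  have : A ∪ ⋃₀ F = A ∪ ⋃ e ∈ F, closure e := by
    apply Subset.antisymm
    · refine union_subset_union_right _ ?_
      rintro x ⟨e, he, hx⟩
      exact mem_biUnion he (subset_closure hx)
    · rintro x (hx | hx)
      · exact Or.inl hx
      · obtain ⟨e, he, hx⟩ := mem_iUnion₂.1 hx
        by_cases hxe : x ∈ e
        · exact Or.inr ⟨e, he, hxe⟩
        · exact Or.inl (hends e he ⟨hx, hxe⟩)
  rw [this]
  exact (hT.finite_singular.subset hA).isClosed.union
    ((hT.finite_edges.subset hF).isClosed_biUnion fun e _ => isClosed_closure)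

/-- Components of the complement are open by local connectedness and relatively closed, so their
closures add only points of the subtangle, hence at most a contact point. -/
theorem IsTangle.exists_threeEnds (hT : IsTangle T) (h : HasGenGapCutset T 1) :
    ∃ (C : Fin 3 → Set T) (s : Fin 3 → T), ThreeEnds C s := by
  classical
  obtain ⟨X, C, h⟩ := h
  obtain ⟨_, hconn, _, _⟩ := hT.facts
  obtain ⟨p⟩ := hconn.toNonempty
  have hXo : IsOpen (⋃ i, X i)ᶜ := (isClosed_iUnion_of_finite fun i =>
    hT.isClosed_subtangle (h.subtangle i)).isOpen_compl
  have hXu : (⋃ i, X i) = X 0 := by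
    ext x
    simp
  -- A component without contact point is closed, and `p` serves as an arbitrary value for it.
  refine ⟨C, fun j => if hj : (X 0 ∩ closure (C j)).Nonempty then hj.choose else p, ?_, ?_, ?_, ?_⟩
  · intro j
    obtain ⟨x, hx, hj⟩ := h.component j
    rw [hj]
    exact hXo.connectedComponentIn
  · intro j
    obtain ⟨x, hx, hj⟩ := h.component j
    exact ⟨x, hj ▸ mem_connectedComponentIn hx⟩
  · intro i j hij
    rw [Set.disjoint_left]
    intro y hi hj
    obtain ⟨x, hx, hxi⟩ := h.component i
    obtain ⟨x', hx', hxj⟩ := h.component j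
    apply hij
    apply h.injective
    rw [hxi] at hi
    rw [hxj] at hj
    rw [hxi, hxj, connectedComponentIn_eq hi, connectedComponentIn_eq hj]
  · intro j y hy
    by_cases hyX : y ∈ X 0
    · left
      have hne : (X 0 ∩ closure (C j)).Nonempty := ⟨y, hyX, hy⟩
      rw [dif_pos hne]
      exact h.contact 0 j ⟨hyX, hy⟩ hne.choose_spec
    · right
      obtain ⟨x, hx, hj⟩ := h.component j
      rw [← hXu] at hyX
      have hyX : y ∈ (⋃ i, X i)ᶜ := hyX
      obtain ⟨z, hz, hzj⟩ := mem_closure_iff.1 hy _ hXo.connectedComponentIn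
        (mem_connectedComponentIn hyX)
      rw [hj] at hzj
      rw [hj, connectedComponentIn_eq hzj, ← connectedComponentIn_eq hz]
      exact mem_connectedComponentIn hyX

end Edges

/-! ## Valuations concentrated on three ends -/

section Measures

open MeasureTheory Filter Topology

variable {T : Type*} [TopologicalSpace T]

theorem volume_pos_of_isOpen {U : Set unitInterval} (hU : IsOpen U) (hne : U.Nonempty) :
    0 < (volume : Measure unitInterval) U := by
  obtain ⟨O, hO, rfl⟩ := isOpen_induced_iff.1 hU
  have hd : Dense (Ioo (0 : unitInterval) 1) := dense_iff_closure_eq.2 closure_Ioo_unitInterval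
  obtain ⟨t, htO, ht⟩ := hd.inter_open_nonempty _ hU hne
  rw [unitInterval.volume_apply]
  refine ((hO.inter isOpen_Ioo).measure_pos volume ⟨(t : ℝ), htO, ht⟩).trans_le (measure_mono ?_)
  rintro x ⟨hx, hx'⟩
  exact ⟨⟨x, Ioo_subset_Icc_self hx'⟩, hx, rfl⟩

theorem IsEdgeIdentification.finite_fiber {ψ : edges T → unitInterval → T}
    (hψ : IsEdgeIdentification ψ) (e : edges T) (q : T) : {u | ψ e u = q}.Finite := by
  have : {u | ψ e u = q} ⊆ {0, 1} ∪ ({u | ψ e u = q} ∩ Ioo 0 1) := by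
    intro u hu
    rcases unitInterval_trichotomy u with rfl | rfl | h
    · exact Or.inl (Or.inl rfl)
    · exact Or.inl (Or.inr rfl)
    · exact Or.inr ⟨hu, h⟩
  refine (((finite_singleton _).insert _).union ?_).subset this
  apply Set.Subsingleton.finite
  rintro u ⟨hu, hu'⟩ w ⟨hw, hw'⟩
  exact hψ.injOn e hu' hw' (hu.trans hw.symm)

theorem eventually_le_iff_le {X : Type*} [TopologicalSpace X] {f g : X → ℝ} {x : X}
    (hf : ContinuousAt f x) (hg : ContinuousAt g x) (h : f x ≠ g x) :
    ∀ᶠ y in 𝓝 x, (f y ≤ g y ↔ f x ≤ g x) := by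
  rcases lt_or_gt_of_ne h with h | h
  · filter_upwards [hf.eventually_lt hg h] with y hy
    exact iff_of_true hy.le h.le
  · filter_upwards [hg.eventually_lt hf h] with y hy
    exact iff_of_false (not_le.2 hy) (not_le.2 h)

/-- The point `q` has finitely many parameters on each edge, so membership is a finite combination
of comparisons, none of which is an equality at `z`; all of them persist nearby. -/
theorem IsEdgeIdentification.eventually_mem_closedPiece [Finite (edges T)]
    {ψ : edges T → unitInterval → T} (hψ : IsEdgeIdentification ψ) (z : edges T → ℝ × ℝ) {q : T}
    (hq : ∀ e (u : unitInterval), ((u : ℝ) = (z e).1 ∨ (u : ℝ) = (z e).2) → ψ e u ≠ q) :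
    ∀ᶠ z' in 𝓝 z, (q ∈ closedPiece ψ z' ↔ q ∈ closedPiece ψ z) := by
  have h1 : ∀ᶠ z' in 𝓝 z, ∀ e, ∀ u ∈ {u | ψ e u = q},
      (((z' e).1 ≤ (u : ℝ) ↔ (z e).1 ≤ (u : ℝ)) ∧ ((u : ℝ) ≤ (z' e).2 ↔ (u : ℝ) ≤ (z e).2)) := by
    rw [eventually_all]
    intro e
    rw [(hψ.finite_fiber e q).eventually_all]
    intro u hu
    have hc : ContinuousAt (fun z : edges T → ℝ × ℝ => z e) z := continuousAt_apply e z
    exact (eventually_le_iff_le hc.fst continuousAt_const fun h => hq e u (Or.inl h.symm) hu).and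
      (eventually_le_iff_le continuousAt_const hc.snd fun h => hq e u (Or.inr h) hu)
  filter_upwards [h1] with z' hz'
  simp only [closedPiece, mem_iUnion, mem_image, mem_ofPred_eq]
  constructor
  · rintro ⟨e, u, ⟨h1, h2⟩, h3⟩
    exact ⟨e, u, ⟨(hz' e u h3).1.1 h1, (hz' e u h3).2.1 h2⟩, h3⟩
  · rintro ⟨e, u, ⟨h1, h2⟩, h3⟩
    exact ⟨e, u, ⟨(hz' e u h3).1.2 h1, (hz' e u h3).2.2 h2⟩, h3⟩

theorem IsEdgeIdentification.isClosed_closedPiece [Finite (edges T)] [T2Space T]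
    {ψ : edges T → unitInterval → T} (hψ : IsEdgeIdentification ψ) (z : edges T → ℝ × ℝ) :
    IsClosed (closedPiece ψ z) := by
  refine isClosed_iUnion_of_finite fun e => IsCompact.isClosed ?_
  refine (IsClosed.isCompact ?_).image (hψ.continuous e)
  exact (isClosed_le continuous_const continuous_subtype_val).inter
    (isClosed_le continuous_subtype_val continuous_const)

/-- The measure of the part of an arc in a set depends continuously on the set. -/
theorem IsEdgeIdentification.continuous_measure [Finite (edges T)] [T2Space T]
    {ψ : edges T → unitInterval → T} (hψ : IsEdgeIdentification ψ) {γ : unitInterval → T}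
    (hγ : Continuous γ) {U : Set unitInterval} (hU : IsOpen U) (hinj : InjOn γ U) :
    Continuous fun z => volume.real (U ∩ γ ⁻¹' closedPiece ψ z) := by
  rw [continuous_iff_continuousAt]
  intro z
  have hm : ∀ z, MeasurableSet (U ∩ γ ⁻¹' closedPiece ψ z) := fun z =>
    hU.measurableSet.inter ((hψ.isClosed_closedPiece z).preimage hγ).measurableSet
  refine (ENNReal.tendsto_toReal (measure_ne_top _ _)).comp ?_
  refine tendsto_measure_of_ae_tendsto_indicator_of_isFiniteMeasure _ (hm z) hm ?_
  -- The ends of the pieces. Away from these finitely many points membership is locally constant in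
  -- `z`, so the indicators converge almost everywhere, and hence the measures converge.
  let Q : Set T := ⋃ e, ψ e '' {u : unitInterval | (u : ℝ) = (z e).1 ∨ (u : ℝ) = (z e).2}
  have hQ : Q.Finite := by
    refine finite_iUnion fun e => Finite.image _ ?_
    have h1 : ∀ r : ℝ, {u : unitInterval | (u : ℝ) = r}.Subsingleton := fun r u hu w hw =>
      Subtype.ext (Eq.trans hu (Eq.symm hw))
    exact (h1 _).finite.union (h1 _).finite
  have hQ' : (U ∩ γ ⁻¹' Q).Finite := by
    refine Finite.of_finite_image (hQ.subset ?_) (hinj.mono inter_subset_left)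
    rintro _ ⟨t, ht, rfl⟩
    exact ht.2
  have hnull : ∀ᵐ t ∂(volume : Measure unitInterval), t ∉ U ∩ γ ⁻¹' Q :=
    measure_eq_zero_iff_ae_notMem.1 (hQ'.measure_zero _)
  filter_upwards [hnull] with t ht
  by_cases htU : t ∈ U
  · have htQ : γ t ∉ Q := fun h => ht ⟨htU, h⟩
    filter_upwards [hψ.eventually_mem_closedPiece z (q := γ t) fun e u hu heq =>
      htQ (mem_iUnion.2 ⟨e, u, hu, heq⟩)] with z' hz'
    exact and_congr_right fun _ => hz'
  · exact Eventually.of_forall fun z' => iff_of_false (fun h => htU h.1) fun h => htU h.1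

/-- An open set is infinite and the vertices are finite in number, so it contains an inner point of
some arc and with it a piece of the arc. -/
theorem Drawing.exists_arc_in {ι : Type*} [Finite ι] {V : Set T} {φ : ι → unitInterval → T}
    [T2Space T] [ConnectedSpace T] [Nontrivial T] (h : Drawing V φ) {C : Set T} (hC : IsOpen C)
    (hne : C.Nonempty) :
    ∃ (γ : unitInterval → T) (U : Set unitInterval), Continuous γ ∧ IsOpen U ∧ U.Nonempty ∧
      InjOn γ U ∧ MapsTo γ U C := by
  obtain ⟨x, hxC, hxV⟩ := (infinite_of_isOpen hC hne).exists_notMem_finite h.finite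
  obtain ⟨i, t, ht, rfl⟩ := (h.cover x).resolve_left hxV
  refine ⟨φ i, Ioo 0 1 ∩ φ i ⁻¹' C, h.cont i, isOpen_Ioo.inter (hC.preimage (h.cont i)),
    ⟨t, ht, hxC⟩, ?_, fun t ht => ht.2⟩
  intro s hs t ht heq
  exact (h.inj i i s hs.1 t ht.1 heq).2

/-- Both agents get the same valuation, the sum of three probability measures, one spread over a
piece of arc in each end. In a connected partition one share meets at most one end, so it is worth
at most 1, while the other share contains the remaining two ends and is worth at least 2. -/
theorem IsTangle.not_guarantees_of_threeEnds (hT : IsTangle T) {C : Fin 3 → Set T}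
    {s : Fin 3 → T} (hC : ThreeEnds C s) : ¬ GuaranteesConnectedEF T 2 := by
  obtain ⟨_, hconn, _, -⟩ := hT.facts
  have : Finite (edges T) := hT.finite_edges
  obtain ⟨p⟩ := hconn.toNonempty
  obtain ⟨ι, _, φ, hφ⟩ := hT.exists_drawing p
  choose γ U hγ hU hUne hinj hmaps using fun j => hφ.exists_arc_in (hC.isOpen j) (hC.nonempty j)
  let μ : Fin 3 → Set T → ℝ := fun j X => volume.real (U j ∩ γ j ⁻¹' X) / volume.real (U j)
  have hpos : ∀ j, 0 < volume.real (U j) := fun j =>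
    ENNReal.toReal_pos (volume_pos_of_isOpen (hU j) (hUne j)).ne' (measure_ne_top _ _)
  have hμ0 : ∀ j X, 0 ≤ μ j X := fun j X => div_nonneg measureReal_nonneg measureReal_nonneg
  have hμ1 : ∀ j X, μ j X ≤ 1 := fun j X =>
    (div_le_one (hpos j)).2 (measureReal_mono inter_subset_left)
  have hμe : ∀ j X, ¬ (X ∩ C j).Nonempty → μ j X = 0 := by
    intro j X hX
    have : U j ∩ γ j ⁻¹' X = ∅ := by
      rw [eq_empty_iff_forall_notMem]
      rintro t ⟨ht, htX⟩
      exact hX ⟨γ j t, htX, hmaps j ht⟩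
    simp [μ, this]
  have hμu : ∀ j X, C j ⊆ X → μ j X = 1 := by
    intro j X hX
    have : U j ∩ γ j ⁻¹' X = U j := inter_eq_left.2 fun t ht => hX (hmaps j ht)
    simp only [μ, this]
    exact div_self (hpos j).ne'
  let ν : Set T → ℝ := fun X => ∑ j, μ j X
  have hν : IsMonotoneContinuous ν := by
    refine ⟨fun X _ => Finset.sum_nonneg fun j _ => hμ0 j X, ?_, fun X Y _ _ hXY => ?_, ?_⟩
    · exact Finset.sum_eq_zero fun j _ => hμe j ∅ (by simp)
    · refine Finset.sum_le_sum fun j _ => ?_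
      refine div_le_div_of_nonneg_right (measureReal_mono ?_) measureReal_nonneg
      exact inter_subset_inter_right _ (preimage_mono hXY)
    · intro ψ hψ
      refine Continuous.continuousOn ?_
      refine continuous_finsetSum _ fun j _ => ?_
      exact (hψ.continuous_measure (hγ j) (hU j) (hinj j)).div_const _
  intro hEF
  obtain ⟨A, hA, hd, hcov, henvy⟩ := hEF (fun _ => ν) fun _ => hν
  have hone : ∀ k k', k ≠ k' → (∀ i j, (A k ∩ C i).Nonempty → (A k ∩ C j).Nonempty → i = j) →
      False := by
    intro k k' hkk hk
    have hfull : ∀ j, ¬ (A k ∩ C j).Nonempty → C j ⊆ A k' := by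
      intro j hj x hx
      obtain ⟨l, hl⟩ := mem_iUnion.1 (hcov.symm.subset (mem_univ x))
      have : l = k ∨ l = k' := by omega
      rcases this with rfl | rfl
      · exact (hj ⟨x, hl, hx⟩).elim
      · exact hl
    obtain ⟨j, hj⟩ : ∃ j, ∀ i, i ≠ j → ¬ (A k ∩ C i).Nonempty := by
      by_cases h : ∃ j, (A k ∩ C j).Nonempty
      · obtain ⟨j, hj⟩ := h
        exact ⟨j, fun i hij hi => hij (hk i j hi hj)⟩
      · exact ⟨0, fun i _ hi => h ⟨i, hi⟩⟩
    have hle := henvy k k'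
    simp only [ν] at hle
    -- Apart from the end `j`, the share of `k'` collects 1 from both other ends and the share of
    -- `k` collects nothing.
    rw [← Finset.add_sum_erase _ _ (Finset.mem_univ j),
      ← Finset.add_sum_erase _ (fun j => μ j (A k)) (Finset.mem_univ j)] at hle
    rw [Finset.sum_congr rfl (g := fun _ => (1 : ℝ)) (fun i hi => hμu i _ (hfull i (hj i (Finset.ne_of_mem_erase hi)))),
      Finset.sum_congr rfl (g := fun _ => (0 : ℝ)) (fun i hi => hμe i _ (hj i (Finset.ne_of_mem_erase hi)))] at hle
    simp only [Finset.sum_const, Finset.card_erase_of_mem (Finset.mem_univ j)] at hle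
    norm_num at hle
    linarith [hμ0 j (A k'), hμ1 j (A k)]
  obtain ⟨k, hk⟩ := hC.meets_one hA (hd 0 1 (by decide))
  obtain ⟨k', hk'⟩ : ∃ k' : Fin 2, k ≠ k' := ⟨k + 1, by omega⟩
  exact hone k k' hk' hk

end Measures

/-! ## Sweeping a drawing -/

section Sweeping

variable {T : Type*} {ι : Type*}

/-- A height function that is increasing and affine on the arcs. An arc may be a loop that hangs
below the lowest vertex or stands on the highest one. -/
structure Sweeping (V : Set T) (φ : ι → unitInterval → T) (a b : ι → ℝ) (h : T → ℝ) : Prop where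
  lt : ∀ i, a i < b i
  mid : ∀ i, ∀ t ∈ Ioo (0 : unitInterval) 1, h (φ i t) = a i + t * (b i - a i)
  inj : InjOn h V
  ends : ∀ i, (h (φ i 0) = a i ∧ h (φ i 1) = b i) ∨
    (φ i 0 = φ i 1 ∧ h (φ i 0) = b i ∧ ∀ x ∈ V, b i ≤ h x) ∨
    (φ i 0 = φ i 1 ∧ h (φ i 0) = a i ∧ ∀ x ∈ V, h x ≤ a i)
  down : ∀ x ∈ V, (∃ z ∈ V, h z < h x) → ∃ i, φ i 1 = x ∧ h (φ i 0) = a i ∧ h x = b i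
  up : ∀ x ∈ V, (∃ z ∈ V, h x < h z) → ∃ i, φ i 0 = x ∧ h x = a i ∧ h (φ i 1) = b i
  low_unique : ∀ i j, h (φ i 0) = b i → h (φ j 0) = b j → i = j
  high_unique : ∀ i j, h (φ i 1) = a i → h (φ j 1) = a j → i = j

variable {V : Set T} {φ : ι → unitInterval → T} {a b : ι → ℝ} {h : T → ℝ}

/-- Reversing the height requires reversing the arcs, since they are parametrized upwards. -/
theorem Sweeping.reverse (hs : Sweeping V φ a b h) :
    Sweeping V (fun i => φ i ∘ unitInterval.symm) (fun i => - b i) (fun i => - a i)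
      (fun x => - h x) where
  lt i := neg_lt_neg (hs.lt i)
  mid i t ht := by
    rw [Function.comp_apply, hs.mid i _ (symm_mem_Ioo ht), unitInterval.coe_symm_eq]
    ring
  inj x hx y hy hxy := hs.inj hx hy (neg_injective hxy)
  ends i := by
    simp only [Function.comp_apply, unitInterval.symm_zero, unitInterval.symm_one, neg_inj,
      neg_le_neg_iff]
    rcases hs.ends i with h1 | ⟨h0, h1⟩ | ⟨h0, h1⟩
    · exact Or.inl h1.symm
    · exact Or.inr (Or.inr ⟨h0.symm, h0 ▸ h1⟩)
    · exact Or.inr (Or.inl ⟨h0.symm, h0 ▸ h1⟩)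
  down x hx := by
    simp only [Function.comp_apply, unitInterval.symm_zero, unitInterval.symm_one, neg_inj,
      neg_lt_neg_iff]
    intro hz
    obtain ⟨i, h1, h2, h3⟩ := hs.up x hx hz
    exact ⟨i, h1, h3, h2⟩
  up x hx := by
    simp only [Function.comp_apply, unitInterval.symm_zero, unitInterval.symm_one, neg_inj,
      neg_lt_neg_iff]
    intro hz
    obtain ⟨i, h1, h2, h3⟩ := hs.down x hx hz
    exact ⟨i, h1, h3, h2⟩
  low_unique i j := by simpa using hs.high_unique i j
  high_unique i j := by simpa using hs.low_unique i j

theorem Sweeping.eq_low_or (hs : Sweeping V φ a b h) (i : ι) :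
    h (φ i 0) = a i ∨ (φ i 0 = φ i 1 ∧ h (φ i 0) = b i ∧ ∀ x ∈ V, b i ≤ h x) := by
  rcases hs.ends i with h1 | h1 | h1
  exacts [Or.inl h1.1, Or.inr h1, Or.inl h1.2.1]

theorem Sweeping.low_eq (hs : Sweeping V φ a b h) {i : ι} (hi : h (φ i 0) = b i) :
    φ i 0 = φ i 1 ∧ ∀ x ∈ V, b i ≤ h x := by
  rcases hs.eq_low_or i with h1 | h1
  · exact absurd (h1.symm.trans hi) (hs.lt i).ne
  · exact ⟨h1.1, h1.2.2⟩

theorem Sweeping.mid_lt (hs : Sweeping V φ a b h) (i : ι) {t : unitInterval}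
    (ht : t ∈ Ioo (0 : unitInterval) 1) : a i < h (φ i t) ∧ h (φ i t) < b i := by
  have h0 : (0 : ℝ) < t := ht.1
  have h1 : (t : ℝ) < 1 := ht.2
  have := hs.lt i
  rw [hs.mid i t ht]
  constructor <;> nlinarith

theorem Sweeping.mid_lt_mid (hs : Sweeping V φ a b h) (i : ι) {s t : unitInterval}
    (hs' : s ∈ Ioo (0 : unitInterval) 1) (ht : t ∈ Ioo (0 : unitInterval) 1) (hst : s < t) :
    h (φ i s) < h (φ i t) := by
  have hst : (s : ℝ) < t := hst
  have := hs.lt i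
  rw [hs.mid i s hs', hs.mid i t ht]
  nlinarith

variable [TopologicalSpace T]

/-- From every point, except on the low loop, one can descend to the lowest vertex. -/
theorem Sweeping.exists_descent (hs : Sweeping V φ a b h) (hd : Drawing V φ) {v : T} (hv : v ∈ V)
    (hmin : ∀ x ∈ V, h v ≤ h x) (x : T) (hx : ∀ i, h (φ i 0) = b i → x ∉ openArc φ i) :
    ∃ K, IsPreconnected K ∧ x ∈ K ∧ v ∈ K ∧ ∀ y ∈ K, y = x ∨ h y < h x := by
  have hV := finite_induction_on_height hd.finite h
    (P := fun x => ∃ K, IsPreconnected K ∧ x ∈ K ∧ v ∈ K ∧ ∀ y ∈ K, y = x ∨ h y < h x)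
    (fun x hx ih => by
      by_cases hxv : x = v
      · exact ⟨{v}, isPreconnected_singleton, hxv, rfl, fun y hy => Or.inl (Eq.trans hy hxv.symm)⟩
      have hlt : h v < h x := lt_of_le_of_ne (hmin x hx) fun h' => hxv (hs.inj hx hv h'.symm)
      obtain ⟨i, rfl, h1, h2⟩ := hs.down x hx ⟨v, hv, hlt⟩
      have hab := hs.lt i
      obtain ⟨K, hK, hxK, hvK, hlow⟩ := ih _ (hd.zero_mem i) (by rw [h1, h2]; exact hab)
      refine ⟨range (φ i) ∪ K, ?_, Or.inl ⟨1, rfl⟩, Or.inr hvK, ?_⟩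
      · exact (isPreconnected_range (hd.cont i)).union _ ⟨0, rfl⟩ hxK hK
      · rintro y (⟨t, rfl⟩ | hy)
        · rcases unitInterval_trichotomy t with rfl | rfl | ht
          · right; rw [h1, h2]; exact hab
          · exact Or.inl rfl
          · right; rw [h2]; exact (hs.mid_lt i ht).2
        · right
          rw [h2]
          rcases hlow y hy with rfl | hlt
          · rw [h1]; exact hab
          · linarith)
  rcases hd.cover x with hxV | ⟨i, t, ht, rfl⟩
  · exact hV x hxV
  · have h1 : h (φ i 0) = a i := by
      rcases hs.eq_low_or i with h1 | h1
      · exact h1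
      · exact absurd ⟨t, ht, rfl⟩ (hx i h1.2.1)
    obtain ⟨K, hK, hxK, hvK, hlow⟩ := hV _ (hd.zero_mem i)
    have hat := (hs.mid_lt i ht).1
    refine ⟨φ i '' Iic t ∪ K, ?_, Or.inl ⟨t, mem_Iic.2 le_rfl, rfl⟩, Or.inr hvK, ?_⟩
    · exact (isPreconnected_Iic.image _ (hd.cont i).continuousOn).union _
        ⟨0, mem_Iic.2 ht.1.le, rfl⟩ hxK hK
    · rintro y (⟨s, hst, rfl⟩ | hy)
      · rcases (mem_Iic.1 hst).eq_or_lt with rfl | hst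
        · exact Or.inl rfl
        · right
          rcases unitInterval_trichotomy s with rfl | rfl | hs'
          · rwa [h1]
          · exact absurd (hst.trans ht.2) (lt_irrefl _)
          · exact hs.mid_lt_mid i hs' ht hst
      · right
        rcases hlow y hy with rfl | hlt
        · rwa [h1]
        · linarith

/-- The points that are not above a low loop lie on it. -/
theorem Sweeping.mem_low (hs : Sweeping V φ a b h) (hd : Drawing V φ) {i : ι}
    (hi : h (φ i 0) = b i) {y : T} (hy : h y ≤ b i) : y ∈ range (φ i) := by
  rcases hd.cover y with hyV | ⟨j, t, ht, rfl⟩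
  · exact ⟨0, hs.inj (hd.zero_mem i) hyV (hi.trans (le_antisymm ((hs.low_eq hi).2 y hyV) hy))⟩
  · by_cases hij : i = j
    · exact ⟨t, by rw [hij]⟩
    · have h1 : h (φ j 0) = a j := (hs.eq_low_or j).resolve_right fun h1 =>
        hij (hs.low_unique i j hi h1.2.1)
      have h2 := (hs.low_eq hi).2 _ (hd.zero_mem j)
      have h3 := (hs.mid_lt j ht).1
      linarith

/-- Points of `S` descend inside `S` to the lowest vertex. Only points of the loop below that vertex
cannot descend to it: they are joined to it along the loop if it belongs to `S`, and otherwise `S`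
lies in the open loop. -/
theorem Sweeping.isPreconnected_of_lower (hs : Sweeping V φ a b h) (hd : Drawing V φ)
    {S : Set T} (hS : ∀ x ∈ S, ∀ y, h y < h x → y ∈ S) : IsPreconnected S := by
  have hKS : ∀ {y}, y ∈ S → ∀ {K : Set T}, (∀ z ∈ K, z = y ∨ h z < h y) → K ⊆ S := by
    intro y hy K hK z hz
    rcases hK z hz with rfl | hlt
    · exact hy
    · exact hS y hy z hlt
  by_cases hlow : ∃ i, h (φ i 0) = b i
  · obtain ⟨i, hi⟩ := hlow
    obtain ⟨h01, hmin⟩ := hs.low_eq hi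
    have hmin' : ∀ x ∈ V, h (φ i 0) ≤ h x := fun x hx => hi.trans_le (hmin x hx)
    have hr : ∀ z ∈ range (φ i), z = φ i 0 ∨ h z < h (φ i 0) := by
      rintro _ ⟨t, rfl⟩
      rcases unitInterval_trichotomy t with rfl | rfl | ht
      · exact Or.inl rfl
      · exact Or.inl h01.symm
      · right; rw [hi]; exact (hs.mid_lt i ht).2
    by_cases hvS : φ i 0 ∈ S
    · refine isPreconnected_of_forall (φ i 0) fun y hy => ?_
      by_cases hyi : y ∈ range (φ i)
      · exact ⟨range (φ i), hKS hvS hr, ⟨0, rfl⟩, hyi, isPreconnected_range (hd.cont i)⟩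
      · obtain ⟨K, hK, hyK, hvK, hKy⟩ := hs.exists_descent hd (hd.zero_mem i) hmin' y
          fun j hj hyj => hyi (by
            rw [hs.low_unique i j hi hj]
            exact image_subset_range _ _ hyj)
        exact ⟨K, hKS hy hKy, hvK, hyK, hK⟩
    -- Without the loop's vertex nothing above the loop can be in `S`, and on the open loop, where
    -- the height increases with the parameter, a lower set is an interval.
    · have hSi : S = φ i '' {t | t ∈ Ioo (0 : unitInterval) 1 ∧ φ i t ∈ S} := by
        ext y
        constructor
        · intro hy
          have hle : h y ≤ b i := by
            by_contra hlt
            exact hvS (hS y hy _ (by rw [hi]; exact not_le.1 hlt))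
          obtain ⟨t, rfl⟩ := hs.mem_low hd hi hle
          rcases unitInterval_trichotomy t with rfl | rfl | ht
          · exact absurd hy hvS
          · exact absurd (h01 ▸ hy) hvS
          · exact ⟨t, ⟨ht, hy⟩, rfl⟩
        · rintro ⟨t, ht, rfl⟩
          exact ht.2
      rw [hSi]
      refine IsPreconnected.image (OrdConnected.isPreconnected ⟨?_⟩) _ (hd.cont i).continuousOn
      rintro s ⟨hs1, -⟩ t ⟨ht1, ht2⟩ r ⟨hsr, hrt⟩
      have hr1 : r ∈ Ioo (0 : unitInterval) 1 := ⟨hs1.1.trans_le hsr, hrt.trans_lt ht1.2⟩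
      refine ⟨hr1, ?_⟩
      rcases hrt.eq_or_lt with rfl | hrt
      · exact ht2
      · exact hS _ ht2 _ (hs.mid_lt_mid i hr1 ht1 hrt)
  · push Not at hlow
    rcases S.eq_empty_or_nonempty with rfl | ⟨x, hx⟩
    · exact isPreconnected_empty
    have hVne : V.Nonempty := by
      rcases hd.cover x with hxV | ⟨i, -⟩
      exacts [⟨x, hxV⟩, ⟨_, hd.zero_mem i⟩]
    obtain ⟨v, hv, hmin⟩ := exists_min_image V h hd.finite hVne
    refine isPreconnected_of_forall v fun y hy => ?_
    obtain ⟨K, hK, hyK, hvK, hKy⟩ := hs.exists_descent hd hv hmin y fun j hj => absurd hj (hlow j)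
    exact ⟨K, hKS hy hKy, hvK, hyK, hK⟩

theorem Drawing.comp_symm (hd : Drawing V φ) :
    Drawing V (fun i => φ i ∘ unitInterval.symm) := by
  have := hd.flip fun _ => true
  have heq : flipArcs φ (fun _ => true) = fun i => φ i ∘ unitInterval.symm := by
    funext i
    simp [flipArcs]
  rwa [heq] at this

theorem Sweeping.isPreconnected_of_upper (hs : Sweeping V φ a b h) (hd : Drawing V φ)
    {S : Set T} (hS : ∀ x ∈ S, ∀ y, h x < h y → y ∈ S) : IsPreconnected S :=
  hs.reverse.isPreconnected_of_lower hd.comp_symm fun x hx y hxy =>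
    hS x hx y (neg_lt_neg_iff.1 hxy)

theorem Sweeping.hasBipolarOrdering (hs : Sweeping V φ a b h) (hd : Drawing V φ) :
    HasBipolarOrdering T := by
  -- Points of equal height are ordered arbitrarily, through an injection into the cardinals. Any
  -- rule will do, since a set is preconnected as soon as it contains everything strictly lower than
  -- its members.
  let F : T → ℝ ×ₗ Cardinal := fun x => toLex (h x, embeddingToCardinal x)
  have hF : Function.Injective F := by
    intro x y hxy
    have : (h x, embeddingToCardinal x) = (h y, embeddingToCardinal y) := toLex.injective hxy
    exact embeddingToCardinal.injective (Prod.ext_iff.1 this).2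
  have hlt : ∀ x y, h x < h y → F x < F y := fun x y hxy => by
    rw [Prod.Lex.lt_iff]
    exact Or.inl hxy
  refine ⟨LinearOrder.lift' F hF, fun c => ⟨?_, ?_, ?_, ?_⟩⟩
  · exact hs.isPreconnected_of_lower hd fun x (hx : F x < F c) y hy => (hlt y x hy).trans hx
  · exact hs.isPreconnected_of_lower hd fun x (hx : F x ≤ F c) y hy => (hlt y x hy).le.trans hx
  · exact hs.isPreconnected_of_upper hd fun x (hx : F c < F x) y hy => hx.trans (hlt x y hy)
  · exact hs.isPreconnected_of_upper hd fun x (hx : F c ≤ F x) y hy => hx.trans (hlt x y hy).le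

end Sweeping

/-! ## Cutting along a sweep -/

section Cutting

open Filter Topology

variable {T : Type*} [TopologicalSpace T] {V : Set T} {φ : edges T → unitInterval → T}
  {a b : edges T → ℝ} {h : T → ℝ}

theorem IsEdgeIdentification.flip (hφ : IsEdgeIdentification φ) (c : edges T → Bool) :
    IsEdgeIdentification (flipArcs φ c) := by
  refine ⟨fun e => ?_, fun e => ?_, fun e => ?_, fun e => ?_⟩ <;> unfold flipArcs <;> split_ifs
  · exact (hφ.continuous e).comp unitInterval.continuous_symm
  · exact hφ.continuous e
  · intro s hs t ht hst
    exact unitInterval.symm_bijective.injective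
      (hφ.injOn e (symm_mem_Ioo hs) (symm_mem_Ioo ht) hst)
  · exact hφ.injOn e
  · exact fun t ht => hφ.mapsTo e (symm_mem_Ioo ht)
  · exact hφ.mapsTo e
  · rw [unitInterval.symm_bijective.surjective.range_comp]
    exact hφ.range_eq e
  · exact hφ.range_eq e

theorem IsEdgeIdentification.comp_symm (hφ : IsEdgeIdentification φ) :
    IsEdgeIdentification fun e => φ e ∘ unitInterval.symm := by
  have := hφ.flip fun _ => true
  have heq : flipArcs φ (fun _ => true) = fun i => φ i ∘ unitInterval.symm := by
    funext i
    simp [flipArcs]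
  rwa [heq] at this

/-- The closed set of the points of height at most `c`; on a low loop, it starts at the vertex. -/
def lowPiece (φ : edges T → unitInterval → T) (a b : edges T → ℝ) (c : ℝ) : Set T :=
  closedPiece φ fun e => (0, (c - a e) / (b e - a e))

theorem Sweeping.mem_lowPiece (hs : Sweeping V φ a b h) {c : ℝ} {x : T} :
    x ∈ lowPiece φ a b c ↔ ∃ e t, φ e t = x ∧ a e + t * (b e - a e) ≤ c := by
  simp only [lowPiece, closedPiece, mem_iUnion, mem_image, mem_ofPred_eq]
  refine exists_congr fun e => exists_congr fun t => ?_
  rw [le_div_iff₀ (sub_pos.2 (hs.lt e)), and_comm]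
  refine and_congr_right fun _ => ⟨fun h => by linarith [h.2], fun h => ⟨t.2.1, by linarith⟩⟩

variable [T2Space T] [ConnectedSpace T] [Nontrivial T] [Finite (edges T)]

theorem Drawing.exists_eq (hd : Drawing V φ) (x : T) : ∃ e t, φ e t = x := by
  rcases hd.cover x with hx | ⟨e, t, -, h⟩
  · obtain ⟨⟨e, c⟩, hc⟩ := hd.halfEdges_nonempty hx
    exact ⟨e, _, hc⟩
  · exact ⟨e, t, h⟩

theorem Sweeping.subset_lowPiece (hs : Sweeping V φ a b h) (hd : Drawing V φ) (c : ℝ) :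
    {x | h x ≤ c} ⊆ lowPiece φ a b c := by
  intro x (hx : h x ≤ c)
  rw [hs.mem_lowPiece]
  obtain ⟨e, t, rfl⟩ := hd.exists_eq x
  have hlt := hs.lt e
  have key : φ e t = φ e 0 ∧ h (φ e t) = a e ∨ φ e t = φ e 1 ∧ h (φ e t) = b e ∨
      t ∈ Ioo (0 : unitInterval) 1 := by
    rcases unitInterval_trichotomy t with rfl | rfl | ht
    · rcases hs.ends e with h1 | h1 | h1
      · exact Or.inl ⟨rfl, h1.1⟩
      · exact Or.inr (Or.inl ⟨h1.1, h1.2.1⟩)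
      · exact Or.inl ⟨rfl, h1.2.1⟩
    · rcases hs.ends e with h1 | h1 | h1
      · exact Or.inr (Or.inl ⟨rfl, h1.2⟩)
      · exact Or.inr (Or.inl ⟨rfl, h1.1 ▸ h1.2.1⟩)
      · exact Or.inl ⟨h1.1.symm, h1.1 ▸ h1.2.1⟩
    · exact Or.inr (Or.inr ht)
  rcases key with ⟨h1, h2⟩ | ⟨h1, h2⟩ | ht
  · exact ⟨e, 0, h1.symm, by simpa using h2 ▸ hx⟩
  · exact ⟨e, 1, h1.symm, by simpa using h2 ▸ hx⟩
  · exact ⟨e, t, rfl, hs.mid e t ht ▸ hx⟩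

omit [T2Space T] [ConnectedSpace T] [Nontrivial T] [Finite (edges T)] in
theorem Sweeping.lowPiece_subset (hs : Sweeping V φ a b h) {c : ℝ}
    (hc : ∀ e, h (φ e 0) = b e → b e ≤ c) : lowPiece φ a b c ⊆ {x | h x ≤ c} := by
  intro x hx
  obtain ⟨e, t, rfl, ht⟩ := hs.mem_lowPiece.1 hx
  have hlt := hs.lt e
  change h (φ e t) ≤ c
  rcases unitInterval_trichotomy t with rfl | rfl | ht'
  · rcases hs.eq_low_or e with h1 | h1
    · rw [h1]; simpa using ht
    · rw [h1.2.1]; exact hc e h1.2.1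
  · have : b e ≤ c := by simpa using ht
    rcases hs.ends e with h1 | h1 | h1
    · rw [h1.2]; exact this
    · rw [← h1.1, h1.2.1]; exact this
    · rw [← h1.1, h1.2.1]; linarith
  · rw [hs.mid e t ht']; exact ht

theorem Sweeping.lowPiece_eq (hs : Sweeping V φ a b h) (hd : Drawing V φ) {c : ℝ}
    (hc : ∀ e, h (φ e 0) = b e → b e ≤ c) : lowPiece φ a b c = {x | h x ≤ c} :=
  (hs.lowPiece_subset hc).antisymm (hs.subset_lowPiece hd c)

omit [T2Space T] [ConnectedSpace T] [Nontrivial T] [Finite (edges T)] in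
theorem Sweeping.le_of_low (hs : Sweeping V φ a b h) (hd : Drawing V φ) {e e' : edges T}
    (he : h (φ e 0) = b e) (hne : e' ≠ e) : b e ≤ a e' := by
  have h1 : h (φ e' 0) = a e' := (hs.eq_low_or e').resolve_right fun h1 =>
    hne (hs.low_unique e' e h1.2.1 he)
  exact h1 ▸ (hs.low_eq he).2 _ (hd.zero_mem e')

omit [T2Space T] [ConnectedSpace T] [Nontrivial T] [Finite (edges T)] in
theorem isPreconnected_closedPiece_of_single (hd : Drawing V φ) {z : edges T → ℝ × ℝ}
    (e : edges T) (hz : ∀ e', e' ≠ e → ∀ t : unitInterval, ¬ ((z e').1 ≤ t ∧ (t : ℝ) ≤ (z e').2)) :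
    closedPiece φ z = φ e '' {t : unitInterval | (z e).1 ≤ (t : ℝ) ∧ (t : ℝ) ≤ (z e).2} ∧
      IsPreconnected (closedPiece φ z) := by
  have heq : closedPiece φ z =
      φ e '' {t : unitInterval | (z e).1 ≤ (t : ℝ) ∧ (t : ℝ) ≤ (z e).2} := by
    apply Subset.antisymm
    · refine iUnion_subset fun e' => ?_
      by_cases he : e' = e
      · rw [he]
      · rintro _ ⟨t, ht, -⟩
        exact absurd ht (hz e' he t)
    · exact subset_iUnion (fun e => φ e '' {t : unitInterval | (z e).1 ≤ (t : ℝ) ∧ (t : ℝ) ≤ (z e).2}) e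
  refine ⟨heq, heq ▸ IsPreconnected.image (OrdConnected.isPreconnected ⟨?_⟩) _
    (hd.cont e).continuousOn⟩
  rintro s ⟨hs1, -⟩ t ⟨-, ht2⟩ r ⟨hsr, hrt⟩
  exact ⟨hs1.trans hsr, le_trans (Subtype.coe_le_coe.2 hrt) ht2⟩

/-- From the vertex of the low loop upwards the piece is an honest lower set. Below that height it
is a stretch of the loop alone, enlarged by the vertex from which the loop is parametrized. -/
theorem Sweeping.isPreconnected_lowPiece (hs : Sweeping V φ a b h) (hd : Drawing V φ) (c : ℝ) :
    IsPreconnected (lowPiece φ a b c) := by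
  by_cases hc : ∀ e, h (φ e 0) = b e → b e ≤ c
  · rw [hs.lowPiece_eq hd hc]
    exact hs.isPreconnected_of_lower hd fun x (hx : h x ≤ c) y hy => hy.le.trans hx
  · push Not at hc
    obtain ⟨e, he, hc⟩ := hc
    refine (isPreconnected_closedPiece_of_single hd e fun e' he' t ht => ?_).2
    have h1 := hs.le_of_low hd he he'
    have h2 := ht.1.trans ht.2
    simp only at h2
    rw [le_div_iff₀ (sub_pos.2 (hs.lt e'))] at h2
    linarith

omit [T2Space T] [ConnectedSpace T] [Nontrivial T] [Finite (edges T)] in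
theorem continuous_lowParameters (a b : edges T → ℝ) :
    Continuous fun (c : ℝ) (e : edges T) => ((0 : ℝ), (c - a e) / (b e - a e)) := by
  fun_prop

theorem Sweeping.continuous_valuation (hs : Sweeping V φ a b h) (hd : Drawing V φ)
    (hφ : IsEdgeIdentification φ) {ν : Set T → ℝ} (hν : IsMonotoneContinuous ν) :
    Continuous fun c => ν (lowPiece φ a b c) :=
  (hν.continuousOn φ hφ).comp_continuous (continuous_lowParameters a b)
    fun c => hs.isPreconnected_lowPiece hd c

/-- The value of a lower set depends only on its height. -/
theorem Sweeping.valuation_eq (hs : Sweeping V φ a b h) (hd : Drawing V φ)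
    (hφ : IsEdgeIdentification φ) {ν : Set T → ℝ} (hν : IsMonotoneContinuous ν) {c : ℝ}
    {S : Set T} (hS1 : {x | h x < c} ⊆ S) (hS2 : S ⊆ {x | h x ≤ c}) :
    ν S = ν (lowPiece φ a b c) := by
  have hS : IsPreconnected S := hs.isPreconnected_of_lower hd fun x hx y hy =>
    hS1 (hy.trans_le (hS2 hx))
  refine le_antisymm (hν.mono _ _ hS (hs.isPreconnected_lowPiece hd c)
    (hS2.trans (hs.subset_lowPiece hd c))) ?_
  by_cases hc : ∀ e, h (φ e 0) = b e → b e < c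
  -- Strictly above the low loop, the pieces of heights `c' < c` lie in `S`, and their values tend
  -- to the value of the piece of height `c`.
  · have h1 : ∀ᶠ c' in 𝓝[<] c, ∀ e, h (φ e 0) = b e → b e ≤ c' := by
      apply eventually_nhdsWithin_of_eventually_nhds
      rw [eventually_all]
      intro e
      by_cases he : h (φ e 0) = b e
      · filter_upwards [lt_mem_nhds (hc e he)] with c' hc' _ using hc'.le
      · exact Eventually.of_forall fun _ h => absurd h he
    refine le_of_tendsto ((hs.continuous_valuation hd hφ hν).tendsto c |>.mono_left
      nhdsWithin_le_nhds : Tendsto _ (𝓝[<] c) _) ?_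
    filter_upwards [h1, self_mem_nhdsWithin] with c' hc' hlt
    refine hν.mono _ _ (hs.isPreconnected_lowPiece hd c') hS ?_
    exact (hs.lowPiece_subset hc').trans fun x (hx : h x ≤ c') => hS1 (hx.trans_lt hlt)
  · push Not at hc
    obtain ⟨e, he, hc⟩ := hc
    -- At or below the top of the low loop, lowering the height is not enough, because the piece
    -- starts at the vertex, which is higher. Trimming both ends by `ε` gives pieces inside `S` that
    -- still converge; on every other edge the trimmed interval is empty.
    let z : ℝ → edges T → ℝ × ℝ := fun ε e => (ε, (c - a e) / (b e - a e) - ε)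
    have hz0 : z 0 = fun e => (0, (c - a e) / (b e - a e)) := by
      funext e
      simp [z]
    have hz : Continuous z := by fun_prop
    have hsingle : ∀ ε, 0 < ε → closedPiece φ (z ε) =
        φ e '' {t : unitInterval | ε ≤ (t : ℝ) ∧ (t : ℝ) ≤ (c - a e) / (b e - a e) - ε} ∧
        IsPreconnected (closedPiece φ (z ε)) := by
      intro ε hε
      refine isPreconnected_closedPiece_of_single hd e fun e' he' t ht => ?_
      have h1 := hs.le_of_low hd he he'
      have h2 : (c - a e') / (b e' - a e') ≤ 0 :=
        div_nonpos_of_nonpos_of_nonneg (by linarith) (sub_pos.2 (hs.lt e')).le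
      have h3 := ht.1.trans ht.2
      simp only [z] at h3
      linarith
    have hlim : Tendsto (fun ε => ν (closedPiece φ (z ε))) (𝓝[>] 0)
        (𝓝 (ν (closedPiece φ (z 0)))) := by
      have h0 : IsPreconnected (closedPiece φ (z 0)) := by
        rw [hz0]
        exact hs.isPreconnected_lowPiece hd c
      refine ((hν.continuousOn φ hφ) (z 0) h0).tendsto.comp ?_
      rw [tendsto_nhdsWithin_iff]
      refine ⟨hz.tendsto 0 |>.mono_left nhdsWithin_le_nhds, ?_⟩
      filter_upwards [self_mem_nhdsWithin] with ε hε using (hsingle ε hε).2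
    rw [hz0] at hlim
    refine le_of_tendsto hlim ?_
    filter_upwards [self_mem_nhdsWithin] with ε hε
    refine hν.mono _ _ (hsingle ε hε).2 hS ?_
    rw [(hsingle ε hε).1]
    rintro _ ⟨t, ⟨ht1, ht2⟩, rfl⟩
    have hε : 0 < ε := hε
    have hpos := sub_pos.2 (hs.lt e)
    have h4 : (c - a e) / (b e - a e) ≤ 1 := by rw [div_le_one hpos]; linarith
    have h5 : (t : ℝ) < (c - a e) / (b e - a e) := by linarith
    have ht : t ∈ Ioo (0 : unitInterval) 1 := ⟨hε.trans_le ht1, h5.trans_le h4⟩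
    apply hS1
    change h (φ e t) < c
    rw [hs.mid e t ht]
    rw [lt_div_iff₀ hpos] at h5
    linarith

theorem Sweeping.exists_bounds (hs : Sweeping V φ a b h) (hd : Drawing V φ) :
    ∃ m M, ∀ x, m < h x ∧ h x < M := by
  obtain ⟨m, hm⟩ := (finite_range a).bddBelow
  obtain ⟨M, hM⟩ := (finite_range b).bddAbove
  refine ⟨m - 1, M + 1, fun x => ?_⟩
  obtain ⟨e, t, rfl⟩ := hd.exists_eq x
  have h1 := hm ⟨e, rfl⟩
  have h2 := hM ⟨e, rfl⟩
  have h3 := hs.lt e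
  have : a e ≤ h (φ e t) ∧ h (φ e t) ≤ b e := by
    rcases unitInterval_trichotomy t with rfl | rfl | ht
    · rcases hs.ends e with h | ⟨-, h, -⟩ | ⟨-, h, -⟩ <;> constructor <;> linarith
    · rcases hs.ends e with h | ⟨h', h, -⟩ | ⟨h', h, -⟩ <;> (try rw [h'] at h) <;>
        constructor <;> linarith
    · exact ⟨(hs.mid_lt e ht).1.le, (hs.mid_lt e ht).2.le⟩
  constructor <;> linarith

/-- Cut and choose with a moving height: lower and upper sets have values that depend continuously
on the height, so some height `c` makes the two parts equal for agent 0, and agent 1 takes the part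
of larger value. -/
theorem Sweeping.guaranteesConnectedEF (hs : Sweeping V φ a b h) (hd : Drawing V φ)
    (hφ : IsEdgeIdentification φ) : GuaranteesConnectedEF T 2 := by
  intro ν hν
  obtain ⟨m, M, hmM⟩ := hs.exists_bounds hd
  have hlow : ∀ (k : Fin 2) c, ν k {x | h x < c} = ν k (lowPiece φ a b c) := fun k c =>
    hs.valuation_eq hd hφ (hν k) Subset.rfl fun x (hx : h x < c) => hx.le
  -- The upper sets are lower sets of the reversed height, so the same continuity applies.
  have hup : ∀ (k : Fin 2) c, ν k {x | c ≤ h x} = ν k (lowPiece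
      (fun e => φ e ∘ unitInterval.symm) (fun e => - b e) (fun e => - a e) (- c)) := fun k c =>
    hs.reverse.valuation_eq hd.comp_symm hφ.comp_symm (hν k)
      (fun x (hx : - h x < - c) => (neg_lt_neg_iff.1 hx).le) fun x (hx : c ≤ h x) => neg_le_neg hx
  have hcl : Continuous fun c => ν 0 {x | h x < c} :=
    (hs.continuous_valuation hd hφ (hν 0)).congr fun c => (hlow 0 c).symm
  have hcu : Continuous fun c => ν 0 {x | c ≤ h x} :=
    ((hs.reverse.continuous_valuation hd.comp_symm hφ.comp_symm (hν 0)).comp continuous_neg).congr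
      fun c => (hup 0 c).symm
  have hpu : IsPreconnected (univ : Set T) := isPreconnected_univ
  obtain ⟨c, hc⟩ : ∃ c, ν 0 {x | h x < c} = ν 0 {x | c ≤ h x} := by
    apply intermediate_value_univ₂ hcl hcu (a := m) (b := M)
    · have h1 : {x | h x < m} = ∅ := eq_empty_iff_forall_notMem.2 fun x hx =>
        lt_asymm hx (hmM x).1
      have h2 : {x | m ≤ h x} = univ := eq_univ_of_forall fun x => (hmM x).1.le
      rw [h1, h2, (hν 0).empty]
      exact (hν 0).nonneg _ hpu
    · have h1 : {x | h x < M} = univ := eq_univ_of_forall fun x => (hmM x).2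
      have h2 : {x | M ≤ h x} = ∅ := eq_empty_iff_forall_notMem.2 fun x hx =>
        not_lt.2 hx (hmM x).2
      rw [h1, h2, (hν 0).empty]
      exact (hν 0).nonneg _ hpu
  have hA : IsPreconnected {x | h x < c} :=
    hs.isPreconnected_of_lower hd fun x (hx : h x < c) y hy => hy.trans hx
  have hB : IsPreconnected {x | c ≤ h x} :=
    hs.isPreconnected_of_upper hd fun x (hx : c ≤ h x) y hy => hx.trans hy.le
  have hdisj : Disjoint {x | h x < c} {x | c ≤ h x} :=
    Set.disjoint_left.2 fun x (hx : h x < c) (hx' : c ≤ h x) => not_le_of_gt hx hx'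
  have hcov : {x | h x < c} ∪ {x | c ≤ h x} = univ :=
    eq_univ_of_forall fun x => lt_or_ge (h x) c
  rcases le_total (ν 1 {x | h x < c}) (ν 1 {x | c ≤ h x}) with hle | hle
  · refine ⟨![{x | h x < c}, {x | c ≤ h x}], ?_, ?_, ?_, ?_⟩
    · simpa [Fin.forall_fin_two] using ⟨hA, hB⟩
    · simpa [Fin.forall_fin_two] using ⟨hdisj, hdisj.symm⟩
    · rw [← hcov]; ext x; simp [Fin.exists_fin_two]
    · simpa [Fin.forall_fin_two, hc] using hle
  · refine ⟨![{x | c ≤ h x}, {x | h x < c}], ?_, ?_, ?_, ?_⟩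
    · simpa [Fin.forall_fin_two] using ⟨hB, hA⟩
    · simpa [Fin.forall_fin_two] using ⟨hdisj.symm, hdisj⟩
    · rw [← hcov]; ext x; simp [Fin.exists_fin_two, or_comm]
    · simpa [Fin.forall_fin_two, hc] using hle

end Cutting

/-! ## Numberings as height functions -/

section Numbered

open scoped Graph

variable {α β : Type*}

/-- A height function without local minima except the lowest vertex and without local maxima
except the highest vertex. -/
structure Numbered (H : Graph α β) (g : α → ℝ) : Prop where
  inj : InjOn g V(H)
  down : ∀ x ∈ V(H), (∃ z ∈ V(H), g z < g x) → ∃ y, H.Adj y x ∧ g y < g x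
  up : ∀ x ∈ V(H), (∃ z ∈ V(H), g x < g z) → ∃ y, H.Adj x y ∧ g x < g y

theorem Numbered.neg {H : Graph α β} {g : α → ℝ} (h : Numbered H g) :
    Numbered H (fun x => - g x) where
  inj x hx y hy hxy := h.inj hx hy (neg_injective hxy)
  down x hx := by
    simp only [neg_lt_neg_iff]
    intro hz
    obtain ⟨y, hy, hlt⟩ := h.up x hx hz
    exact ⟨y, hy.symm, hlt⟩
  up x hx := by
    simp only [neg_lt_neg_iff]
    intro hz
    obtain ⟨y, hy, hlt⟩ := h.down x hx hz
    exact ⟨y, hy.symm, hlt⟩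

theorem HasBipolarNumbering.exists_numbered {H : Graph α β} (h : HasBipolarNumbering H) :
    V(H).Finite ∧ ∃ g, Numbered H g := by
  classical
  obtain ⟨k, v, hinj, hr, hdown, hup⟩ := h
  let g : α → ℝ := fun x => if hx : ∃ i, v i = x then ((hx.choose : ℕ) : ℝ) else 0
  have hg : ∀ i, g (v i) = ((i : ℕ) : ℝ) := by
    intro i
    have hx : ∃ j, v j = v i := ⟨i, rfl⟩
    simp only [g]
    rw [dif_pos hx, hinj hx.choose_spec]
  refine ⟨hr ▸ finite_range v, g, ?_, ?_, ?_⟩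
  · rw [← hr]
    rintro _ ⟨i, rfl⟩ _ ⟨j, rfl⟩ hij
    rw [hg, hg, Nat.cast_inj] at hij
    rw [Fin.ext hij]
  · rw [← hr]
    rintro _ ⟨j, rfl⟩ ⟨_, ⟨i, rfl⟩, hlt⟩
    rw [hg, hg, Nat.cast_lt] at hlt
    obtain ⟨i', hi', hadj⟩ := hdown j (by omega)
    exact ⟨v i', hadj, by rw [hg, hg, Nat.cast_lt]; exact hi'⟩
  · rw [← hr]
    rintro _ ⟨j, rfl⟩ ⟨_, ⟨i, rfl⟩, hlt⟩
    rw [hg, hg, Nat.cast_lt] at hlt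
    obtain ⟨i', hi', hadj⟩ := hup j (by omega)
    exact ⟨v i', hadj, by rw [hg, hg, Nat.cast_lt]; exact hi'⟩

theorem IsLink.inc_set {H : Graph α β} {e : β} {x y : α} (h : H.IsLink e x y) :
    {z | H.Inc e z} = {x, y} := by
  ext z
  constructor
  · intro hz
    exact Graph.Inc.eq_or_eq_of_isLink hz h
  · rintro (rfl | rfl)
    exacts [h.inc_left, h.inc_right]

/-- Without loops each edge spans the interval between the heights of its two ends, and the
exceptional cases of a sweep do not occur. -/
theorem Numbered.sweep {H : Graph α β} {g : α → ℝ} (h : Numbered H g)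
    (hloop : ∀ e x, ¬ H.IsLink e x x) :
    Sweep H g (fun e => sInf (g '' {z | H.Inc e z})) (fun e => sSup (g '' {z | H.Inc e z})) := by
  have ha : ∀ {e x y}, H.IsLink e x y → g x < g y →
      sInf (g '' {z | H.Inc e z}) = g x ∧ sSup (g '' {z | H.Inc e z}) = g y := by
    intro e x y hl hlt
    rw [IsLink.inc_set hl, image_pair, csInf_pair, csSup_pair]
    exact ⟨min_eq_left hlt.le, max_eq_right hlt.le⟩
  have hex : ∀ e ∈ E(H), ∃ x y, H.IsLink e x y ∧ g x < g y := by
    intro e he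
    obtain ⟨x, y, hl⟩ := H.exists_isLink_of_mem_edgeSet he
    rcases lt_trichotomy (g x) (g y) with hlt | heq | hlt
    · exact ⟨x, y, hl, hlt⟩
    · rw [h.inj hl.left_mem hl.right_mem heq] at hl
      exact absurd hl (hloop e y)
    · exact ⟨y, x, hl.symm, hlt⟩
  refine ⟨h.inj, fun e he => ?_, fun e he => ?_, fun x hx hz => ?_, fun x hx hz => ?_,
    fun e he _ _ hlow _ => ?_, fun e he _ _ hhigh _ => ?_⟩
  · obtain ⟨x, y, hl, hlt⟩ := hex e he
    rw [(ha hl hlt).1, (ha hl hlt).2]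
    exact hlt
  · obtain ⟨x, y, hl, hlt⟩ := hex e he
    exact ⟨x, y, hl, Or.inl ⟨(ha hl hlt).1.symm, (ha hl hlt).2.symm⟩⟩
  · obtain ⟨y, ⟨e, hl⟩, hlt⟩ := h.down x hx hz
    exact ⟨e, y, hl, (ha hl hlt).1.symm, (ha hl hlt).2.symm⟩
  · obtain ⟨y, ⟨e, hl⟩, hlt⟩ := h.up x hx hz
    exact ⟨e, y, hl, (ha hl hlt).1.symm, (ha hl hlt).2.symm⟩
  · obtain ⟨x, y, hl, hlt⟩ := hex e he
    exact absurd (hlow x hl.left_mem) (by simp only [(ha hl hlt).1, lt_irrefl, not_false_eq_true])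
  · obtain ⟨x, y, hl, hlt⟩ := hex e he
    exact absurd (hhigh y hl.right_mem) (by simp only [(ha hl hlt).2, lt_irrefl, not_false_eq_true])

/-! ### Numberings exclude tridents -/

theorem exists_nodup_walk {q : α → α → Prop} {Q : α → Prop} (hq : ∀ a b, q a b → Q a) {w z : α}
    (h : Relation.ReflTransGen q w z) (hz : Q z) :
    ∃ l : List α, l.Nodup ∧ l.IsChain q ∧ l.head? = some w ∧ l.getLast? = some z ∧
      ∀ x ∈ l, Q x := by
  induction h using Relation.ReflTransGen.head_induction_on with
  | refl => exact ⟨[z], by simp, by simp, rfl, rfl, by simpa using hz⟩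
  | @head a b hab _ ih =>
    obtain ⟨l, hn, hch, hhd, hlast, hP⟩ := ih
    by_cases ha : a ∈ l
    · obtain ⟨X, Y, rfl⟩ := List.append_of_mem ha
      exact ⟨a :: Y, (List.nodup_append.1 hn).2.1, hch.right_of_append, rfl,
        by simpa using hlast, fun x hx => hP x (by simp [List.mem_cons.1 hx])⟩
    · refine ⟨a :: l, List.nodup_cons.2 ⟨ha, hn⟩, ?_, rfl, ?_, ?_⟩
      · rw [List.isChain_cons]
        refine ⟨fun y hy => ?_, hch⟩
        rw [hhd] at hy
        simp only [Option.mem_def, Option.some.injEq] at hy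
        exact hy ▸ hab
      · cases l with
        | nil => simp at hlast
        | cons d l => simpa using hlast
      · intro x hx
        rcases List.mem_cons.1 hx with rfl | hx
        exacts [hq _ _ hab, hP x hx]

/-- Two vertices are joined below the higher one. -/
theorem Numbered.exists_low_walk {H : Graph α β} {g : α → ℝ} (h : Numbered H g)
    (hV : V(H).Finite) {x y : α} (hx : x ∈ V(H)) (hy : y ∈ V(H)) (hxy : g x < g y) :
    ∃ l : List α, l.Nodup ∧ l.IsChain H.Adj ∧ l.head? = some y ∧ l.getLast? = some x ∧
      ∀ z ∈ l, z = y ∨ g z < g y := by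
  obtain ⟨v, hv, hmin⟩ := exists_min_image V(H) g hV ⟨x, hx⟩
  -- Adjacency among vertices not higher than `y`. Both `x` and `y` descend to the lowest vertex
  -- within this region.
  let q : α → α → Prop := fun a b => H.Adj a b ∧ g a ≤ g y ∧ g b ≤ g y
  have key := finite_induction_on_height hV g
    (P := fun x => g x ≤ g y → Relation.ReflTransGen q x v) fun x hx ih hle => by
      by_cases hxv : x = v
      · rw [hxv]
      have hlt : g v < g x := lt_of_le_of_ne (hmin x hx) fun h' => hxv (h.inj hx hv h'.symm)
      obtain ⟨z, hz, hzx⟩ := h.down x hx ⟨v, hv, hlt⟩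
      exact .head ⟨hz.symm, hle, hzx.le.trans hle⟩ (ih z hz.left_mem hzx (hzx.le.trans hle))
  have hsymm : ∀ {a b}, Relation.ReflTransGen q a b → Relation.ReflTransGen q b a := by
    intro a b hab
    exact Relation.ReflTransGen.mono (fun c d hcd => ⟨hcd.1.symm, hcd.2.2, hcd.2.1⟩) _ _ hab.swap
  obtain ⟨l, hn, hch, hhd, hlast, hQ⟩ := exists_nodup_walk (Q := fun z => z = y ∨ g z < g y)
    (fun a b hab => by
      rcases hab.2.1.eq_or_lt with heq | hlt
      · exact Or.inl (h.inj hab.1.left_mem hy heq)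
      · exact Or.inr hlt)
    ((key y hy le_rfl).trans (hsymm (key x hx hxy.le))) (Or.inr hxy)
  exact ⟨l, hn, hch.imp fun _ _ hab => hab.1, hhd, hlast, hQ⟩

/-- Take in each arm a vertex off the contact vertex, and let p be the one of middle height. It is
joined to the lowest of the three by a path below p and to the highest by a path above p. Both paths
pass through the contact vertex of its arm, which would be at once lower and higher than p. -/
theorem Numbered.not_hasTrident {H : Graph α β} {g : α → ℝ} (h : Numbered H g)
    (hV : V(H).Finite) : ¬ HasTrident H := by
  rintro ⟨C, P, s, -, -, hP, hs, hnt, hpath, -⟩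
  have hex : ∀ i, ∃ p ∈ V(P i), p ≠ s i := fun i => (hnt i).exists_ne (s i)
  choose p hp hps using hex
  have hpV : ∀ i, p i ∈ V(H) := fun i => (hP i).1.vertexSet_mono (hp i)
  have hinj : Function.Injective (g ∘ p) := by
    intro i j hij
    by_contra hne
    have heq := h.inj (hpV i) (hpV j) hij
    have := (hpath i j hne [p i] (by simp) (by simp) ⟨p i, hp i, rfl⟩
      ⟨p j, hp j, by simp [heq]⟩).1
    exact hps i (List.mem_singleton.1 this).symm
  have hmono : StrictMono ((g ∘ p) ∘ Tuple.sort (g ∘ p)) :=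
    (Tuple.monotone_sort (g ∘ p)).strictMono_of_injective (hinj.comp (Equiv.injective _))
  set σ := Tuple.sort (g ∘ p)
  have h01 : g (p (σ 0)) < g (p (σ 1)) := hmono (by decide)
  have h12 : g (p (σ 1)) < g (p (σ 2)) := hmono (by decide)
  obtain ⟨l, hn, hch, hhd, hlast, hl⟩ := h.exists_low_walk hV (hpV _) (hpV _) h01
  obtain ⟨l', hn', hch', hhd', hlast', hl'⟩ := h.neg.exists_low_walk hV (hpV _) (hpV _)
    (neg_lt_neg h12)
  have h1 := (hpath (σ 1) (σ 0) (σ.injective.ne (by decide)) l hch hn ⟨_, hp _, hhd⟩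
    ⟨_, hp _, hlast⟩).1
  have h2 := (hpath (σ 1) (σ 2) (σ.injective.ne (by decide)) l' hch' hn' ⟨_, hp _, hhd'⟩
    ⟨_, hp _, hlast'⟩).1
  rcases hl _ h1 with h3 | h3
  · exact hps _ h3.symm
  rcases hl' _ h2 with h4 | h4
  · exact hps _ h4.symm
  · linarith

end Numbered

/-! ## Heights on the subdivided multigraph -/

section Subdivision

open scoped Graph

variable {α β : Type*} {G : Graph α β}

theorem subdivideOnce_adj {a b : α ⊕ β} : (subdivideOnce G).Adj a b ↔
    (∃ x e, G.Inc e x ∧ a = Sum.inl x ∧ b = Sum.inr e) ∨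
      (∃ x e, G.Inc e x ∧ a = Sum.inr e ∧ b = Sum.inl x) := by
  constructor
  · rintro ⟨⟨e, x, c⟩, hh, hab⟩
    have hinc : G.Inc e x := hh.elim And.right fun hl => Graph.IsLoopAt.inc hl.2
    rcases hab with hab | hab
    · exact Or.inl ⟨x, e, hinc, hab⟩
    · exact Or.inr ⟨x, e, hinc, hab⟩
  · rintro (⟨x, e, hinc, rfl, rfl⟩ | ⟨x, e, hinc, rfl, rfl⟩)
    · exact ⟨(e, x, false), Or.inl ⟨rfl, hinc⟩, Or.inl ⟨rfl, rfl⟩⟩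
    · exact ⟨(e, x, false), Or.inl ⟨rfl, hinc⟩, Or.inr ⟨rfl, rfl⟩⟩

theorem inl_mem_subdivideOnce {x : α} : Sum.inl x ∈ V(subdivideOnce G) ↔ x ∈ V(G) := by
  change Sum.inl x ∈ Sum.inl '' V(G) ∪ Sum.inr '' E(G) ↔ _
  simp

theorem inr_mem_subdivideOnce {e : β} : Sum.inr e ∈ V(subdivideOnce G) ↔ e ∈ E(G) := by
  change Sum.inr e ∈ Sum.inl '' V(G) ∪ Sum.inr '' E(G) ↔ _
  simp

theorem subdivideOnce_not_loop (h : β × α × Bool) (a : α ⊕ β) :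
    ¬ (subdivideOnce G).IsLink h a a := by
  rintro ⟨-, ⟨h1, h2⟩ | ⟨h1, h2⟩⟩ <;> exact absurd (h1.symm.trans h2) (by simp)

variable {g : α ⊕ β → ℝ}

/-- A subdivision vertex below all its neighbours is the lowest vertex. -/
theorem Numbered.le_of_low (h : Numbered (subdivideOnce G) g) {e : β} (he : e ∈ E(G))
    (hlow : ∀ x, G.Inc e x → g (Sum.inr e) < g (Sum.inl x)) :
    ∀ w ∈ V(subdivideOnce G), g (Sum.inr e) ≤ g w := by
  intro w hw
  by_contra hlt
  obtain ⟨y, hy, hlt'⟩ := h.down _ (inr_mem_subdivideOnce.2 he) ⟨w, hw, not_le.1 hlt⟩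
  rcases subdivideOnce_adj.1 hy with ⟨x, e', hinc, rfl, heq⟩ | ⟨x, e', -, -, heq⟩
  · rw [← Sum.inr_injective heq] at hinc
    exact lt_asymm hlt' (hlow x hinc)
  · simp at heq

/-- Descending from any other vertex ends at the subdivision vertex of `e`, and the last vertex
before it is an end of `e`. -/
theorem Numbered.le_of_low_of_ne (h : Numbered (subdivideOnce G) g)
    (hV : V(subdivideOnce G).Finite) {e : β} (he : e ∈ E(G))
    (hlow : ∀ x, G.Inc e x → g (Sum.inr e) < g (Sum.inl x)) {c : ℝ}
    (hc : ∀ x, G.Inc e x → c ≤ g (Sum.inl x)) :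
    ∀ w ∈ V(subdivideOnce G), w ≠ Sum.inr e → c ≤ g w := by
  have heV := inr_mem_subdivideOnce.2 he
  refine finite_induction_on_height hV g fun w hw ih hne => ?_
  have hlt : g (Sum.inr e) < g w := lt_of_le_of_ne (h.le_of_low he hlow w hw) fun h' =>
    hne (h.inj heV hw h').symm
  obtain ⟨y, hy, hyw⟩ := h.down w hw ⟨_, heV, hlt⟩
  by_cases hye : y = Sum.inr e
  · subst hye
    rcases subdivideOnce_adj.1 hy with ⟨x, e', -, heq, -⟩ | ⟨x, e', hinc, heq, rfl⟩
    · simp at heq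
    · rw [← Sum.inr_injective heq] at hinc
      exact hc x hinc
  · exact (ih y hy.left_mem hyw hye).trans hyw.le

/-- Every vertex except the lowest one is joined by an edge to a lower one. -/
theorem Numbered.exists_down (h : Numbered (subdivideOnce G) g) (hV : V(subdivideOnce G).Finite)
    {x : α} (hx : x ∈ V(G)) (hz : ∃ z ∈ V(G), g (Sum.inl z) < g (Sum.inl x)) :
    ∃ e y, G.IsLink e y x ∧ g (Sum.inl y) < g (Sum.inl x) := by
  obtain ⟨z, hz, hzx⟩ := hz
  obtain ⟨y, hy, hyx⟩ := h.down _ (inl_mem_subdivideOnce.2 hx) ⟨_, inl_mem_subdivideOnce.2 hz, hzx⟩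
  rcases subdivideOnce_adj.1 hy with ⟨x', e, -, -, heq⟩ | ⟨x', e, hinc, rfl, heq⟩
  · simp at heq
  obtain rfl := Sum.inl_injective heq
  -- If `e` led to nothing lower than `x`, its subdivision vertex would lie below both ends and thus
  -- be the lowest vertex; everything else would then be at least as high as `x`.
  by_contra hcon
  push Not at hcon
  have hge : ∀ u, G.Inc e u → g (Sum.inl x) ≤ g (Sum.inl u) := by
    intro u hu
    by_cases hux : u = x
    · rw [hux]
    · obtain ⟨w, hw⟩ := hinc
      rcases hu.eq_or_eq_of_isLink hw with rfl | rfl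
      · exact absurd rfl hux
      · exact hcon e u hw.symm
  exact not_le.2 hzx (h.le_of_low_of_ne hV hinc.edge_mem (fun u hu => hyx.trans_le (hge u hu)) hge _
    (inl_mem_subdivideOnce.2 hz) (by simp))

/-- The heights of the ends of an edge; for a loop, the height of the subdivision vertex counts
as a second end. -/
def endHeights (G : Graph α β) (g : α ⊕ β → ℝ) (e : β) : Set ℝ :=
  {r | (∃ x, G.Inc e x ∧ g (Sum.inl x) = r) ∨ ((∃ x, G.IsLink e x x) ∧ g (Sum.inr e) = r)}

theorem endHeights_of_ne {e : β} {x y : α} (hl : G.IsLink e x y) (hne : x ≠ y) :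
    endHeights G g e = {g (Sum.inl x), g (Sum.inl y)} := by
  ext r
  constructor
  · rintro (⟨z, hz, rfl⟩ | ⟨⟨z, hz⟩, -⟩)
    · rcases hz.eq_or_eq_of_isLink hl with rfl | rfl <;> simp
    · rcases hz.eq_and_eq_or_eq_and_eq hl with ⟨h1, h2⟩ | ⟨h1, h2⟩
      · exact absurd (h1.symm.trans h2) hne
      · exact absurd (h2.symm.trans h1) hne
  · rintro (rfl | rfl)
    · exact Or.inl ⟨x, hl.inc_left, rfl⟩
    · exact Or.inl ⟨y, hl.inc_right, rfl⟩

theorem endHeights_of_loop {e : β} {x : α} (hl : G.IsLink e x x) :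
    endHeights G g e = {g (Sum.inl x), g (Sum.inr e)} := by
  ext r
  constructor
  · rintro (⟨z, hz, rfl⟩ | ⟨-, rfl⟩)
    · rcases hz.eq_or_eq_of_isLink hl with rfl | rfl <;> simp
    · simp
  · rintro (rfl | rfl)
    · exact Or.inl ⟨x, hl.inc_left, rfl⟩
    · exact Or.inr ⟨⟨x, hl⟩, rfl⟩

/-- A loop gets the interval between its vertex and its subdivision vertex. The latter has only one
neighbour, so it is the lowest or the highest vertex of the subdivision; this forces the loop to
hang from the lowest or stand on the highest vertex and leaves room for one loop of each kind. -/
theorem Numbered.sweep_subdivideOnce (h : Numbered (subdivideOnce G) g)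
    (hV : V(subdivideOnce G).Finite) :
    Sweep G (fun x => g (Sum.inl x)) (fun e => sInf (endHeights G g e))
      (fun e => sSup (endHeights G g e)) := by
  have hinj : InjOn (fun x => g (Sum.inl x)) V(G) := fun x hx y hy hxy =>
    Sum.inl_injective (h.inj (inl_mem_subdivideOnce.2 hx) (inl_mem_subdivideOnce.2 hy) hxy)
  have hlt : ∀ {e x y}, G.IsLink e x y → g (Sum.inl x) < g (Sum.inl y) →
      sInf (endHeights G g e) = g (Sum.inl x) ∧ sSup (endHeights G g e) = g (Sum.inl y) := by
    intro e x y hl hxy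
    rw [endHeights_of_ne hl fun h' => hxy.ne (h' ▸ rfl), csInf_pair, csSup_pair]
    exact ⟨min_eq_left hxy.le, max_eq_right hxy.le⟩
  have hloop : ∀ {e x}, G.IsLink e x x →
      (g (Sum.inr e) < g (Sum.inl x) ∧ sInf (endHeights G g e) = g (Sum.inr e) ∧
        sSup (endHeights G g e) = g (Sum.inl x)) ∨
      (g (Sum.inl x) < g (Sum.inr e) ∧ sInf (endHeights G g e) = g (Sum.inl x) ∧
        sSup (endHeights G g e) = g (Sum.inr e)) := by
    intro e x hl
    rw [endHeights_of_loop hl, csInf_pair, csSup_pair]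
    have hne : g (Sum.inr e) ≠ g (Sum.inl x) := fun h' => by
      have := h.inj (inr_mem_subdivideOnce.2 hl.edge_mem) (inl_mem_subdivideOnce.2 hl.left_mem) h'
      simp at this
    rcases lt_or_gt_of_ne hne with h1 | h1
    · exact Or.inl ⟨h1, min_eq_right h1.le, max_eq_left h1.le⟩
    · exact Or.inr ⟨h1, min_eq_left h1.le, max_eq_right h1.le⟩
  have hinc : ∀ {e x y}, G.IsLink e x x → G.Inc e y → y = x := by
    intro e x y hl hy
    rcases hy.eq_or_eq_of_isLink hl with h1 | h1 <;> exact h1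
  have hcases : ∀ e ∈ E(G), (∃ x y, G.IsLink e x y ∧ g (Sum.inl x) < g (Sum.inl y)) ∨
      ∃ x, G.IsLink e x x := by
    intro e he
    obtain ⟨x, y, hl⟩ := G.exists_isLink_of_mem_edgeSet he
    rcases lt_trichotomy (g (Sum.inl x)) (g (Sum.inl y)) with h1 | h1 | h1
    · exact Or.inl ⟨x, y, hl, h1⟩
    · rw [hinj hl.left_mem hl.right_mem h1] at hl
      exact Or.inr ⟨y, hl⟩
    · exact Or.inl ⟨y, x, hl.symm, h1⟩
  refine ⟨hinj, fun e he => ?_, fun e he => ?_, fun x hx hz => ?_, fun x hx hz => ?_,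
    fun e he e' he' h1 h2 => ?_, fun e he e' he' h1 h2 => ?_⟩
  · rcases hcases e he with ⟨x, y, hl, hxy⟩ | ⟨x, hl⟩
    · simp only [(hlt hl hxy).1, (hlt hl hxy).2, hxy]
    · rcases hloop hl with ⟨h1, h2, h3⟩ | ⟨h1, h2, h3⟩ <;> simp only [h1, h2, h3]
  · rcases hcases e he with ⟨x, y, hl, hxy⟩ | ⟨x, hl⟩
    · exact ⟨x, y, hl, Or.inl ⟨(hlt hl hxy).1.symm, (hlt hl hxy).2.symm⟩⟩
    · refine ⟨x, x, hl, Or.inr ?_⟩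
      rcases hloop hl with ⟨h1, h2, h3⟩ | ⟨h1, h2, h3⟩
      · refine Or.inl ⟨rfl, h3.symm, fun z hz => ?_⟩
        exact h.le_of_low_of_ne hV he (fun y hy => hinc hl hy ▸ h1)
          (fun y hy => by rw [hinc hl hy]) _ (inl_mem_subdivideOnce.2 hz) (by simp)
      · refine Or.inr ⟨rfl, h2.symm, fun z hz => ?_⟩
        exact neg_le_neg_iff.1 (h.neg.le_of_low_of_ne hV he
          (fun y hy => hinc hl hy ▸ neg_lt_neg h1)
          (fun y hy => by rw [hinc hl hy]) _ (inl_mem_subdivideOnce.2 hz) (by simp))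
  · obtain ⟨e, y, hl, hyx⟩ := h.exists_down hV hx hz
    exact ⟨e, y, hl, (hlt hl hyx).1.symm, (hlt hl hyx).2.symm⟩
  · obtain ⟨z, hz, hzx⟩ := hz
    obtain ⟨e, y, hl, hyx⟩ := h.neg.exists_down hV hx ⟨z, hz, neg_lt_neg hzx⟩
    have hyx := neg_lt_neg_iff.1 hyx
    exact ⟨e, y, hl.symm, (hlt hl.symm hyx).1.symm, (hlt hl.symm hyx).2.symm⟩
  · have key : ∀ e ∈ E(G), (∀ z ∈ V(G), sInf (endHeights G g e) < g (Sum.inl z)) →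
        ∀ w ∈ V(subdivideOnce G), g (Sum.inr e) ≤ g w := by
      intro e he hlow
      rcases hcases e he with ⟨x, y, hl, hxy⟩ | ⟨x, hl⟩
      · exact absurd (hlow x hl.left_mem) (by rw [(hlt hl hxy).1]; exact lt_irrefl _)
      · rcases hloop hl with ⟨h1, h2, h3⟩ | ⟨h1, h2, h3⟩
        · exact h.le_of_low he fun y hy => hinc hl hy ▸ h1
        · exact absurd (hlow x hl.left_mem) (by rw [h2]; exact lt_irrefl _)
    have hV1 := inr_mem_subdivideOnce.2 he
    have hV2 := inr_mem_subdivideOnce.2 he'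
    exact Sum.inr_injective (h.inj hV1 hV2
      (le_antisymm (key e he h1 _ hV2) (key e' he' h2 _ hV1)))
  · have key : ∀ e ∈ E(G), (∀ z ∈ V(G), g (Sum.inl z) < sSup (endHeights G g e)) →
        ∀ w ∈ V(subdivideOnce G), g w ≤ g (Sum.inr e) := by
      intro e he hlow
      rcases hcases e he with ⟨x, y, hl, hxy⟩ | ⟨x, hl⟩
      · exact absurd (hlow y hl.right_mem) (by rw [(hlt hl hxy).2]; exact lt_irrefl _)
      · rcases hloop hl with ⟨h1, h2, h3⟩ | ⟨h1, h2, h3⟩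
        · exact absurd (hlow x hl.left_mem) (by rw [h3]; exact lt_irrefl _)
        · exact fun w hw => neg_le_neg_iff.1
            (h.neg.le_of_low he (fun y hy => hinc hl hy ▸ neg_lt_neg h1) w hw)
    have hV1 := inr_mem_subdivideOnce.2 he
    have hV2 := inr_mem_subdivideOnce.2 he'
    exact Sum.inr_injective (h.inj hV1 hV2
      (le_antisymm (key e' he' h2 _ hV1) (key e he h1 _ hV2)))

end Subdivision

/-! ## Forks -/

section Forks

open scoped Graph

variable {α β : Type*}

/-- Three disjoint connected sets of vertices, each attached to the rest at one vertex. -/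
structure Fork (H : Graph α β) (v : Fin 3 → α) (D : Fin 3 → Set α) : Prop where
  subset : ∀ i, D i ⊆ V(H)
  notMem : ∀ i j, v i ∉ D j
  disjoint : ∀ i j, i ≠ j → Disjoint (D i) (D j)
  closed : ∀ i y z, y ∈ D i → H.Adj y z → z ∈ D i ∨ z = v i
  conn : ∀ i, ∀ x ∈ D i, ∀ y ∈ D i,
    Relation.ReflTransGen (fun a b => H.Adj a b ∧ a ∈ D i ∧ b ∈ D i) x y
  adj : ∀ i, ∃ y ∈ D i, H.Adj (v i) y
  normal : (∀ i, v i = v 0) ∨ Function.Injective v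

/-- Adjacency between the vertices of a multigraph. -/
def vertexAdj (H : Graph α β) (a b : V(H)) : Prop := H.Adj a b

theorem vertexAdj_symm (H : Graph α β) : ∀ ⦃a b⦄, vertexAdj H a b → vertexAdj H b a :=
  fun _ _ h => Graph.Adj.symm h

theorem GraphConnected.vertexAdj {H : Graph α β} (h : GraphConnected H) (x y : V(H)) :
    Relation.ReflTransGen (vertexAdj H) x y := by
  have key : ∀ z, Relation.ReflTransGen H.Adj x.1 z → ∀ hz : z ∈ V(H),
      Relation.ReflTransGen (TangleDivision.vertexAdj H) x ⟨z, hz⟩ := by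
    intro z hxz
    induction hxz with
    | refl => exact fun _ => .refl
    | tail _ hab ih => exact fun hz => .tail (ih hab.left_mem) hab
  exact key y.1 (h.2 x.1 x.2 y.1 y.2) y.2

/-- Otherwise the side would be closed under adjacency, and by connectedness it would contain its
own vertex. -/
theorem exists_adj_side {W : Type*} {r : W → W → Prop}
    (hr : ∀ ⦃a b⦄, r a b → r b a) (hc : ∀ x y, Relation.ReflTransGen r x y) {v x : W}
    (hx : x ≠ v) : ∃ y ∈ Side r v x, r v y := by
  by_contra hcon
  push Not at hcon
  have key : ∀ y, Relation.ReflTransGen r x y → y ∈ Side r v x := by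
    intro y hy
    induction hy with
    | refl => exact self_mem_side _ _
    | tail _ hab ih => exact mem_side_of_rel hx ih hab fun hv => hcon _ ih (hv ▸ hr hab)
  exact ne_of_mem_side hx (key v (hc x v)) rfl

theorem SideTriple.fork {H : Graph α β} (hH : GraphConnected H) {v x : Fin 3 → V(H)}
    (h : SideTriple (vertexAdj H) v x) (hn : (∀ i, v i = v 0) ∨ Function.Injective v) :
    Fork H (fun i => (v i : α)) (fun i => Subtype.val '' Side (vertexAdj H) (v i) (x i)) := by
  have hr := vertexAdj_symm H
  have hc := hH.vertexAdj
  refine ⟨?_, ?_, ?_, ?_, ?_, ?_, ?_⟩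
  · rintro i _ ⟨y, -, rfl⟩
    exact y.2
  · rintro i j ⟨y, hy, heq⟩
    obtain rfl := Subtype.ext heq
    by_cases hij : i = j
    · subst hij
      exact ne_of_mem_side (h.ne i) hy rfl
    · exact h.notMem hr hc hij hy
  · exact fun i j hij => (disjoint_image_iff Subtype.val_injective).2 (h.disjoint i j hij)
  · rintro i _ z ⟨y, hy, rfl⟩ hyz
    by_cases hz : (⟨z, hyz.right_mem⟩ : V(H)) = v i
    · exact Or.inr (congrArg Subtype.val hz)
    · exact Or.inl ⟨⟨z, hyz.right_mem⟩, mem_side_of_rel (h.ne i) hy hyz hz, rfl⟩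
  · intro i
    have key : ∀ y ∈ Side (TangleDivision.vertexAdj H) (v i) (x i), Relation.ReflTransGen
        (fun a b => H.Adj a b ∧ a ∈ Subtype.val '' Side (vertexAdj H) (v i) (x i) ∧
          b ∈ Subtype.val '' Side (vertexAdj H) (v i) (x i)) (x i : α) y := by
      intro y hy
      induction hy with
      | refl => exact .refl
      | @tail a b hxa hab ih =>
        exact .tail ih ⟨hab.1, ⟨a, hxa, rfl⟩, ⟨b, .tail hxa hab, rfl⟩⟩
    rintro _ ⟨y, hy, rfl⟩ _ ⟨z, hz, rfl⟩
    exact (Relation.ReflTransGen.mono (fun c d hcd => ⟨hcd.1.symm, hcd.2.2, hcd.2.1⟩) _ _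
      (key y hy).swap).trans (key z hz)
  · intro i
    obtain ⟨y, hy, hvy⟩ := exists_adj_side hr hc (h.ne i)
    exact ⟨y, ⟨y, hy, rfl⟩, hvy⟩
  · exact hn.imp (fun h i => congrArg Subtype.val (h i)) Subtype.val_injective.comp

/-- Three disjoint sides of the subdivided multigraph may be assumed to belong to original
vertices. -/
theorem SideTriple.exists_inl {G : Graph α β} (hH : GraphConnected (subdivideOnce G))
    {v x : Fin 3 → V(subdivideOnce G)} (h : SideTriple (vertexAdj (subdivideOnce G)) v x) :
    ∃ v' x', SideTriple (vertexAdj (subdivideOnce G)) v' x' ∧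
      ((∀ i, v' i = v' 0) ∨ Function.Injective v') ∧ ∀ i, ∃ u, (v' i : α ⊕ β) = Sum.inl u := by
  set r := vertexAdj (subdivideOnce G)
  have hr : ∀ ⦃a b⦄, r a b → r b a := vertexAdj_symm _
  have hc : ∀ x y, Relation.ReflTransGen r x y := hH.vertexAdj
  obtain ⟨v, x, h, hn, -⟩ := h.exists_normal hr hc
  have hadj : ∀ i (e : β), (v i : α ⊕ β) = Sum.inr e →
      ∃ w, G.Inc e w ∧ ∃ hw, (⟨Sum.inl w, hw⟩ : V(subdivideOnce G)) ∈ Side r (v i) (x i) := by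
    intro i e he
    obtain ⟨⟨y, hyV⟩, hy, hvy⟩ := exists_adj_side hr hc (h.ne i)
    have hvy : (subdivideOnce G).Adj (v i) y := hvy
    rcases subdivideOnce_adj.1 hvy with ⟨w, e', -, heq, -⟩ | ⟨w, e', hinc, heq, rfl⟩
    · rw [he] at heq; simp at heq
    · rw [he] at heq
      rw [← Sum.inr_injective heq] at hinc
      exact ⟨w, hinc, hyV, hy⟩
  rcases hn with hn | hn
  · cases hv : (v 0 : α ⊕ β) with
    | inl u => exact ⟨v, x, h, Or.inl hn, fun i => ⟨u, by rw [hn i, hv]⟩⟩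
    | inr e =>
      -- A subdivision vertex would need neighbours in three disjoint sides, but an edge has at most
      -- two ends.
      exfalso
      choose w hw hwV hwD using fun i => hadj i e (by rw [hn i, hv])
      have hne : ∀ i j, i ≠ j → w i ≠ w j := by
        intro i j hij heq
        refine (h.disjoint i j hij).le_bot ⟨hwD i, ?_⟩
        have := hwD j
        simp only [← heq] at this
        exact this
      rcases (hw 0).eq_or_eq_or_eq (hw 1) (hw 2) with h1 | h1 | h1
      exacts [hne 0 1 (by decide) h1, hne 0 2 (by decide) h1, hne 1 2 (by decide) h1]
  -- A side at the subdivision vertex of an edge contains one end `w` of it. The vertex is moved to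
  -- the other end `w'`, and the side grows by the subdivision vertex at most.
  · have key : ∀ i, ∃ v' x' : V(subdivideOnce G), x' ≠ v' ∧ (∃ u, (v' : α ⊕ β) = Sum.inl u) ∧
        Side r v' x' ⊆ insert (v i) (Side r (v i) (x i)) := by
      intro i
      cases hv : (v i : α ⊕ β) with
      | inl u => exact ⟨v i, x i, h.ne i, ⟨u, hv⟩, subset_insert _ _⟩
      | inr e =>
        obtain ⟨w, hw, hwV, hwD⟩ := hadj i e hv
        obtain ⟨w', hl⟩ := hw
        have hnb : ∀ z, r (v i) z → (z : α ⊕ β) = Sum.inl w ∨ (z : α ⊕ β) = Sum.inl w' := by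
          intro z hz
          have hz : (subdivideOnce G).Adj (v i) z := hz
          rcases subdivideOnce_adj.1 hz with ⟨y, e', -, heq, -⟩ | ⟨y, e', hinc, heq, hzy⟩
          · rw [hv] at heq; simp at heq
          · rw [hv] at heq
            rw [← Sum.inr_injective heq] at hinc
            rw [hzy]
            rcases hinc.eq_or_eq_of_isLink hl with rfl | rfl <;> simp
        have hwV' : Sum.inl w' ∈ V(subdivideOnce G) := inl_mem_subdivideOnce.2 hl.right_mem
        refine ⟨⟨Sum.inl w', hwV'⟩, v i, ?_, ⟨w', rfl⟩, ?_⟩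
        · intro heq
          rw [heq] at hv
          simp at hv
        · apply side_subset_of_closed (mem_insert _ _)
          rintro y (rfl | hy) z hyz hz
          · rcases hnb z hyz with h1 | h1
            · right
              have : z = ⟨Sum.inl w, hwV⟩ := Subtype.ext h1
              rw [this]
              exact hwD
            · exact absurd (Subtype.ext h1) hz
          · by_cases hzv : z = v i
            · exact Or.inl hzv
            · exact Or.inr (mem_side_of_rel (h.ne i) hy hyz hzv)
    choose v' x' hne hinl hsub using key
    have h' : SideTriple r v' x' := by
      refine ⟨hne, fun i j hij => ?_⟩
      refine Disjoint.mono (hsub i) (hsub j) ?_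
      rw [Set.disjoint_left]
      rintro y (rfl | hy) (hy' | hy')
      · exact hij (hn hy')
      · exact h.notMem hr hc hij hy'
      · exact h.notMem hr hc (Ne.symm hij) (hy' ▸ hy)
      · exact (h.disjoint i j hij).le_bot ⟨hy, hy'⟩
    obtain ⟨v'', x'', h'', hn'', hv''⟩ := h'.exists_normal hr hc
    refine ⟨v'', x'', h'', hn'', fun i => ?_⟩
    obtain ⟨j, hj⟩ := hv'' i
    rw [hj]
    exact hinl j

/-- If two points meet all sides, a bipolar list exists and gives a numbering. Otherwise three
disjoint sides exist and are normalised. -/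
theorem exists_fork {G : Graph α β} (hV : V(subdivideOnce G).Finite)
    (hH : GraphConnected (subdivideOnce G)) (hE : E(G).Nonempty)
    (h : ¬ HasBipolarNumbering (subdivideOnce G)) :
    ∃ (u : Fin 3 → α) (D : Fin 3 → Set (α ⊕ β)),
      Fork (subdivideOnce G) (fun i => Sum.inl (u i)) D := by
  have : Finite V(subdivideOnce G) := hV
  have : Nontrivial V(subdivideOnce G) := by
    obtain ⟨e, he⟩ := hE
    obtain ⟨x, y, hl⟩ := G.exists_isLink_of_mem_edgeSet he
    refine ⟨⟨Sum.inl x, inl_mem_subdivideOnce.2 hl.left_mem⟩,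
      ⟨Sum.inr e, inr_mem_subdivideOnce.2 he⟩, fun h => ?_⟩
    have := congrArg Subtype.val h
    simp at this
  have hr := vertexAdj_symm (subdivideOnce G)
  have hc := hH.vertexAdj
  rcases exists_pair_or_sideTriple hr hc with ⟨s, t, hst, hcov⟩ | ⟨v, x, hvx⟩
  · obtain ⟨L, hL, hall⟩ := exists_bipolarList hr hc hst hcov
    obtain ⟨k, v, hbij, hdown, hup⟩ := hL.exists_enumeration hr hall
    refine absurd ⟨k, Subtype.val ∘ v, Subtype.val_injective.comp hbij.injective, ?_, hdown, hup⟩ h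
    rw [hbij.surjective.range_comp, Subtype.range_coe]
  · obtain ⟨v, x, h', hn, hinl⟩ := hvx.exists_inl hH
    choose u hu using hinl
    have := h'.fork hH hn
    simp only [hu] at this
    exact ⟨u, _, this⟩

/-! ### Tridents and splits from forks -/

theorem Fork.mem_of_isChain {H : Graph α β} {v : Fin 3 → α} {D : Fin 3 → Set α} (h : Fork H v D)
    (i : Fin 3) {l : List α} (hl : l.IsChain H.Adj) (hv : v i ∉ l)
    (hhd : ∀ x, l.head? = some x → x ∈ D i) : ∀ x ∈ l, x ∈ D i := by
  induction l with
  | nil => simp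
  | cons a l ih =>
    rw [List.isChain_cons] at hl
    have ha : a ∈ D i := hhd a rfl
    intro x hx
    rcases List.mem_cons.1 hx with rfl | hx
    · exact ha
    · refine ih hl.2 (fun h => hv (List.mem_cons_of_mem _ h)) (fun y hy => ?_) x hx
      refine (h.closed i a y ha (hl.1 y hy)).resolve_right ?_
      rintro rfl
      exact hv (List.mem_cons_of_mem _ (List.mem_of_mem_head? hy))

/-- Each arm is a part of the fork with its attaching vertex. The centre is that vertex if all three
coincide, and otherwise all that lies outside the three parts. -/
theorem Fork.hasTrident {H : Graph α β} {v : Fin 3 → α} {D : Fin 3 → Set α} (h : Fork H v D)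
    (hH : GraphConnected H) : HasTrident H := by
  classical
  have hvV : ∀ i, v i ∈ V(H) := fun i => (h.adj i).choose_spec.2.left_mem
  have hP : ∀ i, insert (v i) (D i) ⊆ V(H) := fun i => insert_subset (hvV i) (h.subset i)
  let P : Fin 3 → Graph α β := fun i => H.induce (insert (v i) (D i))
  have hPadj : ∀ i a b, H.Adj a b → a ∈ insert (v i) (D i) → b ∈ insert (v i) (D i) →
      (P i).Adj a b := fun i a b ⟨e, he⟩ ha hb => ⟨e, he, ha, hb⟩
  have hPc : ∀ i, GraphConnected (P i) := by
    intro i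
    refine graphConnected_of_center (v := v i) (mem_insert _ _) ?_
    obtain ⟨y, hy, hvy⟩ := h.adj i
    rintro x (rfl | hx)
    · exact .refl
    · refine Relation.ReflTransGen.trans (Relation.ReflTransGen.mono
        (fun a b hab => hPadj i a b hab.1 (Or.inr hab.2.1) (Or.inr hab.2.2)) _ _
        (h.conn i x hx y hy)) (.single ?_)
      exact hPadj i _ _ hvy.symm (Or.inr hy) (Or.inl rfl)
  have hnt : ∀ i, V(P i).Nontrivial := by
    intro i
    obtain ⟨y, hy, -⟩ := h.adj i
    exact ⟨v i, mem_insert _ _, y, Or.inr hy, fun heq => h.notMem i i (heq ▸ hy)⟩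
  have hpath : ∀ i j, i ≠ j → ∀ w : List α, w.IsChain H.Adj → w.Nodup →
      (∃ x ∈ V(P i), w.head? = some x) → (∃ y ∈ V(P j), w.getLast? = some y) →
      v i ∈ w ∧ v j ∈ w := by
    have half : ∀ i j, i ≠ j → ∀ w : List α, w.IsChain H.Adj →
        (∃ x ∈ V(P i), w.head? = some x) → (∃ y ∈ V(P j), w.getLast? = some y) → v i ∈ w := by
      rintro i j hij w hw ⟨x, hx, hhd⟩ ⟨y, hy, hlast⟩
      by_contra hv
      have hx' : x ∈ D i := Or.resolve_left hx fun heq =>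
        hv (heq ▸ List.mem_of_mem_head? hhd)
      have hall := h.mem_of_isChain i hw hv (fun z hz => by
        rw [hhd, Option.some.injEq] at hz
        exact hz ▸ hx')
      have hyi := hall y (List.mem_of_mem_getLast? hlast)
      rcases hy with rfl | hy
      · exact h.notMem _ _ hyi
      · exact (h.disjoint i j hij).le_bot ⟨hyi, hy⟩
    intro i j hij w hw _ hx hy
    refine ⟨half i j hij w hw hx hy, ?_⟩
    have := half j i hij.symm w.reverse
      (List.isChain_reverse.2 (hw.imp fun _ _ hab => hab.symm))
      (by simpa using hy) (by simpa using hx)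
    simpa using this
  rcases h.normal with hn | hn
  · have hsub : ({v 0} : Set α) ⊆ V(H) := singleton_subset_iff.2 (hvV 0)
    refine ⟨H.induce {v 0}, P, v, Graph.induce_le hsub, ⟨⟨v 0, rfl⟩, ?_⟩,
      fun i => ⟨Graph.induce_le (hP i), hPc i⟩, fun i => ?_, hnt, hpath, Or.inl ⟨v 0, rfl⟩⟩
    · rintro x rfl y rfl
      exact .refl
    · change insert (v i) (D i) ∩ {v 0} = {v i}
      rw [hn i]
      exact inter_eq_right.2 (singleton_subset_iff.2 (mem_insert _ _))
  · let S : Set α := V(H) \ ⋃ i, D i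
    have hvS : ∀ i, v i ∈ S := fun i => ⟨hvV i, fun hmem => by
      obtain ⟨j, hj⟩ := mem_iUnion.1 hmem
      exact h.notMem i j hj⟩
    refine ⟨H.induce S, P, v, Graph.induce_le sdiff_subset, ⟨⟨v 0, hvS 0⟩, ?_⟩,
      fun i => ⟨Graph.induce_le (hP i), hPc i⟩, fun i => ?_, hnt, hpath, Or.inr hn⟩
    -- Collapsing each part to its attaching vertex maps walks to walks, so what remains is
    -- connected.
    · let ρ : α → α := fun x => if hx : ∃ i, x ∈ D i then v hx.choose else x
      have hρD : ∀ {x i}, x ∈ D i → ρ x = v i := by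
        intro x i hx
        have hex : ∃ i, x ∈ D i := ⟨i, hx⟩
        have : hex.choose = i := by
          by_contra hne
          exact (h.disjoint _ _ hne).le_bot ⟨hex.choose_spec, hx⟩
        simp only [ρ]
        rw [dif_pos hex, this]
      have hρS : ∀ {x}, (∀ i, x ∉ D i) → ρ x = x := by
        intro x hx
        simp only [ρ]
        rw [dif_neg (not_exists.2 hx)]
      have hadj : ∀ a b, H.Adj a b → ρ a = ρ b ∨ (H.induce S).Adj (ρ a) (ρ b) := by
        intro a b hab
        by_cases ha : ∃ i, a ∈ D i
        · obtain ⟨i, ha⟩ := ha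
          left
          rcases h.closed i a b ha hab with hb | rfl
          · rw [hρD ha, hρD hb]
          · rw [hρD ha, hρS (h.notMem i)]
        · push Not at ha
          by_cases hb : ∃ i, b ∈ D i
          · obtain ⟨i, hb⟩ := hb
            left
            rcases h.closed i b a hb hab.symm with ha' | rfl
            · exact absurd ha' (ha i)
            · rw [hρD hb, hρS (h.notMem i)]
          · push Not at hb
            right
            rw [hρS ha, hρS hb]
            obtain ⟨e, he⟩ := hab
            exact ⟨e, he, ⟨he.left_mem, by simpa using ha⟩, ⟨he.right_mem, by simpa using hb⟩⟩
      have hlift : ∀ x y, Relation.ReflTransGen H.Adj x y →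
          Relation.ReflTransGen (H.induce S).Adj (ρ x) (ρ y) := by
        intro x y hxy
        induction hxy with
        | refl => exact .refl
        | tail _ hab ih =>
          rcases hadj _ _ hab with heq | hadj'
          · rwa [← heq]
          · exact .tail ih hadj'
      intro x hx y hy
      have hx' : ∀ i, x ∉ D i := fun i hi => hx.2 (mem_iUnion.2 ⟨i, hi⟩)
      have hy' : ∀ i, y ∉ D i := fun i hi => hy.2 (mem_iUnion.2 ⟨i, hi⟩)
      have := hlift x y (hH.2 x hx.1 y hy.1)
      rwa [hρS hx', hρS hy'] at this
    · change insert (v i) (D i) ∩ S = {v i}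
      ext y
      constructor
      · rintro ⟨rfl | hy, hyS⟩
        · rfl
        · exact absurd (mem_iUnion.2 ⟨i, hy⟩) hyS.2
      · rintro rfl
        exact ⟨mem_insert _ _, hvS i⟩

/-- A fork splits off three disjoint sets of edges. -/
theorem Fork.isSplit {H : Graph α β} {v : Fin 3 → α} {D : Fin 3 → Set α} (h : Fork H v D)
    (i : Fin 3) : IsSplit H (v i) {e | ∃ y ∈ D i, H.Inc e y} ∧
      ∀ j, i ≠ j → Disjoint {e | ∃ y ∈ D i, H.Inc e y} {e | ∃ y ∈ D j, H.Inc e y} := by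
  have hother : ∀ {i e y z}, y ∈ D i → H.Inc e y → H.Inc e z → z ∈ D i ∨ z = v i := by
    intro i e y z hy hey hez
    obtain ⟨w, hw⟩ := hey
    rcases hez.eq_or_eq_of_isLink hw with rfl | rfl
    · exact Or.inl hy
    · exact h.closed i y z hy ⟨e, hw⟩
  have hd : ∀ j, i ≠ j → Disjoint {e | ∃ y ∈ D i, H.Inc e y} {e | ∃ y ∈ D j, H.Inc e y} := by
    intro j hij
    rw [Set.disjoint_left]
    rintro e ⟨y, hy, hey⟩ ⟨z, hz, hez⟩
    rcases hother hy hey hez with hz' | rfl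
    · exact (h.disjoint i j hij).le_bot ⟨hz', hz⟩
    · exact h.notMem i j hz
  have hne : ∀ j, {e | ∃ y ∈ D j, H.Inc e y}.Nonempty := by
    intro j
    obtain ⟨y, hy, e, he⟩ := h.adj j
    exact ⟨e, y, hy, he.inc_right⟩
  refine ⟨⟨?_, hne i, ?_, ?_⟩, hd⟩
  · rintro e ⟨y, -, hey⟩
    exact hey.edge_mem
  · obtain ⟨j, hj, -⟩ := fin_three_exists_other i i
    obtain ⟨e, he⟩ := hne j
    refine ⟨e, ?_, fun he' => (hd j hj.symm).le_bot ⟨he', he⟩⟩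
    obtain ⟨y, -, hey⟩ := he
    exact hey.edge_mem
  · rintro e ⟨y, hy, hey⟩ e' ⟨-, he'⟩ x hx hx'
    exact (hother hy hey hx).resolve_left fun hxD => he' ⟨x, hxD, hx'⟩

theorem Fork.exists_inr_mem {G : Graph α β} {u : Fin 3 → α} {D : Fin 3 → Set (α ⊕ β)}
    (h : Fork (subdivideOnce G) (fun i => Sum.inl (u i)) D) (i : Fin 3) :
    ∃ e, Sum.inr e ∈ D i ∧ G.Inc e (u i) := by
  obtain ⟨y, hy, hadj⟩ := h.adj i
  rcases subdivideOnce_adj.1 hadj with ⟨x, e, hinc, heq, rfl⟩ | ⟨x, e, -, heq, -⟩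
  · rw [← Sum.inl_injective heq] at hinc
    exact ⟨e, hy, hinc⟩
  · simp at heq

theorem Fork.inl_mem_or {G : Graph α β} {u : Fin 3 → α} {D : Fin 3 → Set (α ⊕ β)}
    (h : Fork (subdivideOnce G) (fun i => Sum.inl (u i)) D) {i : Fin 3} {e : β} {x : α}
    (he : Sum.inr e ∈ D i) (hx : G.Inc e x) : Sum.inl x ∈ D i ∨ x = u i :=
  (h.closed i _ _ he (subdivideOnce_adj.2 (Or.inr ⟨x, e, hx, rfl, rfl⟩))).imp_right
    fun h => Sum.inl_injective h

theorem Fork.inr_mem {G : Graph α β} {u : Fin 3 → α} {D : Fin 3 → Set (α ⊕ β)}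
    (h : Fork (subdivideOnce G) (fun i => Sum.inl (u i)) D) {i : Fin 3} {e : β} {x : α}
    (hx : Sum.inl x ∈ D i) (he : G.Inc e x) : Sum.inr e ∈ D i :=
  (h.closed i _ _ hx (subdivideOnce_adj.2 (Or.inl ⟨x, e, he, rfl, rfl⟩))).resolve_right (by simp)

/-- A fork of the subdivided multigraph splits off three disjoint sets of original edges. -/
theorem Fork.isSplit_original {G : Graph α β} {u : Fin 3 → α} {D : Fin 3 → Set (α ⊕ β)}
    (h : Fork (subdivideOnce G) (fun i => Sum.inl (u i)) D) (i : Fin 3) :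
    IsSplit G (u i) {e | Sum.inr e ∈ D i} ∧
      ∀ j, i ≠ j → Disjoint {e | (Sum.inr e : α ⊕ β) ∈ D i} {e | Sum.inr e ∈ D j} := by
  have hd : ∀ j, i ≠ j → Disjoint {e | (Sum.inr e : α ⊕ β) ∈ D i} {e | Sum.inr e ∈ D j} :=
    fun j hij => Set.disjoint_left.2 fun e he he' => (h.disjoint i j hij).le_bot ⟨he, he'⟩
  refine ⟨⟨fun e he => inr_mem_subdivideOnce.1 (h.subset i he), ?_, ?_, ?_⟩, hd⟩
  · obtain ⟨e, he, -⟩ := h.exists_inr_mem i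
    exact ⟨e, he⟩
  · obtain ⟨j, hj, -⟩ := fin_three_exists_other i i
    obtain ⟨e, he, hinc⟩ := h.exists_inr_mem j
    exact ⟨e, hinc.edge_mem, fun he' => Set.disjoint_left.1 (hd j hj.symm) he' he⟩
  · rintro e he e' ⟨-, he'⟩ x hx hx'
    exact (h.inl_mem_or he hx).resolve_left fun hxD => he' (h.inr_mem hxD hx')

end Forks

/-! ## The multigraph of a drawing -/

section DrawnGraph

open scoped Graph

variable {T : Type*} [TopologicalSpace T] {ι : Type*} {V : Set T} {φ : ι → unitInterval → T}

theorem Drawing.isLink_iff [Finite ι] [T2Space T] (h : Drawing V φ) {i : ι} {x y : T} :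
    (drawnGraph V).IsLink (openArc φ i) x y ↔ ({φ i 0, φ i 1} : Set T) = {x, y} := by
  change openArc φ i ∈ componentsOf Vᶜ ∧ x ∈ V ∧ y ∈ V ∧
    closure (openArc φ i) \ openArc φ i = {x, y} ↔ _
  rw [h.closure_diff, h.componentsOf_compl]
  refine ⟨fun hl => hl.2.2.2, fun heq => ⟨⟨i, rfl⟩, ?_, ?_, heq⟩⟩
  · rcases heq.symm.subset (mem_insert x {y}) with rfl | rfl
    exacts [h.zero_mem i, h.one_mem i]
  · rcases heq.symm.subset (mem_insert_of_mem x rfl : y ∈ ({x, y} : Set T)) with rfl | rfl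
    exacts [h.zero_mem i, h.one_mem i]

theorem Drawing.isLink [Finite ι] [T2Space T] (h : Drawing V φ) (i : ι) :
    (drawnGraph V).IsLink (openArc φ i) (φ i 0) (φ i 1) := h.isLink_iff.2 rfl

theorem Drawing.edgeSet_eq [Finite ι] [T2Space T] (h : Drawing V φ) :
    E(drawnGraph V) = range (openArc φ) := by
  ext e
  constructor
  · intro he
    obtain ⟨x, y, hl⟩ := (drawnGraph V).exists_isLink_of_mem_edgeSet he
    rw [← h.componentsOf_compl]
    exact hl.1
  · rintro ⟨i, rfl⟩
    exact (h.isLink i).edge_mem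

theorem Drawing.inc_iff [Finite ι] [T2Space T] (h : Drawing V φ) {i : ι} {x : T} :
    (drawnGraph V).Inc (openArc φ i) x ↔ x = φ i 0 ∨ x = φ i 1 := by
  refine ⟨fun hx => hx.eq_or_eq_of_isLink (h.isLink i), ?_⟩
  rintro (rfl | rfl)
  exacts [(h.isLink i).inc_left, (h.isLink i).inc_right]

/-- The vertices reachable from `x`, together with the arcs at them, form a clopen set. -/
theorem Drawing.graphConnected [Finite ι] [T2Space T] [ConnectedSpace T] (h : Drawing V φ)
    (hne : V.Nonempty) : GraphConnected (drawnGraph V) := by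
  classical
  refine ⟨hne, fun x hx y hy => ?_⟩
  let S : Set T := {z ∈ V | Relation.ReflTransGen (drawnGraph V).Adj x z}
  have hiff : ∀ i, φ i 0 ∈ S ↔ φ i 1 ∈ S := fun i =>
    ⟨fun hs => ⟨h.one_mem i, .tail hs.2 ⟨_, h.isLink i⟩⟩,
      fun hs => ⟨h.zero_mem i, .tail hs.2 ⟨_, (h.isLink i).symm⟩⟩⟩
  let A : Set T := S ∪ ⋃ i, φ i '' (if φ i 0 ∈ S then univ else ∅)
  have hA : IsClosed A := h.isClosed_union (fun z hz => hz.1) fun i => by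
    split_ifs
    exacts [isClosed_univ, isClosed_empty]
  have hAc : IsClosed ((V \ S) ∪ ⋃ i, φ i '' (if φ i 0 ∈ S then ∅ else univ)) :=
    h.isClosed_union sdiff_subset fun i => by
      split_ifs
      exacts [isClosed_empty, isClosed_univ]
  have hVA : ∀ z ∈ V, z ∈ A → z ∈ S := by
    rintro z hz (hzS | hzA)
    · exact hzS
    · obtain ⟨i, t, ht, rfl⟩ := mem_iUnion.1 hzA
      by_cases hi : φ i 0 ∈ S
      · rcases unitInterval_trichotomy t with rfl | rfl | ht'
        exacts [hi, (hiff i).1 hi, absurd hz (h.notMem i t ht')]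
      · rw [if_neg hi] at ht
        exact absurd ht (notMem_empty _)
  have hcompl : Aᶜ = (V \ S) ∪ ⋃ i, φ i '' (if φ i 0 ∈ S then ∅ else univ) := by
    ext z
    constructor
    · intro hz
      rcases h.cover z with hzV | ⟨i, t, ht, rfl⟩
      · exact Or.inl ⟨hzV, fun hzS => hz (Or.inl hzS)⟩
      · by_cases hi : φ i 0 ∈ S
        · exact (hz (Or.inr (mem_iUnion.2 ⟨i, t, by rw [if_pos hi]; trivial, rfl⟩))).elim
        · exact Or.inr (mem_iUnion.2 ⟨i, t, by rw [if_neg hi]; trivial, rfl⟩)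
    · rintro (hz | hz) hzA
      · exact hz.2 (hVA z hz.1 hzA)
      · obtain ⟨i, t, ht, rfl⟩ := mem_iUnion.1 hz
        by_cases hi : φ i 0 ∈ S
        · rw [if_pos hi] at ht
          exact ht
        · rcases unitInterval_trichotomy t with rfl | rfl | ht'
          · exact hi (hVA _ (h.zero_mem i) hzA)
          · exact hi ((hiff i).2 (hVA _ (h.one_mem i) hzA))
          · rcases hzA with hzS | hzA
            · exact h.notMem i t ht' hzS.1
            · obtain ⟨j, s, hs, hst⟩ := mem_iUnion.1 hzA
              obtain ⟨rfl, -⟩ := h.eq_of_eq ht' hst.symm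
              rw [if_neg hi] at hs
              exact hs
  have hclopen : IsClopen A := ⟨hA, isClosed_compl_iff.1 (hcompl ▸ hAc)⟩
  have huniv := (isClopen_iff.1 hclopen).resolve_left
    (Nonempty.ne_empty ⟨x, Or.inl ⟨hx, .refl⟩⟩)
  exact (hVA y hy (huniv ▸ mem_univ y)).2

/-- Each step of a walk becomes two steps through the subdivision vertex. -/
theorem GraphConnected.subdivideOnce {α β : Type*} {G : Graph α β} (h : GraphConnected G) :
    GraphConnected (subdivideOnce G) := by
  obtain ⟨v, hv⟩ := h.1
  refine graphConnected_of_center (inl_mem_subdivideOnce.2 hv) ?_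
  have hin : ∀ {e x}, G.Inc e x → (TangleDivision.subdivideOnce G).Adj (Sum.inl x) (Sum.inr e) :=
    fun {e x} hx => subdivideOnce_adj.2 (Or.inl ⟨x, e, hx, rfl, rfl⟩)
  have hV : ∀ x ∈ V(G), Relation.ReflTransGen (TangleDivision.subdivideOnce G).Adj
      (Sum.inl x) (Sum.inl v) := by
    intro x hx
    have := h.2 x hx v hv
    induction this with
    | refl => exact .refl
    | @tail a b _ hab ih =>
      obtain ⟨e, he⟩ := hab
      exact .tail (.tail (ih he.left_mem) (hin he.inc_left)) (hin he.inc_right).symm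
  rintro (x | e) hx
  · exact hV x (inl_mem_subdivideOnce.1 hx)
  · obtain ⟨x, y, hl⟩ := G.exists_isLink_of_mem_edgeSet (inr_mem_subdivideOnce.1 hx)
    exact .head (hin hl.inc_left).symm (hV x hl.left_mem)

theorem finite_subdivideOnce {α β : Type*} {G : Graph α β} (hV : V(G).Finite) (hE : E(G).Finite) :
    V(subdivideOnce G).Finite ∧ E(subdivideOnce G).Finite := by
  refine ⟨(hV.image _).union (hE.image _), ?_⟩
  refine (hE.prod (hV.prod (finite_univ (α := Bool)))).subset ?_
  intro h hh
  obtain ⟨a, b, hl⟩ := (subdivideOnce G).exists_isLink_of_mem_edgeSet hh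
  have hinc : G.Inc h.1 h.2.1 := hl.1.elim And.right fun hl => Graph.IsLoopAt.inc hl.2
  exact ⟨hinc.edge_mem, hinc.vertex_mem, trivial⟩

theorem edgeSet_subdivideOnce_nonempty {α β : Type*} {G : Graph α β} (hE : E(G).Nonempty) :
    E(subdivideOnce G).Nonempty := by
  obtain ⟨e, he⟩ := hE
  obtain ⟨x, y, hl⟩ := G.exists_isLink_of_mem_edgeSet he
  obtain ⟨h, hh⟩ : (subdivideOnce G).Adj (Sum.inl x) (Sum.inr e) :=
    subdivideOnce_adj.2 (Or.inl ⟨x, e, hl.inc_left, rfl, rfl⟩)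
  exact ⟨h, hh.edge_mem⟩

open Classical in
/-- The height of the points of a drawing that is affine on the arcs. -/
noncomputable def arcHeight (V : Set T) (φ : ι → unitInterval → T) (f : T → ℝ) (a b : ι → ℝ)
    (x : T) : ℝ :=
  if x ∈ V then f x
  else if h : ∃ p : ι × unitInterval, p.2 ∈ Ioo (0 : unitInterval) 1 ∧ φ p.1 p.2 = x then
    a h.choose.1 + h.choose.2 * (b h.choose.1 - a h.choose.1)
  else 0

/-- A sweep of the multigraph of a drawing extends to the space. -/
theorem Sweep.sweeping [Finite ι] [T2Space T] {f : T → ℝ} {a b : Set T → ℝ}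
    (hs : Sweep (drawnGraph V) f a b) (h : Drawing V φ) (hf : ∀ i, f (φ i 0) ≤ f (φ i 1)) :
    Sweeping V φ (fun i => a (openArc φ i)) (fun i => b (openArc φ i))
      (arcHeight V φ f (fun i => a (openArc φ i)) (fun i => b (openArc φ i))) := by
  set η := arcHeight V φ f (fun i => a (openArc φ i)) (fun i => b (openArc φ i))
  have hη : ∀ x ∈ V, η x = f x := fun x hx => if_pos hx
  have h0 : ∀ i, η (φ i 0) = f (φ i 0) := fun i => hη _ (h.zero_mem i)
  have h1 : ∀ i, η (φ i 1) = f (φ i 1) := fun i => hη _ (h.one_mem i)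
  have hE : ∀ i, openArc φ i ∈ E(drawnGraph V) := fun i => (h.isLink i).edge_mem
  have hlink : ∀ {e x y}, (drawnGraph V).IsLink e x y → f x < f y →
      ∃ i, openArc φ i = e ∧ φ i 0 = x ∧ φ i 1 = y := by
    intro e x y hl hxy
    obtain ⟨i, rfl⟩ := h.edgeSet_eq.subset hl.edge_mem
    rcases hl.eq_and_eq_or_eq_and_eq (h.isLink i) with ⟨rfl, rfl⟩ | ⟨rfl, rfl⟩
    · exact ⟨i, rfl, rfl, rfl⟩
    · exact absurd (hf i) (not_le.2 hxy)
  have hends : ∀ i, (η (φ i 0) = a (openArc φ i) ∧ η (φ i 1) = b (openArc φ i)) ∨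
    (φ i 0 = φ i 1 ∧ η (φ i 0) = b (openArc φ i) ∧ ∀ x ∈ V, b (openArc φ i) ≤ η x) ∨
    (φ i 0 = φ i 1 ∧ η (φ i 0) = a (openArc φ i) ∧ ∀ x ∈ V, η x ≤ a (openArc φ i)) := by
    intro i
    obtain ⟨x, y, hl, hc⟩ := hs.link _ (hE i)
    have hlt := hs.lt _ (hE i)
    rcases hc with ⟨hx, hy⟩ | ⟨rfl, hx, hmin⟩ | ⟨rfl, hx, hmax⟩
    · left
      rw [h0, h1]
      rcases hl.eq_and_eq_or_eq_and_eq (h.isLink i) with ⟨rfl, rfl⟩ | ⟨rfl, rfl⟩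
      · exact ⟨hx, hy⟩
      · have := hf i
        rw [hx, hy] at this
        linarith
    · right; left
      have hx0 := (h.isLink i).left_eq_or_eq hl
      have hx1 := (h.isLink i).right_eq_or_eq hl
      rw [or_self] at hx0 hx1
      refine ⟨hx0.trans hx1.symm, by rw [h0, hx0, hx], fun z hz => ?_⟩
      rw [hη z hz, ← hx]
      exact hmin z hz
    · right; right
      have hx0 := (h.isLink i).left_eq_or_eq hl
      have hx1 := (h.isLink i).right_eq_or_eq hl
      rw [or_self] at hx0 hx1
      refine ⟨hx0.trans hx1.symm, by rw [h0, hx0, hx], fun z hz => ?_⟩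
      rw [hη z hz, ← hx]
      exact hmax z hz
  refine ⟨fun i => hs.lt _ (hE i), fun i t ht => ?_, fun x hx y hy hxy => ?_, hends,
    fun x hx => ?_, fun x hx => ?_, fun i j hi hj => ?_, fun i j hi hj => ?_⟩
  · have hex : ∃ p : ι × unitInterval, p.2 ∈ Ioo (0 : unitInterval) 1 ∧ φ p.1 p.2 = φ i t :=
      ⟨(i, t), ht, rfl⟩
    have hp : hex.choose = (i, t) := by
      obtain ⟨h2, h3⟩ := h.eq_of_eq hex.choose_spec.1 hex.choose_spec.2
      exact Prod.ext h2 h3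
    simp only [η, arcHeight]
    rw [if_neg (h.notMem i t ht), dif_pos hex, hp]
  · rw [hη x hx, hη y hy] at hxy
    exact hs.inj hx hy hxy
  · rintro ⟨z, hz, hzx⟩
    rw [hη z hz, hη x hx] at hzx
    obtain ⟨e, y, hl, hy, hx'⟩ := hs.down x hx ⟨z, hz, hzx⟩
    obtain ⟨i, rfl, rfl, rfl⟩ := hlink hl (by rw [hy, hx']; exact hs.lt _ hl.edge_mem)
    exact ⟨i, rfl, (h0 i).trans hy, (h1 i).trans hx'⟩
  · rintro ⟨z, hz, hzx⟩
    rw [hη z hz, hη x hx] at hzx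
    obtain ⟨e, y, hl, hx', hy⟩ := hs.up x hx ⟨z, hz, hzx⟩
    obtain ⟨i, rfl, rfl, rfl⟩ := hlink hl (by rw [hy, hx']; exact hs.lt _ hl.edge_mem)
    exact ⟨i, rfl, (h0 i).trans hx', (h1 i).trans hy⟩
  · have key : ∀ i, η (φ i 0) = b (openArc φ i) → ∀ z ∈ V, a (openArc φ i) < f z := by
      intro i hi z hz
      have hlt := hs.lt _ (hE i)
      rcases hends i with hc | hc | hc
      · rw [hc.1] at hi; linarith
      · have := hc.2.2 z hz
        rw [hη z hz] at this
        linarith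
      · rw [hc.2.1] at hi; linarith
    exact h.openArc_injective (hs.low_unique _ (hE i) _ (hE j) (key i hi) (key j hj))
  · have key : ∀ i, η (φ i 1) = a (openArc φ i) → ∀ z ∈ V, f z < b (openArc φ i) := by
      intro i hi z hz
      have hlt := hs.lt _ (hE i)
      rcases hends i with hc | hc | hc
      · rw [hc.2] at hi; linarith
      · rw [← hc.1, hc.2.1] at hi; linarith
      · have := hc.2.2 z hz
        rw [hη z hz] at this
        linarith
    exact h.openArc_injective (hs.high_unique _ (hE i) _ (hE j) (key i hi) (key j hj))

theorem Drawing.reindex {κ : Type*} (h : Drawing V φ) (ε : κ ≃ ι) :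
    Drawing V (fun k => φ (ε k)) where
  finite := h.finite
  cont k := h.cont _
  zero_mem k := h.zero_mem _
  one_mem k := h.one_mem _
  notMem k := h.notMem _
  inj k l s hs t ht heq := by
    obtain ⟨h1, h2⟩ := h.inj _ _ s hs t ht heq
    exact ⟨ε.injective h1, h2⟩
  cover x := by
    refine (h.cover x).imp_right ?_
    rintro ⟨i, t, ht, rfl⟩
    exact ⟨ε.symm i, t, ht, by rw [Equiv.apply_symm_apply]⟩

/-- The standard drawing of a tangle identifies its edges with the unit interval. -/
theorem IsTangle.exists_edgeDrawing (hT : IsTangle T) (p : T) :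
    ∃ φ : edges T → unitInterval → T, Drawing (tangleVertices p) φ ∧ IsEdgeIdentification φ := by
  obtain ⟨_, _, _, -⟩ := hT.facts
  obtain ⟨ι, _, φ, h⟩ := hT.exists_drawing p
  have main : ∀ ε : edges T ≃ ι, (∀ e, openArc φ (ε e) ⊆ e.1 ∧ range (φ (ε e)) = closure e.1) →
      ∃ φ : edges T → unitInterval → T, Drawing (tangleVertices p) φ ∧ IsEdgeIdentification φ := by
    intro ε hε
    refine ⟨fun e => φ (ε e), h.reindex ε, fun e => h.cont _, fun e s hs t ht heq => ?_,
      fun e t ht => (hε e).1 ⟨t, ht, rfl⟩, fun e => (hε e).2⟩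
    exact (h.inj _ _ s hs t ht heq).2
  by_cases hsing : ∃ y : T, IsSingular y
  · have hE : edges T = range (openArc φ) := by
      rw [edges_eq_of_singular p hsing, h.componentsOf_compl]
    let ε : edges T ≃ ι := (Equiv.setCongr hE).trans (Equiv.ofInjective _ h.openArc_injective).symm
    have hε : ∀ e, openArc φ (ε e) = e.1 := fun e =>
      Equiv.apply_ofInjective_symm h.openArc_injective (Equiv.setCongr hE e)
    exact main ε fun e => ⟨(hε e).subset, by rw [h.range_eq_closure, hε e]⟩
  · have hns := not_exists.1 hsing
    have hV : tangleVertices p = {p} := by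
      ext x
      exact ⟨fun hx => (hx.resolve_left (hns x)).2, fun hx => Or.inr ⟨hns, hx⟩⟩
    have hE : edges T = {univ} := edges_eq_of_circle hns
    -- On the circle every arc starts and finishes at `p`, which has exactly two half-edges, so
    -- there is a single arc.
    have hhalf : halfEdges φ p = univ := by
      refine eq_univ_of_forall fun ⟨i, c⟩ => ?_
      have : endPt φ (i, c) ∈ tangleVertices p := by
        cases c
        exacts [h.zero_mem i, h.one_mem i]
      rw [hV] at this
      exact this
    have hcard : Nat.card ι = 1 := by
      have := (h.isSingular_iff (v := p) (hV ▸ rfl)).not.1 (hns p)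
      rw [not_not, hhalf, ncard_univ, Nat.card_prod, Nat.card_eq_fintype_card (α := Bool),
        Fintype.card_bool] at this
      omega
    obtain ⟨hsub, ⟨i₀⟩⟩ := Nat.card_eq_one_iff_unique.1 hcard
    have : Unique ι := ⟨⟨i₀⟩, fun j => Subsingleton.elim j i₀⟩
    have : Unique (edges T) := by
      rw [hE]
      infer_instance
    refine main (Equiv.ofUnique _ _) fun e => ?_
    have he : e.1 = univ := hE.subset e.2
    rw [he, closure_univ]
    refine ⟨subset_univ _, eq_univ_of_forall fun x => ?_⟩
    rcases h.cover x with hx | ⟨i, t, -, rfl⟩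
    · rw [hV] at hx
      have h0 := h.zero_mem (Equiv.ofUnique (edges T) ι e)
      rw [hV] at h0
      exact ⟨0, Eq.trans h0 hx.symm⟩
    · exact ⟨t, by rw [Subsingleton.elim i (Equiv.ofUnique (edges T) ι e)]⟩

end DrawnGraph

/-! ## From forks to cutsets -/

section ForkCutset

open scoped Graph

variable {T : Type*} [TopologicalSpace T]

/-- A connected set that is open and closed relative to `S` is a full component of `S`. -/
theorem mem_componentsOf {C S : Set T} (hC : IsConnected C) (hCS : C ⊆ S) (ho : IsOpen C)
    (hcl : closure C ∩ S ⊆ C) : C ∈ componentsOf S := by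
  obtain ⟨x, hx⟩ := hC.nonempty
  refine ⟨x, hCS hx, (hC.isPreconnected.subset_connectedComponentIn hx hCS).antisymm ?_⟩
  refine isPreconnected_connectedComponentIn.subset_left_of_subset_union ho
    isClosed_closure.isOpen_compl (disjoint_compl_right.mono_left subset_closure) (fun y hy => ?_)
    ⟨x, mem_connectedComponentIn (hCS hx), hx⟩
  by_cases hy' : y ∈ closure C
  · exact Or.inl (hcl ⟨hy', connectedComponentIn_subset _ _ hy⟩)
  · exact Or.inr hy'

/-- The part of the space that belongs to a set of vertices and edges. -/
def realize (D : Set (T ⊕ Set T)) : Set T := {x | Sum.inl x ∈ D ∨ ∃ e, Sum.inr e ∈ D ∧ x ∈ e}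

variable {ι : Type*} {V : Set T} {φ : ι → unitInterval → T} {u : Fin 3 → T}
  {D : Fin 3 → Set (T ⊕ Set T)}

theorem Fork.inl_mem_vertices (h : Fork (subdivideOnce (drawnGraph V)) (fun i => Sum.inl (u i)) D)
    {i : Fin 3} {x : T} (hx : Sum.inl x ∈ D i) : x ∈ V :=
  inl_mem_subdivideOnce.1 (h.subset i hx)

theorem Fork.inr_eq_openArc [Finite ι] [T2Space T] (hd : Drawing V φ)
    (h : Fork (subdivideOnce (drawnGraph V)) (fun i => Sum.inl (u i)) D) {i : Fin 3} {e : Set T}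
    (he : Sum.inr e ∈ D i) : ∃ k, openArc φ k = e :=
  hd.edgeSet_eq.subset (inr_mem_subdivideOnce.1 (h.subset i he))

theorem Fork.mem_vertices
    (h : Fork (subdivideOnce (drawnGraph V)) (fun i => Sum.inl (u i)) D) (i : Fin 3) : u i ∈ V := by
  obtain ⟨y, -, hy⟩ := h.adj i
  exact inl_mem_subdivideOnce.1 hy.left_mem

theorem Fork.realize_eq [Finite ι] [T2Space T] (hd : Drawing V φ)
    (h : Fork (subdivideOnce (drawnGraph V)) (fun i => Sum.inl (u i)) D) (i : Fin 3) :
    realize (D i) = {x | Sum.inl x ∈ D i} ∪ ⋃ k ∈ {k | Sum.inr (openArc φ k) ∈ D i}, openArc φ k := by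
  ext x
  constructor
  · rintro (hx | ⟨e, he, hx⟩)
    · exact Or.inl hx
    · obtain ⟨k, rfl⟩ := h.inr_eq_openArc hd he
      exact Or.inr (mem_biUnion he hx)
  · rintro (hx | hx)
    · exact Or.inl hx
    · obtain ⟨k, hk, hx⟩ := mem_iUnion₂.1 hx
      exact Or.inr ⟨_, hk, hx⟩

theorem Fork.mem_realize_vertex [Finite ι] [T2Space T] (hd : Drawing V φ)
    (h : Fork (subdivideOnce (drawnGraph V)) (fun i => Sum.inl (u i)) D) {i : Fin 3} {x : T}
    (hx : x ∈ V) : x ∈ realize (D i) ↔ Sum.inl x ∈ D i := by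
  refine ⟨?_, Or.inl⟩
  rintro (hx' | ⟨e, he, hxe⟩)
  · exact hx'
  · obtain ⟨k, rfl⟩ := h.inr_eq_openArc hd he
    obtain ⟨t, ht, rfl⟩ := hxe
    exact absurd hx (hd.notMem k t ht)

theorem Fork.mem_realize_arc [Finite ι] [T2Space T] (hd : Drawing V φ)
    (h : Fork (subdivideOnce (drawnGraph V)) (fun i => Sum.inl (u i)) D) {i : Fin 3} {k : ι}
    {t : unitInterval} (ht : t ∈ Ioo (0 : unitInterval) 1) :
    φ k t ∈ realize (D i) ↔ Sum.inr (openArc φ k) ∈ D i := by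
  refine ⟨?_, fun hk => Or.inr ⟨_, hk, t, ht, rfl⟩⟩
  rintro (hx' | ⟨e, he, hxe⟩)
  · exact absurd (h.inl_mem_vertices hx') (hd.notMem k t ht)
  · obtain ⟨l, rfl⟩ := h.inr_eq_openArc hd he
    rwa [hd.openArc_inj ⟨_, ⟨t, ht, rfl⟩, hxe⟩]

theorem Fork.disjoint_realize [Finite ι] [T2Space T] (hd : Drawing V φ)
    (h : Fork (subdivideOnce (drawnGraph V)) (fun i => Sum.inl (u i)) D) {i j : Fin 3}
    (hij : i ≠ j) : Disjoint (realize (D i)) (realize (D j)) := by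
  rw [Set.disjoint_left]
  intro x hx hx'
  rcases hd.cover x with hxV | ⟨k, t, ht, rfl⟩
  · rw [h.mem_realize_vertex hd hxV] at hx hx'
    exact (h.disjoint i j hij).le_bot ⟨hx, hx'⟩
  · rw [h.mem_realize_arc hd ht] at hx hx'
    exact (h.disjoint i j hij).le_bot ⟨hx, hx'⟩

theorem Fork.notMem_realize [Finite ι] [T2Space T] (hd : Drawing V φ)
    (h : Fork (subdivideOnce (drawnGraph V)) (fun i => Sum.inl (u i)) D) (i j : Fin 3) :
    u i ∉ realize (D j) := by
  rw [h.mem_realize_vertex hd (h.mem_vertices i)]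
  exact h.notMem i j

/-- An end of an edge of a fork is in the fork or is the attaching vertex. -/
theorem Fork.ends_mem [Finite ι] [T2Space T] (hd : Drawing V φ)
    (h : Fork (subdivideOnce (drawnGraph V)) (fun i => Sum.inl (u i)) D) {i : Fin 3} {k : ι}
    (hk : Sum.inr (openArc φ k) ∈ D i) (t : unitInterval) :
    φ k t ∈ insert (u i) (realize (D i)) := by
  rcases unitInterval_trichotomy t with rfl | rfl | ht
  · exact (h.inl_mem_or hk (hd.isLink k).inc_left).symm.imp id Or.inl
  · exact (h.inl_mem_or hk (hd.isLink k).inc_right).symm.imp id Or.inl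
  · exact Or.inr ((h.mem_realize_arc hd ht).2 hk)

theorem Fork.isClosed_insert [Finite ι] [T2Space T] (hd : Drawing V φ)
    (h : Fork (subdivideOnce (drawnGraph V)) (fun i => Sum.inl (u i)) D) (i : Fin 3) :
    IsClosed (insert (u i) (realize (D i))) := by
  classical
  have hcl := hd.isClosed_union (V' := insert (u i) {x | Sum.inl x ∈ D i})
    (insert_subset (h.mem_vertices i) fun x hx => h.inl_mem_vertices hx)
    (J := fun k => if Sum.inr (openArc φ k) ∈ D i then univ else ∅) fun k => by
      split_ifs
      exacts [isClosed_univ, isClosed_empty]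
  convert hcl using 1
  ext x
  constructor
  · rintro (rfl | hx)
    · exact Or.inl (mem_insert _ _)
    · rw [h.realize_eq hd] at hx
      rcases hx with hx | hx
      · exact Or.inl (Or.inr hx)
      · obtain ⟨k, hk, t, ht, rfl⟩ := mem_iUnion₂.1 hx
        exact Or.inr (mem_iUnion.2 ⟨k, t, by rw [if_pos (show Sum.inr (openArc φ k) ∈ D i from hk)]; trivial, rfl⟩)
  · rintro ((rfl | hx) | hx)
    · exact mem_insert _ _
    · exact Or.inr (Or.inl hx)
    · obtain ⟨k, t, ht, rfl⟩ := mem_iUnion.1 hx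
      by_cases hk : Sum.inr (openArc φ k) ∈ D i
      · exact h.ends_mem hd hk t
      · rw [if_neg hk] at ht
        exact absurd ht (notMem_empty _)

theorem Fork.isOpen_realize [Finite ι] [T2Space T] (hd : Drawing V φ)
    (h : Fork (subdivideOnce (drawnGraph V)) (fun i => Sum.inl (u i)) D) (i : Fin 3) :
    IsOpen (realize (D i)) := by
  classical
  have hcl := hd.isClosed_union (V' := V \ {x | Sum.inl x ∈ D i}) sdiff_subset
    (J := fun k => if Sum.inr (openArc φ k) ∈ D i then ∅ else univ) fun k => by
      split_ifs
      exacts [isClosed_empty, isClosed_univ]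
  rw [← isClosed_compl_iff]
  convert hcl using 1
  ext x
  constructor
  · intro hx
    rcases hd.cover x with hxV | ⟨k, t, ht, rfl⟩
    · exact Or.inl ⟨hxV, fun hxD => hx (Or.inl hxD)⟩
    · refine Or.inr (mem_iUnion.2 ⟨k, t, ?_, rfl⟩)
      rw [if_neg fun hk => hx ((h.mem_realize_arc hd ht).2 hk)]
      trivial
  · rintro (hx | hx) hxD
    · exact hx.2 ((h.mem_realize_vertex hd hx.1).1 hxD)
    · obtain ⟨k, t, ht, rfl⟩ := mem_iUnion.1 hx
      by_cases hk : Sum.inr (openArc φ k) ∈ D i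
      · rw [if_pos hk] at ht
        exact ht
      · apply hk
        rcases unitInterval_trichotomy t with rfl | rfl | ht'
        · exact h.inr_mem ((h.mem_realize_vertex hd (hd.zero_mem k)).1 hxD) (hd.isLink k).inc_left
        · exact h.inr_mem ((h.mem_realize_vertex hd (hd.one_mem k)).1 hxD) (hd.isLink k).inc_right
        · exact (h.mem_realize_arc hd ht').1 hxD

theorem Fork.isConnected_realize [Finite ι] [T2Space T] (hd : Drawing V φ)
    (h : Fork (subdivideOnce (drawnGraph V)) (fun i => Sum.inl (u i)) D) (i : Fin 3) :
    IsConnected (realize (D i)) := by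
  -- Each vertex of the part stands for a point and each edge for its closure without the attaching
  -- vertex. These sets are connected, they overlap along the adjacencies of the part, and their
  -- union adds nothing to it.
  let s : T ⊕ Set T → Set T := Sum.elim (fun x => {x}) fun e => closure e \ {u i}
  have hsub : ∀ {k}, openArc φ k ⊆ s (Sum.inr (openArc φ k)) := by
    rintro k x ⟨t, ht, rfl⟩
    exact ⟨subset_closure ⟨t, ht, rfl⟩, fun heq =>
      hd.notMem k t ht ((heq : φ k t = u i) ▸ h.mem_vertices i)⟩
  have hmeet : ∀ {x e}, Sum.inl x ∈ D i → Sum.inr e ∈ D i → (drawnGraph V).Inc e x →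
      (s (Sum.inl x) ∩ s (Sum.inr e)).Nonempty := by
    intro x e hx he hinc
    obtain ⟨k, rfl⟩ := h.inr_eq_openArc hd he
    refine ⟨x, rfl, ?_, fun heq => h.notMem i i ((heq : x = u i) ▸ hx)⟩
    rw [← hd.range_eq_closure]
    rcases hd.inc_iff.1 hinc with rfl | rfl
    exacts [mem_range_self _, mem_range_self _]
  have heq : realize (D i) = ⋃ w ∈ D i, s w := by
    ext x
    constructor
    · rintro (hx | ⟨e, he, hx⟩)
      · exact mem_biUnion hx rfl
      · obtain ⟨k, rfl⟩ := h.inr_eq_openArc hd he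
        exact mem_biUnion he (hsub hx)
    · intro hx
      obtain ⟨w, hw, hx⟩ := mem_iUnion₂.1 hx
      cases w with
      | inl y =>
        obtain rfl : x = y := hx
        exact Or.inl hw
      | inr e =>
        obtain ⟨k, rfl⟩ := h.inr_eq_openArc hd hw
        obtain ⟨hx, hxu⟩ := hx
        rw [← hd.range_eq_closure] at hx
        obtain ⟨t, rfl⟩ := hx
        exact (h.ends_mem hd hw t).resolve_left hxu
  rw [heq]
  obtain ⟨y, hy, -⟩ := h.adj i
  refine IsConnected.biUnion_of_reflTransGen ⟨y, hy⟩ (fun w hw => ?_) fun w hw w' hw' => ?_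
  · cases w with
    | inl x => exact isConnected_singleton
    | inr e =>
      obtain ⟨k, rfl⟩ := h.inr_eq_openArc hd hw
      exact (hd.isConnected_openArc k).subset_closure hsub sdiff_subset
  · refine Relation.ReflTransGen.mono (fun a b hab => ⟨?_, hab.2.1⟩) _ _ (h.conn i w hw w' hw')
    obtain ⟨hadj, ha, hb⟩ := hab
    rcases subdivideOnce_adj.1 hadj with ⟨x, e, hinc, rfl, rfl⟩ | ⟨x, e, hinc, rfl, rfl⟩
    · exact hmeet ha hb hinc
    · rw [inter_comm]
      exact hmeet hb ha hinc

theorem Fork.mem_closure_realize [Finite ι] [T2Space T] (hd : Drawing V φ)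
    (h : Fork (subdivideOnce (drawnGraph V)) (fun i => Sum.inl (u i)) D) (i : Fin 3) :
    u i ∈ closure (realize (D i)) := by
  obtain ⟨e, he, hinc⟩ := h.exists_inr_mem i
  obtain ⟨k, rfl⟩ := h.inr_eq_openArc hd he
  refine closure_mono (fun x hx => Or.inr ⟨_, he, hx⟩ : openArc φ k ⊆ realize (D i)) ?_
  rw [← hd.range_eq_closure]
  rcases hd.inc_iff.1 hinc with heq | heq <;> rw [heq]
  exacts [mem_range_self _, mem_range_self _]

/-- Removing the three parts of a fork leaves a connected set. -/
theorem Fork.isConnected_compl [Finite ι] [T2Space T] [ConnectedSpace T] (hd : Drawing V φ)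
    (h : Fork (subdivideOnce (drawnGraph V)) (fun i => Sum.inl (u i)) D) :
    IsConnected (⋃ i, realize (D i))ᶜ := by
  classical
  -- The topological collapse: each part goes to its attaching vertex. It is continuous because a
  -- part becomes closed by adding that vertex, so the complement is a continuous image of the
  -- connected space.
  let ρ : T → T := fun x => if hx : ∃ i, x ∈ realize (D i) then u hx.choose else x
  have hρD : ∀ {x i}, x ∈ realize (D i) → ρ x = u i := by
    intro x i hx
    have hex : ∃ i, x ∈ realize (D i) := ⟨i, hx⟩
    have : hex.choose = i := by
      by_contra hne
      exact (h.disjoint_realize hd hne).le_bot ⟨hex.choose_spec, hx⟩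
    simp only [ρ]
    rw [dif_pos hex, this]
  have hρX : ∀ {x}, x ∈ (⋃ i, realize (D i))ᶜ → ρ x = x := by
    intro x hx
    simp only [ρ]
    rw [dif_neg fun hex => hx (mem_iUnion.2 hex)]
  have huX : ∀ i, u i ∈ (⋃ i, realize (D i))ᶜ := fun i hi => by
    obtain ⟨j, hj⟩ := mem_iUnion.1 hi
    exact h.notMem_realize hd i j hj
  have hcases : ∀ x, (∃ i, x ∈ realize (D i)) ∨ x ∈ (⋃ i, realize (D i))ᶜ := by
    intro x
    by_cases hx : x ∈ ⋃ i, realize (D i)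
    · exact Or.inl (mem_iUnion.1 hx)
    · exact Or.inr hx
  have hcont : Continuous ρ := by
    rw [continuous_iff_isClosed]
    intro Z hZ
    have heq : ρ ⁻¹' Z = (Z ∩ (⋃ i, realize (D i))ᶜ) ∪
        ⋃ i ∈ {i | u i ∈ Z}, insert (u i) (realize (D i)) := by
      ext x
      constructor
      · intro hx
        rcases hcases x with ⟨i, hi⟩ | hxX
        · rw [mem_preimage, hρD hi] at hx
          exact Or.inr (mem_biUnion hx (Or.inr hi))
        · rw [mem_preimage, hρX hxX] at hx
          exact Or.inl ⟨hx, hxX⟩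
      · rintro (⟨hx, hxX⟩ | hx)
        · rwa [mem_preimage, hρX hxX]
        · obtain ⟨i, hi, rfl | hx⟩ := mem_iUnion₂.1 hx
          · rw [mem_preimage, hρX (huX i)]
            exact hi
          · rw [mem_preimage, hρD hx]
            exact hi
    rw [heq]
    exact (hZ.inter (isOpen_iUnion fun i => h.isOpen_realize hd i).isClosed_compl).union
      ((toFinite _).isClosed_biUnion fun i _ => h.isClosed_insert hd i)
  have hrange : range ρ = (⋃ i, realize (D i))ᶜ := by
    apply Subset.antisymm
    · rintro _ ⟨x, rfl⟩
      rcases hcases x with ⟨i, hi⟩ | hxX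
      · rw [hρD hi]; exact huX i
      · rw [hρX hxX]; exact hxX
    · exact fun x hx => ⟨x, hρX hx⟩
  exact hrange ▸ isConnected_range hcont

/-- If the attaching vertices coincide, that point is the cutset. If they are distinct, the cutset
is the whole complement of the three parts, whose contact points are exactly these three vertices.
-/
theorem Fork.hasGenGapCutset [Finite ι] [T2Space T] [ConnectedSpace T] (hd : Drawing V φ)
    (h : Fork (subdivideOnce (drawnGraph V)) (fun i => Sum.inl (u i)) D)
    (hV : V = {x | IsSingular x}) : HasGenGapCutset T 1 := by
  have hE : edges T = range (openArc φ) := by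
    rw [← hd.componentsOf_compl, hV]
    rfl
  have huS : ∀ i, IsSingular (u i) := fun i => hV.subset (h.mem_vertices i)
  have hclosure : ∀ i, closure (realize (D i)) ⊆ insert (u i) (realize (D i)) := fun i =>
    closure_minimal (subset_insert _ _) (h.isClosed_insert hd i)
  have main : ∀ X : Set T, IsSubtangle X → IsConnected X → (∀ i, realize (D i) ⊆ Xᶜ) →
      (∀ i, u i ∈ X) → ((∃ p, X = {p}) ∨ Function.Injective u) → HasGenGapCutset T 1 := by
    intro X hX hXc hsub huX htype
    have hcontact : ∀ i, X ∩ closure (realize (D i)) ⊆ {u i} := by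
      rintro i x ⟨hxX, hx⟩
      rcases hclosure i hx with rfl | hx
      · rfl
      · exact absurd hxX (hsub i hx)
    refine ⟨fun _ => X, fun j => realize (D j), fun _ => hX, fun _ => hXc,
      fun i i' hii => absurd (Subsingleton.elim i i') hii, fun j => ?_, fun i j hij => ?_,
      fun _ j => subsingleton_singleton.anti (hcontact j), fun _ => ?_⟩
    · rw [iUnion_const]
      refine mem_componentsOf (h.isConnected_realize hd j) (hsub j) (h.isOpen_realize hd j) ?_
      rintro x ⟨hx, hxX⟩
      refine (hclosure j hx).resolve_left ?_
      rintro rfl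
      exact hxX (huX j)
    · by_contra hne
      obtain ⟨x, hx⟩ := (h.isConnected_realize hd i).nonempty
      have hx' : x ∈ realize (D j) := hij ▸ hx
      exact (h.disjoint_realize hd hne).le_bot ⟨hx, hx'⟩
    · refine htype.imp_right fun hinj => ⟨⟨u 0, huX 0, u 1, huX 1, hinj.ne (by decide)⟩, ?_, ?_⟩
      · have : {j : Fin 3 | (X ∩ closure (realize (D j))).Nonempty} = univ :=
          eq_univ_of_forall fun j => ⟨u j, huX j, h.mem_closure_realize hd j⟩
        exact (congrArg ncard this).trans (by simp)
      · intro j j' hjj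
        refine Disjoint.mono (hcontact j) (hcontact j') ?_
        exact disjoint_singleton.2 (hinj.ne hjj)
  rcases h.normal with hn | hn
  · have hu : ∀ i, u i = u 0 := fun i => Sum.inl_injective (hn i)
    refine main {u 0} ⟨{u 0}, ∅, singleton_nonempty _, ?_, empty_subset _, by simp, by simp⟩
      isConnected_singleton (fun i => ?_) hu (Or.inl ⟨_, rfl⟩)
    · rintro x rfl
      exact huS 0
    · rintro x hx rfl
      exact h.notMem_realize hd 0 i hx
  · have huX : ∀ i, u i ∈ (⋃ i, realize (D i))ᶜ := fun i hi => by
      obtain ⟨j, hj⟩ := mem_iUnion.1 hi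
      exact h.notMem_realize hd i j hj
    refine main (⋃ i, realize (D i))ᶜ ⟨V ∩ (⋃ i, realize (D i))ᶜ,
      {e | ∃ k, openArc φ k = e ∧ ∀ i, Sum.inr e ∉ D i}, ⟨u 0, h.mem_vertices 0, huX 0⟩, ?_, ?_,
      ?_, ?_⟩ (h.isConnected_compl hd) (fun i => ?_) huX
      (Or.inr fun i j hij => hn (congrArg Sum.inl hij))
    · exact fun x hx => hV.subset hx.1
    · rintro e ⟨k, rfl, -⟩
      rw [hE]
      exact ⟨k, rfl⟩
    · rintro e ⟨k, rfl, hk⟩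
      rw [hd.closure_diff]
      have key : ∀ x ∈ V, (drawnGraph V).Inc (openArc φ k) x →
          x ∈ V ∩ (⋃ i, realize (D i))ᶜ := by
        refine fun x hx hinc => ⟨hx, fun hxD => ?_⟩
        obtain ⟨i, hi⟩ := mem_iUnion.1 hxD
        exact hk i (h.inr_mem ((h.mem_realize_vertex hd hx).1 hi) hinc)
      rintro x (rfl | rfl)
      · exact key _ (hd.zero_mem k) (hd.isLink k).inc_left
      · exact key _ (hd.one_mem k) (hd.isLink k).inc_right
    · ext x
      constructor
      · intro hx
        rcases hd.cover x with hxV | ⟨k, t, ht, rfl⟩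
        · exact Or.inl ⟨hxV, hx⟩
        · refine Or.inr ⟨openArc φ k, ⟨k, rfl, fun i hi => hx (mem_iUnion.2 ⟨i, ?_⟩)⟩, t, ht, rfl⟩
          exact (h.mem_realize_arc hd ht).2 hi
      · rintro (hx | ⟨_, ⟨k, rfl, hk⟩, t, ht, rfl⟩)
        · exact hx.2
        · intro hxD
          obtain ⟨i, hi⟩ := mem_iUnion.1 hxD
          exact hk i ((h.mem_realize_arc hd ht).1 hi)
    · rw [compl_compl]
      exact subset_iUnion (fun i => realize (D i)) i

/-- The vertices must be singular, so the circle has to be excluded: its only vertex has two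
half-edges, while a fork has three different edges there. -/
theorem IsTangle.hasGenGapCutset_of_fork (hT : IsTangle T) (p : T)
    (h : Fork (subdivideOnce (drawnGraph (tangleVertices p))) (fun i => Sum.inl (u i)) D) :
    HasGenGapCutset T 1 := by
  obtain ⟨_, _, _, -⟩ := hT.facts
  obtain ⟨ι, _, φ, hd⟩ := hT.exists_drawing p
  refine h.hasGenGapCutset hd (tangleVertices_eq p ?_)
  by_contra hns
  have hns := not_exists.1 hns
  have hV : tangleVertices p = {p} := by
    ext x
    exact ⟨fun hx => (hx.resolve_left (hns x)).2, fun hx => Or.inr ⟨hns, hx⟩⟩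
  have hcard : (halfEdges φ p).ncard = 2 := by
    have := (hd.isSingular_iff (v := p) (hV ▸ rfl)).not.1 (hns p)
    rwa [not_not] at this
  choose e he _ using h.exists_inr_mem
  choose k hk using fun i => h.inr_eq_openArc hd (he i)
  have hinj : Function.Injective fun i => (k i, false) := by
    intro i j hij
    by_contra hne
    have hkij : k i = k j := congrArg Prod.fst hij
    refine (h.disjoint i j hne).le_bot ⟨he i, ?_⟩
    rw [← hk i, hkij, hk j]
    exact he j
  have hsub : range (fun i => (k i, false)) ⊆ halfEdges φ p := by
    rintro _ ⟨i, rfl⟩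
    have := hd.zero_mem (k i)
    rw [hV] at this
    exact this
  have := ncard_le_ncard hsub (toFinite _)
  rw [hcard, ← image_univ, ncard_image_of_injective _ hinj, ncard_univ, Nat.card_fin] at this
  omega

end ForkCutset

/-! ## The equivalences -/

section Main

open scoped Graph

variable {T : Type*} [TopologicalSpace T]

/-- A numbering gives (2), (3) and the block and trident statements through sweeps. A cutset
contradicts (2) and (3), and a fork, present when there is no numbering, contradicts (4) to (7). -/
theorem IsTangle.tfae (hT : IsTangle T) (p : T) : List.TFAE [
    HasBipolarNumbering (subdivideOnce (tangleGraph p)),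
    HasBipolarOrdering T,
    GuaranteesConnectedEF T 2,
    ¬ HasGenGapCutset T 1,
    IsPathGraph (blockGraph (tangleGraph p)),
    IsPathGraph (blockGraph (subdivideOnce (tangleGraph p))),
    ¬ HasTrident (subdivideOnce (tangleGraph p))] := by
  obtain ⟨_, _, _, -⟩ := hT.facts
  have : Finite (edges T) := hT.finite_edges
  obtain ⟨φ, hd, hφ⟩ := hT.exists_edgeDrawing p
  change List.TFAE [
    HasBipolarNumbering (subdivideOnce (drawnGraph (tangleVertices p))),
    HasBipolarOrdering T,
    GuaranteesConnectedEF T 2,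
    ¬ HasGenGapCutset T 1,
    IsPathGraph (blockGraph (drawnGraph (tangleVertices p))),
    IsPathGraph (blockGraph (subdivideOnce (drawnGraph (tangleVertices p)))),
    ¬ HasTrident (subdivideOnce (drawnGraph (tangleVertices p)))]
  set G := drawnGraph (tangleVertices p)
  have hV : V(G).Finite := hd.finite
  have hE : E(G).Finite := hd.edgeSet_eq ▸ finite_range _
  obtain ⟨e₀, t₀, he₀⟩ := hd.exists_eq p
  have hVne : (tangleVertices p).Nonempty := ⟨_, hd.zero_mem e₀⟩
  have hEne : E(G).Nonempty := ⟨_, (hd.isLink e₀).edge_mem⟩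
  have hG : GraphConnected G := hd.graphConnected hVne
  have hH : GraphConnected (subdivideOnce G) := hG.subdivideOnce
  obtain ⟨hHV, hHE⟩ := finite_subdivideOnce hV hE
  have hHEne := edgeSet_subdivideOnce_nonempty hEne
  have hsweep : HasBipolarNumbering (subdivideOnce G) →
      ∃ (f : T → ℝ) (a b : Set T → ℝ), Sweep G f a b := by
    intro h
    obtain ⟨-, g, hg⟩ := h.exists_numbered
    exact ⟨_, _, _, hg.sweep_subdivideOnce hHV⟩
  have hsweeping : HasBipolarNumbering (subdivideOnce G) →
      ∃ (ψ : edges T → unitInterval → T) (a b : edges T → ℝ) (η : T → ℝ),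
        Drawing (tangleVertices p) ψ ∧ IsEdgeIdentification ψ ∧
          Sweeping (tangleVertices p) ψ a b η := by
    intro h
    obtain ⟨f, a, b, hs⟩ := hsweep h
    -- The arcs are redirected so that they run upwards in the height `f`; this changes neither the
    -- drawing nor the identification of edges in any essential way.
    let c : edges T → Bool := fun e => decide (f (φ e 1) < f (φ e 0))
    refine ⟨flipArcs φ c, _, _, _, hd.flip c, hφ.flip c, hs.sweeping (hd.flip c) fun e => ?_⟩
    by_cases hc : f (φ e 1) < f (φ e 0)
    · have : c e = true := decide_eq_true hc
      simp only [flipArcs, this, if_true, Function.comp_apply, unitInterval.symm_zero,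
        unitInterval.symm_one]
      exact hc.le
    · have : c e = false := decide_eq_false hc
      simp only [flipArcs, this, Bool.false_eq_true, if_false]
      exact not_lt.1 hc
  have hfork : ¬ HasBipolarNumbering (subdivideOnce G) →
      ∃ (u : Fin 3 → T) (D : Fin 3 → Set (T ⊕ Set T)),
        Fork (subdivideOnce G) (fun i => Sum.inl (u i)) D := exists_fork hHV hH hEne
  tfae_have 1 → 2 := by
    intro h
    obtain ⟨ψ, a, b, η, hψ, -, hs⟩ := hsweeping h
    exact hs.hasBipolarOrdering hψ
  tfae_have 1 → 3 := by
    intro h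
    obtain ⟨ψ, a, b, η, hψ, hψ', hs⟩ := hsweeping h
    exact hs.guaranteesConnectedEF hψ hψ'
  tfae_have 2 → 4 := by
    intro h hcut
    obtain ⟨C, s, hC⟩ := hT.exists_threeEnds hcut
    exact hC.not_hasBipolarOrdering h
  tfae_have 3 → 4 := by
    intro h hcut
    obtain ⟨C, s, hC⟩ := hT.exists_threeEnds hcut
    exact hT.not_guarantees_of_threeEnds hC h
  tfae_have 4 → 1 := by
    contrapose!
    intro h
    obtain ⟨u, D, hD⟩ := hfork h
    exact hT.hasGenGapCutset_of_fork p hD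
  tfae_have 1 → 5 := by
    intro h
    obtain ⟨f, a, b, hs⟩ := hsweep h
    exact hs.isPathGraph hV hE hEne
  tfae_have 5 → 1 := by
    contrapose
    intro h
    obtain ⟨u, D, hD⟩ := hfork h
    exact not_isPathGraph_of_isSplit hV hE hG (fun i => (hD.isSplit_original i).1)
      fun i => (hD.isSplit_original i).2
  tfae_have 1 → 6 := by
    intro h
    obtain ⟨-, g, hg⟩ := h.exists_numbered
    exact (hg.sweep subdivideOnce_not_loop).isPathGraph hHV hHE hHEne
  tfae_have 6 → 1 := by
    contrapose
    intro h
    obtain ⟨u, D, hD⟩ := hfork h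
    exact not_isPathGraph_of_isSplit hHV hHE hH (fun i => (hD.isSplit i).1)
      fun i => (hD.isSplit i).2
  tfae_have 1 → 7 := by
    intro h
    obtain ⟨-, g, hg⟩ := h.exists_numbered
    exact hg.not_hasTrident hHV
  tfae_have 7 → 1 := by
    contrapose!
    intro h
    obtain ⟨u, D, hD⟩ := hfork h
    exact hD.hasTrident hH
  tfae_finish

end Main

end TangleDivision

theorem mainTheorem6 {T : Type*} [TopologicalSpace T] (hT : TangleDivision.IsTangle T) :
    (∀ p : T, List.TFAE [
      TangleDivision.HasBipolarNumbering
        (TangleDivision.subdivideOnce (TangleDivision.tangleGraph p)),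
      TangleDivision.HasBipolarOrdering T,
      TangleDivision.GuaranteesConnectedEF T 2,
      ¬ TangleDivision.HasGenGapCutset T 1,
      TangleDivision.IsPathGraph
        (TangleDivision.blockGraph (TangleDivision.tangleGraph p)),
      TangleDivision.IsPathGraph
        (TangleDivision.blockGraph
          (TangleDivision.subdivideOnce (TangleDivision.tangleGraph p))),
      ¬ TangleDivision.HasTrident
        (TangleDivision.subdivideOnce (TangleDivision.tangleGraph p))]) ∧
    List.TFAE [
      TangleDivision.HasBipolarOrdering T,
      TangleDivision.GuaranteesConnectedEF T 2,
      ¬ TangleDivision.HasGenGapCutset T 1] := by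
  refine ⟨hT.tfae, ?_⟩
  obtain ⟨p⟩ := hT.1.toNonempty
  have h := hT.tfae p
  tfae_have 1 ↔ 2 := h.out 1 2
  tfae_have 2 ↔ 3 := h.out 2 3
  tfae_finish
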